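/- Let $N\cong\mathbb Z^d$ be a lattice of even rank $d\ge 0$, $M$ the dual lattice, and let $\Sigma$ be a complete fan of strongly convex rational polyhedral cones in $N_{\mathbb R}$, with toric variety $\mathbf P$. Assume that $\mathbf P$ is Gorenstein, i.e. that there is a function $\deg:N\to\mathbb Z$ which is linear on every cone of $\Sigma$ and equals $1$ on the primitive generators of the one-dimensional cones. Put $$G(y,q)=\prod_{k\ge 1}\frac{(1-yq^{k-1})(1-y^{-1}q^k)}{(1-q^k)^2},$$ $$Ell(\mathbf P,y,q)=y^{-d/2}\sum_{m\in M}\Big(\sum_{C\in\Sigma}(-1)^{\operatorname{codim}C}\sum_{n\in C\cap N}q^{m\cdot n}y^{\deg n}\Big)G(y,q)^d ,$$ where, for each $m\in M$ and each cone $C$, the sum $\sum_{n\in C\cap N}q^{m\cdot n}y^{\deg n}$ stands for the Laurent expansion around $q=0$ of the rational function of $q,y$ that it represents. At $y=-1$ the sum over $m$ is well defined as a power series in $q$: no $m$ contributes negative powers of $q$, and only finitely many $m$ contribute to a given power of $q$. The power series $Ell(\mathbf P,-1,q)$ and $$\widehat{Ell}(\mathbf P,q)=(-1)^{d/2}\,Ell(\mathbf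 P,-1,q)\,G(-1,q)^{-d}$$ converge absolutely for $q=e^{2\pi i\tau}$, $\operatorname{Im}\tau>0$, and the function $f(\tau)=\widehat{Ell}(\mathbf P,e^{2\pi i\tau})$ on the upper half plane transforms like a modular form of weight $d$ for $\Gamma_0(2)$: $$f\Big(\frac{a\tau+b}{c\tau+e}\Big)=(c\tau+e)^d f(\tau)\qquad\text{for all }\begin{pmatrix}a&b\\c&e\end{pmatrix}\in SL_2(\mathbb Z)\text{ with } c \text{ even}.$$ -/

import Mathlib

open scoped UpperHalfPlane MatrixGroups

noncomputable section

namespace ToricGenus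

/-- The lattice `N = ℤ^d` as a subset of `N_ℝ = ℝ^d`. The dual lattice `M` is also written as
`Fin d → ℤ`, with the pairing `m · n` given by `m ⬝ᵥ n`. -/
def latVec {d : ℕ} (n : Fin d → ℤ) : Fin d → ℝ := fun i => (n i : ℝ)

/-- A (finite) fan of strongly convex rational polyhedral cones in `ℝ^d`. -/
structure Fan (d : ℕ) where
  /-- the cones of the fan -/
  cones : Finset (PointedCone ℝ (Fin d → ℝ))
  nonempty : cones.Nonempty
  rational : ∀ σ ∈ cones, ∃ S : Finset (Fin d → ℤ), σ = PointedCone.hull ℝ (latVec '' (S : Set _))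
  salient : ∀ σ ∈ cones, ∀ x ∈ σ, -x ∈ σ → x = 0
  face_mem : ∀ σ ∈ cones, ∀ τ : PointedCone ℝ (Fin d → ℝ), τ.IsFaceOf σ → τ ∈ cones
  inter_face : ∀ σ ∈ cones, ∀ τ ∈ cones, (σ ⊓ τ).IsFaceOf σ

variable {d : ℕ}

/-- The dimension of a cone: the dimension of its linear span. -/
def coneDim (σ : PointedCone ℝ (Fin d → ℝ)) : ℕ :=
  Module.finrank ℝ (Submodule.span ℝ (σ : Set (Fin d → ℝ)))

/-- The generators of the one-dimensional faces of `σ`: the primitive lattice vectors `n` such that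
the half-line `ℝ≥0 · n` is a face of `σ`. -/
def rayGens (σ : PointedCone ℝ (Fin d → ℝ)) : Set (Fin d → ℤ) :=
  {n | n ≠ 0 ∧ (∀ (k : ℤ) (n' : Fin d → ℤ), n = k • n' → IsUnit k) ∧
    (PointedCone.hull ℝ {latVec n}).IsFaceOf σ}

namespace Fan

/-- The fan is complete (its toric variety is compact). -/
def IsComplete (F : Fan d) : Prop := ∀ x : Fin d → ℝ, ∃ σ ∈ F.cones, x ∈ σ

/-- `deg` is an integer valued piecewise linear function on the lattice `N`, linear on every
cone of the fan, which equals `1` on the generators of the one-dimensional cones. -/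
def IsDegree (F : Fan d) (deg : (Fin d → ℤ) → ℤ) : Prop :=
  ∀ σ ∈ F.cones,
    (∃ u : Fin d → ℤ, ∀ n : Fin d → ℤ, latVec n ∈ σ → deg n = u ⬝ᵥ n) ∧
    ∀ n ∈ rayGens σ, deg n = 1

/-- The toric variety of the fan is Gorenstein: the piecewise linear function that equals `1` on
the generators of the one-dimensional cones exists and takes integer values on `N`. -/
def IsGorenstein (F : Fan d) : Prop := ∃ deg : (Fin d → ℤ) → ℤ, F.IsDegree deg

/-- The function `deg` of a Gorenstein toric variety. For a complete fan it is unique. -/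
def deg (F : Fan d) (hG : F.IsGorenstein) : (Fin d → ℤ) → ℤ := hG.choose

end Fan

/-- With `n_1, …, n_r` the generators of the one-dimensional faces of `σ`, this is the coefficient
of `x^n` in `∏ i, (1 - x^{n_i}) * ∑ n ∈ σ ∩ N, x^n`. That product is a Laurent polynomial: only
finitely many coefficients are nonzero, and all of these belong to points `n` of `σ`. -/
def numCoeff (σ : PointedCone ℝ (Fin d → ℝ)) (n : Fin d → ℤ) : ℤ :=
  ∑ᶠ S ∈ {S : Finset (Fin d → ℤ) | (S : Set (Fin d → ℤ)) ⊆ rayGens σ},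
    (-1 : ℤ) ^ S.card * Set.indicator {x : Fin d → ℤ | latVec x ∈ σ} 1 (n - ∑ i ∈ S, i)

/-- The expansion around `q = 0` of the rational function
`∑ n ∈ σ ∩ N, q^{m · n} y^{deg n}`, for a complex number `y ≠ 0, 1`. The rational function is
the quotient of the Laurent polynomial `∑ n, numCoeff σ n * q^{m · n} * y^{deg n}` by
`∏ i, (1 - y * q^{m · n_i})`, and the quotient is taken in the field of Laurent series in `q`. -/
def coneSeries (deg : (Fin d → ℤ) → ℤ) (y : ℂ) (m : Fin d → ℤ)
    (σ : PointedCone ℝ (Fin d → ℝ)) : LaurentSeries ℂ :=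
  (∑ᶠ n : Fin d → ℤ, HahnSeries.single (m ⬝ᵥ n) ((numCoeff σ n : ℂ) * y ^ deg n)) /
    ∏ᶠ n ∈ rayGens σ, (1 - HahnSeries.single (m ⬝ᵥ n) y)

open scoped PowerSeries.WithPiTopology in
/-- `G(y, q) = ∏_{k ≥ 1} (1 - y q^{k-1}) (1 - y⁻¹ q^k) / (1 - q^k)^2`, as a power series in `q`
(the index `k` of the code is the `k - 1` of the formula). -/
def G (y : ℂ) : PowerSeries ℂ :=
  ∏' k : ℕ, (1 - PowerSeries.C y * PowerSeries.X ^ k) *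
    (1 - PowerSeries.C y⁻¹ * PowerSeries.X ^ (k + 1)) *
    ((1 - PowerSeries.X ^ (k + 1)) ^ 2)⁻¹

namespace Fan

/-- The contribution of `m ∈ M` to the elliptic genus:
`(∑_σ (-1)^{codim σ} ∑_{n ∈ σ} q^{m · n} y^{deg n}) G(y, q)^d`. -/
def ellTerm (F : Fan d) (hG : F.IsGorenstein) (y : ℂ) (m : Fin d → ℤ) : LaurentSeries ℂ :=
  (∑ σ ∈ F.cones, (-1) ^ (d - coneDim σ) * coneSeries (F.deg hG) y m σ) *
    ((G y : PowerSeries ℂ) : LaurentSeries ℂ) ^ d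

/-- The sum over `m ∈ M` of the contributions `ellTerm` is meaningful as a power series in `q`:
no contribution has negative powers of `q`, and only finitely many `m` contribute to a given
power of `q`. -/
def EllWellDefined (F : Fan d) (hG : F.IsGorenstein) (y : ℂ) : Prop :=
  (∀ (m : Fin d → ℤ) (k : ℤ), k < 0 → (F.ellTerm hG y m).coeff k = 0) ∧
  ∀ k : ℤ, {m : Fin d → ℤ | (F.ellTerm hG y m).coeff k ≠ 0}.Finite

/-- The elliptic genus
`Ell(P, y, q) = y^{-d/2} ∑_m ∑_σ (-1)^{codim σ} (∑_{n ∈ σ} q^{m · n} y^{deg n}) G(y, q)^d`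
of a Gorenstein toric variety, as a power series in `q`. -/
def ell (F : Fan d) (hG : F.IsGorenstein) (y : ℂ) : PowerSeries ℂ :=
  PowerSeries.C (y ^ (-(d : ℂ) / 2)) *
    PowerSeries.mk fun k => ∑ᶠ m : Fin d → ℤ, (F.ellTerm hG y m).coeff (k : ℤ)

/-- The normalized genus `(-1)^{d/2} Ell(P, -1, q) G(-1, q)^{-d}`. -/
def normEll (F : Fan d) (hG : F.IsGorenstein) : PowerSeries ℂ :=
  PowerSeries.C ((-1 : ℂ) ^ ((d : ℂ) / 2)) * F.ell hG (-1) * ((G (-1))⁻¹) ^ d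

end Fan

/-- The terms of a power series in `q` at `q = exp(2πiτ)`. -/
def qTerm (f : PowerSeries ℂ) (τ : ℍ) (k : ℕ) : ℂ :=
  PowerSeries.coeff k f * Complex.exp (2 * Real.pi * Complex.I * (τ : ℂ)) ^ k

/-- The value of a power series in `q` at `q = exp(2πiτ)`. -/
def qValue (f : PowerSeries ℂ) (τ : ℍ) : ℂ := ∑' k : ℕ, qTerm f τ k

end ToricGenus

end

/-! At `y = -1` each denominator `1 - y q^{m·n_i}` becomes the binomial `1 + q^{m·n_i}`, which is
nonzero even when `m·n_i = 0`, and a lattice point enters with the weight `(-1)^{deg n}`. By the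
Euler relation the alternating sum of the indicator functions of the cones is the constant 1
(`Fan.sum_codim_eq_one`). A triangulation without new rays, together with a generic vector `v` that
decides which facets each simplicial cone keeps, also writes 1 as a sum of indicator functions, now
of half-open simplicial cones (`Fan.exists_pieces`). A formal sum over the lattice determines the
rational function it represents, so the contribution of `m` is a sum over these half-open cones
(`Fan.sum_coneSeries_eq`).

For one half-open cone with generators `n_i` the rational function is a finite sum of terms `±
q^{m·b} ∏ (1 + q^{m·n_i})⁻¹` over the lattice points `b` of the fundamental parallelepiped. The
coordinates of `b` lie in `[0,1]`, so no negative powers of `q` occur. The exponents are at least `δ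
(-m·v)` for small `δ > 0`. The total does not depend on `v`, so `v` can be adapted to `m`, and the
total is divisible by `q^{c|m|}` (`exists_contribution_bound`). This gives the finiteness and
convergence statements.

For modularity, let `ker` be the continuation of `∑_k t^k / (1 + q^k)` with `t = e^{2πiz}`. It is
odd, has multipliers `1` and `-1` under `z + 1` and `z + τ`, and has simple poles exactly at the
lattice points. These properties and the residue at 0 determine it, whence `ker τ' (z/(cτ+e)) =
(cτ+e) ker τ z` for even `c` (`ker_modular`). A factor `e^{2πi s m·v}` with small `s` makes the sum
over `m` converge for each simplicial cone separately. By orthogonality of characters that sum is a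
constant times the sum of `± ∏ ker(s v_i + x_i τ + y_i)` over pairs `(x, y)` of points of the
parallelepiped (`Piece.hasSum_deformed`). A unimodular matrix permutes the pairs modulo the lattice
of the generators, which gives weight `d` for each cone (`Piece.deformed_modular`). A single cone
may blow up as `s → 0`, but the total tends to the genus by dominated convergence. The ray along
which `s → 0` is chosen so that `s` and `s/(cτ+e)` both have positive imaginary part. -/

noncomputable section

namespace ToricGenus

/-! ### The Euler relation for relatively open convex sets -/

section EulerRelation

variable {V : Type*} [AddCommGroup V] [Module ℝ V]

/-- A convex set in which every segment can be prolonged a bit at both ends. -/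
structure RelOpen (A : Set V) : Prop where
  convex : Convex ℝ A
  extend : ∀ x ∈ A, ∀ y ∈ A, ∃ ε : ℝ, 0 < ε ∧ x + ε • (x - y) ∈ A

/-- The linear space of directions of a set. -/
def dirSpan (A : Set V) : Submodule ℝ V := Submodule.span ℝ {w | ∃ x ∈ A, ∃ y ∈ A, w = x - y}

theorem sub_mem_dirSpan {A : Set V} {x y : V} (hx : x ∈ A) (hy : y ∈ A) : x - y ∈ dirSpan A :=
  Submodule.subset_span ⟨x, hx, y, hy, rfl⟩

theorem add_smul_mem_of_le {A : Set V} (hA : Convex ℝ A) {x w : V} (hx : x ∈ A) {η η' : ℝ}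
    (h : x + η • w ∈ A) (h0 : 0 ≤ η') (hle : η' ≤ η) : x + η' • w ∈ A := by
  rcases h0.eq_or_lt with rfl | h0
  · simpa using hx
  have hη : 0 < η := h0.trans_le hle
  have := hA hx h (a := 1 - η' / η) (b := η' / η)
    (by rw [sub_nonneg, div_le_one hη]; exact hle) (by positivity) (by ring)
  convert this using 1
  have : η' • w = (η' / η) • η • w := by rw [smul_smul, div_mul_cancel₀ _ hη.ne']
  rw [this]
  module

/-- The directions in which one can move a little from `x` are closed under sums by convexity, and
under negative multiples because the segment from `x + η w` can be prolonged past `x`. So it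
suffices to treat differences of points of `A`. -/
theorem RelOpen.exists_add_smul_mem {A : Set V} (hA : RelOpen A) {x : V} (hx : x ∈ A) {w : V}
    (hw : w ∈ dirSpan A) : ∃ η : ℝ, 0 < η ∧ x + η • w ∈ A := by
  induction hw using Submodule.span_induction with
  | mem w hw =>
    obtain ⟨y, hy, z, hz, rfl⟩ := hw
    -- Prolong the segment from `z` past `x`, then go back towards `y`: the weights below leave
    -- exactly `x + ε/(1+ε) (y - z)`.
    obtain ⟨ε, hε, h⟩ := hA.extend x hx z hz
    have h1 : 1 + ε ≠ 0 := by positivity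
    refine ⟨ε / (1 + ε), by positivity, ?_⟩
    have := hA.convex h hy (a := 1 / (1 + ε)) (b := ε / (1 + ε)) (by positivity) (by positivity)
      (by field_simp)
    convert this using 1
    have e1 : (1 / (1 + ε)) • (x + ε • (x - z)) = x - (ε / (1 + ε)) • z := by
      have : x = (1 / (1 + ε) + ε / (1 + ε)) • x := by
        rw [show 1 / (1 + ε) + ε / (1 + ε) = 1 by field_simp, one_smul]
      conv_rhs => rw [this]
      module
    rw [e1]
    module
  | zero => exact ⟨1, one_pos, by simpa using hx⟩
  | add w₁ w₂ _ _ h₁ h₂ =>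
    obtain ⟨η₁, p₁, h₁⟩ := h₁
    obtain ⟨η₂, p₂, h₂⟩ := h₂
    have hm : 0 < min η₁ η₂ := lt_min p₁ p₂
    have k₁ := add_smul_mem_of_le hA.convex hx h₁ hm.le (min_le_left _ _)
    have k₂ := add_smul_mem_of_le hA.convex hx h₂ hm.le (min_le_right _ _)
    refine ⟨min η₁ η₂ / 2, by positivity, ?_⟩
    convert hA.convex k₁ k₂ (a := 1 / 2) (b := 1 / 2) (by norm_num) (by norm_num) (by norm_num)
      using 1
    module
  | smul c w _ h =>
    obtain ⟨η, p, h⟩ := h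
    rcases lt_trichotomy c 0 with hc | rfl | hc
    · obtain ⟨ε, hε, h'⟩ := hA.extend x hx _ h
      refine ⟨ε * η / (-c), div_pos (by positivity) (by linarith), ?_⟩
      convert h' using 1
      rw [smul_smul, show ε * η / (-c) * c = -(ε * η) by field_simp [hc.ne]]
      module
    · exact ⟨1, one_pos, by simpa using hx⟩
    · refine ⟨η / c, by positivity, ?_⟩
      rwa [smul_smul, div_mul_cancel₀ _ hc.ne']

theorem RelOpen.slice {A : Set V} (hA : RelOpen A) (l : V →ₗ[ℝ] ℝ) (t : ℝ) :
    RelOpen (A ∩ {x | l x = t}) where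
  convex := hA.convex.inter (convex_hyperplane l.isLinear t)
  extend := by
    rintro x ⟨hx, hxt⟩ y ⟨hy, hyt⟩
    obtain ⟨ε, hε, h⟩ := hA.extend x hx y hy
    refine ⟨ε, hε, h, ?_⟩
    simp only [Set.mem_ofPred_eq] at hxt hyt ⊢
    simp [hxt, hyt]

/-- Relative openness is what gives `≥`: a direction of `A` that `l` kills can be followed for a
short time without leaving `A`, hence without leaving the slice. -/
theorem RelOpen.dirSpan_slice {A : Set V} (hA : RelOpen A) (l : V →ₗ[ℝ] ℝ) {t : ℝ}
    (ht : (A ∩ {x | l x = t}).Nonempty) :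
    dirSpan (A ∩ {x | l x = t}) = dirSpan A ⊓ LinearMap.ker l := by
  apply le_antisymm
  · refine Submodule.span_le.2 ?_
    rintro _ ⟨x, ⟨hx, hxt⟩, y, ⟨hy, hyt⟩, rfl⟩
    refine ⟨sub_mem_dirSpan hx hy, ?_⟩
    simp only [Set.mem_ofPred_eq] at hxt hyt
    simp [hxt, hyt]
  · rintro w ⟨hw, hl⟩
    obtain ⟨x, hx, hxt⟩ := ht
    obtain ⟨η, p, h⟩ := hA.exists_add_smul_mem hx hw
    have h2 : x + η • w ∈ A ∩ {x | l x = t} := by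
      refine ⟨h, ?_⟩
      simp only [Set.mem_ofPred_eq] at hxt ⊢
      rw [map_add, map_smul, LinearMap.mem_ker.1 hl, hxt]; simp
    have := sub_mem_dirSpan h2 ⟨hx, hxt⟩
    rw [add_sub_cancel_left] at this
    exact (Submodule.smul_mem_iff _ p.ne').1 this

theorem finrank_inf_ker_add_one [FiniteDimensional ℝ V] (U : Submodule ℝ V) (l : V →ₗ[ℝ] ℝ)
    (h : ∃ u ∈ U, l u ≠ 0) :
    Module.finrank ℝ (U ⊓ LinearMap.ker l : Submodule ℝ V) + 1 = Module.finrank ℝ U := by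
  obtain ⟨u, hu, hlu⟩ := h
  have hs : LinearMap.range (l.domRestrict U) = ⊤ := by
    rw [LinearMap.range_eq_top]
    intro c
    refine ⟨(c / l u) • ⟨u, hu⟩, ?_⟩
    simp [LinearMap.domRestrict_apply, hlu]
  have h1 := LinearMap.finrank_range_add_finrank_ker (l.domRestrict U)
  rw [hs, finrank_top, Module.finrank_self] at h1
  have h2 : (LinearMap.ker (l.domRestrict U)).map U.subtype = U ⊓ LinearMap.ker l := by
    ext x
    simp only [Submodule.mem_map, LinearMap.mem_ker, LinearMap.domRestrict_apply,
      Submodule.subtype_apply, Submodule.mem_inf]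
    exact ⟨fun ⟨y, hy, h⟩ => h ▸ ⟨y.2, hy⟩, fun ⟨h1, h2⟩ => ⟨⟨x, h1⟩, h2, rfl⟩⟩
  rw [← h2, Submodule.finrank_map_subtype_eq]
  omega

/-- The Euler relation on the line, for points and bounded open intervals. -/
theorem euler_relation_line {ι : Type*} (s : Finset ι) (b σ : ι → ℤ) (I : ι → Set ℝ)
    (hI : ∀ i ∈ s, (σ i = 1 ∧ ∃ p, I i = {p}) ∨ (σ i = -1 ∧ ∃ α β, α < β ∧ I i = Set.Ioo α β))
    (h : ∀ t, ∑ i ∈ s, b i * Set.indicator (I i) 1 t = 0) : ∑ i ∈ s, b i * σ i = 0 := by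
  classical
  have hE : ∃ E : Finset ℝ, ∀ i ∈ s, (σ i = 1 ∧ ∃ p ∈ E, I i = {p}) ∨
      (σ i = -1 ∧ ∃ α β, α ∈ E ∧ α < β ∧ I i = Set.Ioo α β) := by
    choose! e he using fun i (hi : i ∈ s) => show ∃ e : ℝ, (σ i = 1 ∧ I i = {e}) ∨
        (σ i = -1 ∧ ∃ β, e < β ∧ I i = Set.Ioo e β) by
      rcases hI i hi with ⟨h1, p, h2⟩ | ⟨h1, α, β, h2, h3⟩
      · exact ⟨p, Or.inl ⟨h1, h2⟩⟩
      · exact ⟨α, Or.inr ⟨h1, β, h2, h3⟩⟩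
    refine ⟨s.image e, fun i hi => ?_⟩
    have hm : e i ∈ s.image e := Finset.mem_image_of_mem _ hi
    rcases he i hi with ⟨h1, h2⟩ | ⟨h1, β, h2, h3⟩
    · exact Or.inl ⟨h1, _, hm, h2⟩
    · exact Or.inr ⟨h1, _, β, hm, h2, h3⟩
  obtain ⟨E, hE⟩ := hE
  -- The Euler characteristic is a sum of jumps from `e` to `e + δ`: a point gives `1` at itself, an
  -- open interval gives `-1` at its left end, and no other `e` contributes once `δ` is small. Such
  -- a sum is linear in the indicator function, which proves the relation.
  have key : ∀ i ∈ s, ∃ δ₀ > (0 : ℝ), ∀ δ, 0 < δ → δ < δ₀ →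
      ∑ e ∈ E, (Set.indicator (I i) (1 : ℝ → ℤ) e - Set.indicator (I i) (1 : ℝ → ℤ) (e + δ))
        = σ i := by
    intro i hi
    -- Keeps `e + δ` from reaching or crossing `c` when `e < c`; used for the point and for both
    -- ends of the interval.
    have gap : ∀ c : ℝ, ∃ δ₀ > (0 : ℝ), ∀ e ∈ E, e < c → e + δ₀ ≤ c := by
      intro c
      clear hE
      induction E using Finset.induction_on with
      | empty => exact ⟨1, one_pos, by simp⟩
      | insert x E _ ih =>
        obtain ⟨δ, hδ, hδ'⟩ := ih
        by_cases hx : x < c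
        · refine ⟨min δ (c - x), lt_min hδ (by linarith), ?_⟩
          intro e he hec
          rcases Finset.mem_insert.1 he with rfl | he
          · linarith [min_le_right δ (c - e)]
          · linarith [hδ' e he hec, min_le_left δ (c - x)]
        · refine ⟨δ, hδ, fun e he hec => ?_⟩
          rcases Finset.mem_insert.1 he with rfl | he
          · exact absurd hec hx
          · exact hδ' e he hec
    rcases hE i hi with ⟨h1, p, hp, h2⟩ | ⟨h1, α, β, hα, h2, h3⟩
    · obtain ⟨δ₀, h0, hδ⟩ := gap p
      refine ⟨δ₀, h0, fun δ d0 d1 => ?_⟩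
      rw [h1, h2, Finset.sum_eq_single_of_mem p hp]
      · simp [d0.ne']
      · intro e he hep
        have : e + δ ≠ p := by
          intro hh
          have := hδ e he (by linarith)
          linarith
        simp [hep, this]
    · obtain ⟨δ₀, h0, hδ⟩ := gap α
      obtain ⟨δ₁, h0', hδ'⟩ := gap β
      refine ⟨min δ₀ δ₁, lt_min h0 h0', fun δ d0 d1 => ?_⟩
      have d2 := d1.trans_le (min_le_left _ _)
      have d3 := d1.trans_le (min_le_right _ _)
      rw [h1, h3, Finset.sum_eq_single_of_mem α hα]
      · have : α + δ < β := by linarith [hδ' α hα h2]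
        simp [this, d0]
      · intro e he hea
        rcases lt_or_gt_of_ne hea with hlt | hgt
        · have := hδ e he hlt
          simp [Set.indicator, not_lt.2 hlt.le, not_lt.2 (show e + δ ≤ α by linarith)]
        · by_cases heb : e < β
          · have := hδ' e he heb
            simp [Set.indicator, hgt, heb, show α < e + δ by linarith,
              show e + δ < β by linarith]
          · simp [Set.indicator, heb, show ¬ e + δ < β by linarith]
  choose! δ₀ hδ₀ hk using key
  obtain ⟨δ, hδ, hδs⟩ : ∃ δ > (0 : ℝ), ∀ i ∈ s, δ < δ₀ i := by
    clear hI h hE hk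
    induction s using Finset.induction_on with
    | empty => exact ⟨1, one_pos, by simp⟩
    | insert x s _ ih =>
      obtain ⟨δ, hδ, h⟩ := ih fun i hi => hδ₀ i (Finset.mem_insert_of_mem hi)
      have hx := hδ₀ x (Finset.mem_insert_self _ _)
      refine ⟨min δ (δ₀ x / 2), lt_min hδ (by linarith), fun i hi => ?_⟩
      rcases Finset.mem_insert.1 hi with rfl | hi
      · linarith [min_le_right δ (δ₀ i / 2)]
      · exact (min_le_left _ _).trans_lt (h i hi)
  calc ∑ i ∈ s, b i * σ i
      = ∑ i ∈ s, ∑ e ∈ E, (b i * Set.indicator (I i) 1 e - b i * Set.indicator (I i) 1 (e + δ)) := by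
        refine Finset.sum_congr rfl fun i hi => ?_
        rw [← hk i hi δ hδ (hδs i hi), Finset.mul_sum]
        exact Finset.sum_congr rfl fun e _ => by ring
    _ = ∑ e ∈ E, (∑ i ∈ s, b i * Set.indicator (I i) 1 e
          - ∑ i ∈ s, b i * Set.indicator (I i) 1 (e + δ)) := by
        rw [Finset.sum_comm]
        exact Finset.sum_congr rfl fun e _ => by rw [Finset.sum_sub_distrib]
    _ = 0 := by simp [h]

/-- The image is a bounded interval, and prolonging segments shows that it has neither a largest nor
a smallest element. -/
theorem RelOpen.image_eq_Ioo {A : Set V} (hA : RelOpen A) (l : V →ₗ[ℝ] ℝ)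
    (hb : Bornology.IsBounded (l '' A)) (hne : ∃ x ∈ A, ∃ y ∈ A, l x ≠ l y) :
    ∃ α β, α < β ∧ l '' A = Set.Ioo α β := by
  obtain ⟨x, hx, y, hy, hxy⟩ := hne
  set I := l '' A with hI
  have hbb := isBounded_iff_bddBelow_bddAbove.1 hb
  have hconv : Convex ℝ I := hA.convex.linear_image l
  have hne : I.Nonempty := ⟨_, x, hx, rfl⟩
  have hext : ∀ t ∈ I, ∀ u ∈ I, ∃ ε : ℝ, 0 < ε ∧ t + ε * (t - u) ∈ I := by
    rintro _ ⟨p, hp, rfl⟩ _ ⟨r, hr, rfl⟩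
    obtain ⟨ε, hε, h⟩ := hA.extend p hp r hr
    exact ⟨ε, hε, _, h, by simp⟩
  have hother : ∀ t ∈ I, ∃ u ∈ I, u ≠ t := by
    intro t _
    by_cases h : l x = t
    · exact ⟨l y, ⟨y, hy, rfl⟩, fun h' => hxy (h.trans h'.symm)⟩
    · exact ⟨l x, ⟨x, hx, rfl⟩, h⟩
  have hup : ∀ t ∈ I, ∃ u ∈ I, t < u := by
    intro t ht
    obtain ⟨u, hu, hut⟩ := hother t ht
    rcases lt_or_gt_of_ne hut with h | h
    · obtain ⟨ε, hε, h'⟩ := hext t ht u hu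
      exact ⟨_, h', by nlinarith [mul_pos hε (sub_pos.2 h)]⟩
    · exact ⟨u, hu, h⟩
  have hdown : ∀ t ∈ I, ∃ u ∈ I, u < t := by
    intro t ht
    obtain ⟨u, hu, hut⟩ := hother t ht
    rcases lt_or_gt_of_ne hut with h | h
    · exact ⟨u, hu, h⟩
    · obtain ⟨ε, hε, h'⟩ := hext t ht u hu
      exact ⟨_, h', by nlinarith [mul_pos hε (sub_pos.2 h)]⟩
  have hsub : I ⊆ Set.Ioo (sInf I) (sSup I) := by
    intro t ht
    obtain ⟨u, hu, h⟩ := hup t ht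
    obtain ⟨u', hu', h'⟩ := hdown t ht
    exact ⟨(csInf_le hbb.1 hu').trans_lt h', h.trans_le (le_csSup hbb.2 hu)⟩
  refine ⟨sInf I, sSup I, ?_, hsub.antisymm ?_⟩
  · exact (hsub ⟨x, hx, rfl⟩).1.trans (hsub ⟨x, hx, rfl⟩).2
  · rintro t ⟨h1, h2⟩
    obtain ⟨u, hu, hut⟩ := exists_lt_of_csInf_lt hne h1
    obtain ⟨w, hw, hwt⟩ := exists_lt_of_lt_csSup hne h2
    exact hconv.ordConnected.out hu hw ⟨hut.le, hwt.le⟩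

/-- Fubini for the Euler characteristic. Slice by the level sets of a linear form `l` that is
nonzero on `W`. The induction hypothesis in each slice is a relation between indicator functions of
the images `l(R i)`, to which the one-dimensional case applies. -/
theorem euler_relation_aux [FiniteDimensional ℝ V] {ι : Type*} (n : ℕ) :
    ∀ (W : Submodule ℝ V), Module.finrank ℝ W = n → ∀ (s : Finset ι) (a : ι → ℤ) (R : ι → Set V),
    (∀ i ∈ s, (R i).Nonempty) → (∀ i ∈ s, RelOpen (R i)) →
    (∀ l : V →ₗ[ℝ] ℝ, ∀ i ∈ s, Bornology.IsBounded (l '' R i)) →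
    (∀ i ∈ s, ∀ j ∈ s, ∀ x ∈ R i, ∀ y ∈ R j, x - y ∈ W) →
    (∀ x, ∑ i ∈ s, a i * Set.indicator (R i) 1 x = 0) →
    ∑ i ∈ s, a i * (-1) ^ Module.finrank ℝ (dirSpan (R i)) = 0 := by
  classical
  induction n with
  | zero =>
    intro W hW s a R hne _ _ hsub h
    rw [Submodule.finrank_eq_zero] at hW
    subst hW
    rcases s.eq_empty_or_nonempty with rfl | ⟨i₀, hi₀⟩
    · simp
    obtain ⟨x, hx⟩ := hne i₀ hi₀
    have hR : ∀ i ∈ s, R i = {x} := by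
      intro i hi
      obtain ⟨y, hy⟩ := hne i hi
      refine Set.eq_singleton_iff_unique_mem.2 ⟨?_, fun z hz => ?_⟩
      · have := hsub i hi i₀ hi₀ y hy x hx
        rw [Submodule.mem_bot, sub_eq_zero] at this
        rwa [← this]
      · have := hsub i hi i₀ hi₀ z hz x hx
        rwa [Submodule.mem_bot, sub_eq_zero] at this
    rw [← h x]
    refine Finset.sum_congr rfl fun i hi => ?_
    have : dirSpan (R i) = ⊥ := by
      rw [hR i hi, dirSpan, Submodule.span_eq_bot]
      rintro _ ⟨u, rfl, w, rfl, rfl⟩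
      simp
    rw [this, finrank_bot, hR i hi]
    simp
  | succ n ih =>
    intro W hW s a R hne hRO hbd hsub h
    obtain ⟨w, hw, hw0⟩ : ∃ w ∈ W, w ≠ 0 := by
      refine W.exists_mem_ne_zero_of_ne_bot ?_
      rintro rfl
      simp at hW
    obtain ⟨l, hl⟩ := Module.exists_dual_forall_apply_ne_zero (K := ℝ) (fun _ : Unit => w) (fun _ => hw0)
    have hlw : l w ≠ 0 := hl ()
    have hker := finrank_inf_ker_add_one W l ⟨w, hw, hlw⟩
    -- The Euler characteristic of `l(R i)`: `1` for a point, `-1` for an open interval. It is also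
    -- the ratio between the signs of `R i` and of its nonempty slices.
    let σ : ι → ℤ := fun i => if ∃ x ∈ R i, ∃ y ∈ R i, l x ≠ l y then -1 else 1
    have hσ2 : ∀ i, σ i * σ i = 1 := by
      intro i; simp only [σ]; split_ifs <;> simp
    have hdim : ∀ i ∈ s, ∀ t, (R i ∩ {x | l x = t}).Nonempty →
        (-1 : ℤ) ^ Module.finrank ℝ (dirSpan (R i ∩ {x | l x = t})) =
          σ i * (-1) ^ Module.finrank ℝ (dirSpan (R i)) := by
      intro i hi t ht
      rw [(hRO i hi).dirSpan_slice l ht]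
      simp only [σ]
      split_ifs with hc
      · obtain ⟨x, hx, y, hy, hxy⟩ := hc
        rw [← finrank_inf_ker_add_one (dirSpan (R i)) l
          ⟨x - y, sub_mem_dirSpan hx hy, by rwa [map_sub, sub_ne_zero]⟩, pow_succ]
        ring
      · have : dirSpan (R i) ≤ LinearMap.ker l := by
          refine Submodule.span_le.2 ?_
          rintro _ ⟨x, hx, y, hy, rfl⟩
          push Not at hc
          simp [hc x hx y hy]
        rw [inf_eq_left.2 this, one_mul]
    -- The coefficients are the signs of the slices; integrating over the line multiplies by `σ`
    -- once more, and `σ² = 1`.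
    have hline := euler_relation_line s
      (fun i => a i * (σ i * (-1) ^ Module.finrank ℝ (dirSpan (R i)))) σ (fun i => l '' R i) ?_ ?_
    · rw [← hline]
      refine Finset.sum_congr rfl fun i _ => ?_
      linear_combination (-(a i) * (-1) ^ Module.finrank ℝ (dirSpan (R i))) * hσ2 i
    · intro i hi
      by_cases hc : ∃ x ∈ R i, ∃ y ∈ R i, l x ≠ l y
      · exact Or.inr ⟨if_pos hc, (hRO i hi).image_eq_Ioo l (hbd l i hi) hc⟩
      · refine Or.inl ⟨if_neg hc, ?_⟩
        push Not at hc
        obtain ⟨x, hx⟩ := hne i hi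
        refine ⟨l x, Set.eq_singleton_iff_unique_mem.2 ⟨⟨x, hx, rfl⟩, ?_⟩⟩
        rintro _ ⟨y, hy, rfl⟩
        exact hc y hy x hx
    · intro t
      have := ih (W ⊓ LinearMap.ker l) (by omega)
        (s.filter fun i => (R i ∩ {x | l x = t}).Nonempty) a (fun i => R i ∩ {x | l x = t})
        (fun i hi => (Finset.mem_filter.1 hi).2)
        (fun i hi => (hRO i (Finset.mem_filter.1 hi).1).slice l t)
        (fun l' i hi => (hbd l' i (Finset.mem_filter.1 hi).1).subset
          (Set.image_mono Set.inter_subset_left)) ?_ ?_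
      · rw [Finset.sum_filter] at this
        rw [← this]
        refine Finset.sum_congr rfl fun i hi => ?_
        by_cases hc : (R i ∩ {x | l x = t}).Nonempty
        · rw [if_pos hc, hdim i hi t hc]
          obtain ⟨x, hx, hxt⟩ := hc
          rw [Set.indicator_of_mem (show t ∈ l '' R i from ⟨x, hx, hxt⟩)]
          simp
        · rw [if_neg hc, Set.indicator_of_notMem, mul_zero]
          rintro ⟨x, hx, hxt⟩
          exact hc ⟨x, hx, hxt⟩
      · rintro i hi j hj x ⟨hx, hxt⟩ y ⟨hy, hyt⟩
        refine ⟨hsub i (Finset.mem_filter.1 hi).1 j (Finset.mem_filter.1 hj).1 x hx y hy, ?_⟩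
        simp only [Set.mem_ofPred_eq] at hxt hyt
        simp [hxt, hyt]
      · intro x
        rw [Finset.sum_filter]
        by_cases hx : l x = t
        · refine (Finset.sum_congr rfl fun i hi => ?_).trans (h x)
          by_cases hxi : x ∈ R i
          · rw [if_pos ⟨x, hxi, hx⟩, Set.indicator_of_mem hxi,
              Set.indicator_of_mem (show x ∈ R i ∩ {x | l x = t} from ⟨hxi, hx⟩)]
          · rw [Set.indicator_of_notMem hxi,
              Set.indicator_of_notMem (fun h : x ∈ R i ∩ {x | l x = t} => hxi h.1)]
            simp only [mul_zero, ite_self]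
        · refine Finset.sum_eq_zero fun i _ => ?_
          rw [Set.indicator_of_notMem (fun h => hx h.2)]
          simp

/-- The Euler relation: a linear relation between indicator functions of bounded relatively open
convex sets gives a relation between their Euler characteristics. -/
theorem euler_relation [FiniteDimensional ℝ V] {ι : Type*} (s : Finset ι) (a : ι → ℤ)
    (R : ι → Set V) (hne : ∀ i ∈ s, (R i).Nonempty) (hRO : ∀ i ∈ s, RelOpen (R i))
    (hbd : ∀ l : V →ₗ[ℝ] ℝ, ∀ i ∈ s, Bornology.IsBounded (l '' R i))
    (h : ∀ x, ∑ i ∈ s, a i * Set.indicator (R i) 1 x = 0) :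
    ∑ i ∈ s, a i * (-1) ^ Module.finrank ℝ (dirSpan (R i)) = 0 :=
  euler_relation_aux _ ⊤ rfl s a R hne hRO hbd (fun _ _ _ _ _ _ _ _ => trivial) h

end EulerRelation

end ToricGenus

end

noncomputable section

namespace ToricGenus

/-! ### Extremal rays of rational cones -/

section PolyhedralCones

theorem mem_hull_image {ι E : Type*} [AddCommGroup E] [Module ℝ E] (f : ι → E) (S : Finset ι)
    (x : E) : x ∈ PointedCone.hull ℝ (f '' (S : Set ι)) ↔
      ∃ c : ι → ℝ, (∀ i, 0 ≤ c i) ∧ x = ∑ i ∈ S, c i • f i := by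
  classical
  rw [PointedCone.hull, Submodule.mem_span_image_finset_iff_exists_fun]
  constructor
  · rintro ⟨c, rfl⟩
    refine ⟨fun i => if h : i ∈ S then c ⟨i, h⟩ else 0, fun i => ?_, ?_⟩
    · by_cases h : i ∈ S
      · simp only [h, dif_pos]
        exact (c ⟨i, h⟩).2
      · simp [h]
    · rw [← Finset.sum_coe_sort S]
      exact Finset.sum_congr rfl fun i _ => by simp only [i.2, dif_pos]; rfl
  · rintro ⟨c, hc, rfl⟩
    exact ⟨fun i => ⟨c i, hc i⟩, Finset.sum_coe_sort S fun i => c i • f i⟩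

theorem mem_hull_of_mem {ι E : Type*} [AddCommGroup E] [Module ℝ E] {f : ι → E} {S : Set ι}
    {i : ι} (hi : i ∈ S) : f i ∈ PointedCone.hull ℝ (f '' S) :=
  PointedCone.subset_hull (Set.mem_image_of_mem f hi)

theorem self_mem_hull {E : Type*} [AddCommGroup E] [Module ℝ E] (x : E) :
    x ∈ PointedCone.hull ℝ {x} := Submodule.mem_span_singleton_self x

theorem smul_mem_cone {E : Type*} [AddCommGroup E] [Module ℝ E] (C : PointedCone ℝ E) {x : E}
    (hx : x ∈ C) {c : ℝ} (hc : 0 ≤ c) : c • x ∈ C := PointedCone.smul_mem C hc hx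

variable {d : ℕ}

theorem latVec_injective : Function.Injective (latVec : (Fin d → ℤ) → Fin d → ℝ) := by
  intro a b h
  funext i
  exact Int.cast_injective (congrFun h i)

theorem latVec_add (a b : Fin d → ℤ) : latVec (a + b) = latVec a + latVec b := by
  funext i; simp [latVec]

theorem latVec_sub (a b : Fin d → ℤ) : latVec (a - b) = latVec a - latVec b := by
  funext i; simp [latVec]

theorem latVec_zsmul (k : ℤ) (a : Fin d → ℤ) : latVec (k • a) = (k : ℝ) • latVec a := by
  funext i; simp [latVec]

theorem latVec_sum {ι : Type*} (s : Finset ι) (f : ι → Fin d → ℤ) :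
    latVec (∑ i ∈ s, f i) = ∑ i ∈ s, latVec (f i) := by
  funext i; simp [latVec]

@[simp] theorem latVec_zero : latVec (0 : Fin d → ℤ) = 0 := by
  funext i; simp [latVec]

/-- The linear extension to `ℝ^d` of the pairing with an integral vector. -/
def pairing (u : Fin d → ℤ) : (Fin d → ℝ) →ₗ[ℝ] ℝ := Fintype.linearCombination ℝ (latVec u)

theorem pairing_apply (u : Fin d → ℤ) (x : Fin d → ℝ) : pairing u x = ∑ i, x i * u i := by
  simp [pairing, Fintype.linearCombination_apply, latVec]

theorem pairing_latVec (u n : Fin d → ℤ) : pairing u (latVec n) = ((u ⬝ᵥ n : ℤ) : ℝ) := by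
  rw [pairing_apply]
  simp [dotProduct, latVec, mul_comm]

theorem exists_primitive (s : Fin d → ℤ) (hs : s ≠ 0) : ∃ (k : ℤ) (n : Fin d → ℤ), 0 < k ∧
    s = k • n ∧ n ≠ 0 ∧ ∀ (k : ℤ) (n' : Fin d → ℤ), n = k • n' → IsUnit k := by
  obtain ⟨i, hi⟩ := Function.ne_iff.1 hs
  obtain ⟨g, hg, hg1⟩ := Finset.extract_gcd s ⟨i, Finset.mem_univ i⟩
  have hs' : s = (Finset.univ.gcd s) • g := by
    funext j; exact hg j (Finset.mem_univ j)
  refine ⟨Finset.univ.gcd s, g, ?_, hs', ?_, ?_⟩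
  · have h1 : 0 ≤ Finset.univ.gcd s := by
      have : normalize (Finset.univ.gcd s) = _ := Finset.normalize_gcd
      rw [← this]; exact Int.nonneg_of_normalize_eq_self (by simp)
    rcases h1.eq_or_lt with h | h
    · rw [← h, zero_smul] at hs'
      exact absurd hs' hs
    · exact h
  · rintro rfl
    rw [smul_zero] at hs'
    exact hs hs'
  · rintro k n' rfl
    have : k ∣ Finset.univ.gcd (k • n') := Finset.dvd_gcd fun j _ => ⟨n' j, rfl⟩
    rw [hg1] at this
    exact isUnit_of_dvd_one this

/-- Write `a x + y` in the generators and move the multiples of `f s` to one side. If their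
coefficient is positive, `f s` is a combination of the other generators, against minimality.
Otherwise nonnegative multiples of generators add up to zero, and in a salient cone each of them
vanishes. -/
theorem isFaceOf_hull_singleton_of_minimal {E : Type*} [AddCommGroup E] [Module ℝ E]
    {ι : Type*} [DecidableEq ι] (f : ι → E) (S : Finset ι)
    (hsal : ∀ x ∈ PointedCone.hull ℝ (f '' (S : Set ι)),
      -x ∈ PointedCone.hull ℝ (f '' (S : Set ι)) → x = 0)
    {s : ι} (hs : s ∈ S) (hne : ∀ i ∈ S, f i ≠ 0)
    (hmin : f s ∉ PointedCone.hull ℝ (f '' ((S.erase s : Finset ι) : Set ι))) :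
    (PointedCone.hull ℝ {f s}).IsFaceOf (PointedCone.hull ℝ (f '' (S : Set ι))) := by
  have hfs : f s ∈ PointedCone.hull ℝ (f '' (S : Set ι)) :=
    mem_hull_of_mem hs
  refine ⟨Submodule.span_le.2 (by simpa using hfs), ?_⟩
  intro x y a hx hy ha hxy
  rw [mem_hull_image] at hx hy
  obtain ⟨c, hc, rfl⟩ := hx
  obtain ⟨e, he, rfl⟩ := hy
  obtain ⟨t, ht⟩ := Submodule.mem_span_singleton.1 hxy
  have ht' : (t : ℝ) • f s = a • (c s • f s + ∑ x ∈ S.erase s, c x • f x) +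
      (e s • f s + ∑ x ∈ S.erase s, e x • f x) := by
    rw [Finset.add_sum_erase S (fun i => c i • f i) hs,
      Finset.add_sum_erase S (fun i => e i • f i) hs]
    exact ht
  have hrest : ∑ i ∈ S.erase s, (a * c i + e i) • f i = ((t : ℝ) - a * c s - e s) • f s := by
    have : ∑ i ∈ S.erase s, (a * c i + e i) • f i =
        a • (∑ i ∈ S.erase s, c i • f i) + ∑ i ∈ S.erase s, e i • f i := by
      rw [Finset.smul_sum, ← Finset.sum_add_distrib]
      exact Finset.sum_congr rfl fun i _ => by module
    rw [this]
    rw [sub_smul, sub_smul, ht']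
    module
  have hnn : ∀ i, 0 ≤ a * c i + e i := fun i => by
    have := hc i; have := he i; positivity
  have hmem : ∀ T ⊆ S, ∑ i ∈ T, (a * c i + e i) • f i ∈ PointedCone.hull ℝ (f '' (S : Set ι)) :=
    fun T hT => Submodule.sum_mem _ fun i hi =>
      smul_mem_cone _ (mem_hull_of_mem (hT hi)) (hnn i)
  rcases lt_or_ge 0 ((t : ℝ) - a * c s - e s) with hpos | hneg
  · refine absurd ?_ hmin
    rw [mem_hull_image]
    refine ⟨fun i => ((t : ℝ) - a * c s - e s)⁻¹ * (a * c i + e i),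
      fun i => mul_nonneg (inv_nonneg.2 hpos.le) (hnn i), ?_⟩
    rw [← inv_smul_smul₀ hpos.ne' (f s), ← hrest, Finset.smul_sum]
    exact Finset.sum_congr rfl fun i _ => by rw [smul_smul]
  · have hzero : ∀ i ∈ S.erase s, (a * c i + e i) • f i = 0 := by
      intro i hi
      have hiS := Finset.mem_of_mem_erase hi
      refine hsal _ (smul_mem_cone _ (mem_hull_of_mem hiS) (hnn i)) ?_
      have h1 : -((a * c i + e i) • f i) = ∑ j ∈ (S.erase s).erase i, (a * c j + e j) • f j +
          (-((t : ℝ) - a * c s - e s)) • f s := by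
        rw [neg_smul, ← hrest, ← Finset.add_sum_erase (S.erase s) (fun j => (a * c j + e j) • f j) hi]
        abel
      rw [h1]
      exact Submodule.add_mem _ (hmem _ ((Finset.erase_subset _ _).trans (Finset.erase_subset _ _)))
        (smul_mem_cone _ hfs (by linarith))
    have hc0 : ∑ i ∈ S.erase s, c i • f i = 0 := by
      refine Finset.sum_eq_zero fun i hi => ?_
      have := (smul_eq_zero.1 (hzero i hi)).resolve_right (hne i (Finset.mem_of_mem_erase hi))
      have h1 := hc i
      have h2 := he i
      have : c i = 0 := by
        by_contra h
        have : 0 < a * c i := mul_pos ha (lt_of_le_of_ne h1 (Ne.symm h))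
        linarith
      rw [this, zero_smul]
    rw [← Finset.add_sum_erase S (fun i => c i • f i) hs, hc0, add_zero]
    exact smul_mem_cone _ (self_mem_hull _) (hc s)

theorem exists_minimal_generators {E : Type*} [AddCommGroup E] [Module ℝ E]
    {ι : Type*} [DecidableEq ι] (f : ι → E) (S : Finset ι) :
    ∃ T ⊆ S, PointedCone.hull ℝ (f '' (T : Set ι)) = PointedCone.hull ℝ (f '' (S : Set ι)) ∧
      ∀ s ∈ T, f s ∉ PointedCone.hull ℝ (f '' ((T.erase s : Finset ι) : Set ι)) := by
  induction hn : S.card using Nat.strong_induction_on generalizing S with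
  | _ n ih =>
    subst hn
    by_cases h : ∀ s ∈ S, f s ∉ PointedCone.hull ℝ (f '' ((S.erase s : Finset ι) : Set ι))
    · exact ⟨S, subset_rfl, rfl, h⟩
    · push Not at h
      obtain ⟨s, hs, hmem⟩ := h
      obtain ⟨T, hT, h1, h2⟩ := ih _ (Finset.card_erase_lt_of_mem hs) (S.erase s) rfl
      refine ⟨T, hT.trans (Finset.erase_subset _ _), ?_, h2⟩
      rw [h1]
      refine le_antisymm (Submodule.span_mono (Set.image_mono (by simp))) ?_
      refine Submodule.span_le.2 ?_
      rintro _ ⟨i, hi, rfl⟩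
      by_cases his : i = s
      · exact his ▸ hmem
      · exact mem_hull_of_mem (Finset.mem_coe.2 (Finset.mem_erase.2 ⟨his, hi⟩))

theorem hull_singleton_smul {E : Type*} [AddCommGroup E] [Module ℝ E] (x : E) {c : ℝ} (hc : 0 < c) :
    PointedCone.hull ℝ {c • x} = PointedCone.hull ℝ {x} := by
  apply le_antisymm <;> refine Submodule.span_le.2 (Set.singleton_subset_iff.2 ?_)
  · exact smul_mem_cone _ (self_mem_hull _) hc.le
  · have := smul_mem_cone (PointedCone.hull ℝ {c • x}) (self_mem_hull _) (inv_pos.2 hc).le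
    rwa [inv_smul_smul₀ hc.ne'] at this

theorem mem_of_mem_rayGens {σ : PointedCone ℝ (Fin d → ℝ)} {n : Fin d → ℤ} (hn : n ∈ rayGens σ) :
    latVec n ∈ σ := hn.2.2.le (self_mem_hull _)

/-- The members of a minimal generating system span one-dimensional faces, and each is a positive
multiple of a primitive vector. -/
theorem hull_rayGens {σ : PointedCone ℝ (Fin d → ℝ)} (S : Finset (Fin d → ℤ))
    (hS : σ = PointedCone.hull ℝ (latVec '' (S : Set _)))
    (hsal : ∀ x ∈ σ, -x ∈ σ → x = 0) : σ = PointedCone.hull ℝ (latVec '' rayGens σ) := by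
  classical
  obtain ⟨T, hTS, hT, hmin⟩ := exists_minimal_generators latVec S
  rw [← hS] at hT
  apply le_antisymm
  · conv_lhs => rw [← hT]
    refine Submodule.span_le.2 ?_
    rintro _ ⟨s, hs, rfl⟩
    have hne : ∀ i ∈ T, latVec i ≠ 0 := fun i hi h0 => hmin i hi (h0 ▸ Submodule.zero_mem _)
    have hs0 : s ≠ 0 := by
      rintro rfl
      exact hne 0 hs latVec_zero
    have hface := isFaceOf_hull_singleton_of_minimal latVec T (by rwa [hT]) hs hne (hmin s hs)
    obtain ⟨k, n, hk, hsn, hn0, hprim⟩ := exists_primitive s hs0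
    have hk' : (0 : ℝ) < k := by exact_mod_cast hk
    rw [hT, hsn, latVec_zsmul, hull_singleton_smul _ hk'] at hface
    rw [hsn, latVec_zsmul]
    exact smul_mem_cone _ (mem_hull_of_mem (show n ∈ rayGens σ from ⟨hn0, hprim, hface⟩)) hk'.le
  · refine Submodule.span_le.2 ?_
    rintro _ ⟨n, hn, rfl⟩
    exact mem_of_mem_rayGens hn

/-- Expand a ray generator `n` in `S`: since its half-line is a face, every term that occurs lies on
it. So `n` is proportional to some `s ∈ S`, and `u ⬝ᵥ n = 1` fixes the factor. -/
theorem finite_rayGens {σ : PointedCone ℝ (Fin d → ℝ)} (S : Finset (Fin d → ℤ))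
    (hS : σ = PointedCone.hull ℝ (latVec '' (S : Set _))) (u : Fin d → ℤ)
    (hu : ∀ n ∈ rayGens σ, u ⬝ᵥ n = 1) : (rayGens σ).Finite := by
  refine Set.Finite.subset (Set.Finite.preimage (latVec_injective.injOn)
    (S.finite_toSet.image fun s => ((u ⬝ᵥ s : ℤ) : ℝ)⁻¹ • latVec s)) ?_
  intro n hn
  have hmem := mem_of_mem_rayGens hn
  rw [hS, mem_hull_image] at hmem
  obtain ⟨c, hc, hsum⟩ := hmem
  have : ∃ s ∈ S, c s • latVec s ≠ 0 := by
    by_contra! h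
    rw [Finset.sum_eq_zero h] at hsum
    exact hn.1 (latVec_injective (by rw [hsum, latVec_zero]))
  obtain ⟨s, hs, hcs'⟩ := this
  have hcs : c s ≠ 0 := left_ne_zero_of_smul hcs'
  have hs0 : latVec s ≠ 0 := right_ne_zero_of_smul hcs'
  have hpos : 0 < c s := lt_of_le_of_ne (hc s) (Ne.symm hcs)
  have hmemS : ∀ i ∈ S, latVec i ∈ σ := fun i hi => hS ▸ mem_hull_of_mem hi
  have h1 : latVec s ∈ PointedCone.hull ℝ {latVec n} := by
    classical
    refine hn.2.2.mem_of_smul_add_mem (hmemS s hs)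
      (y := ∑ i ∈ S.erase s, c i • latVec i) (Submodule.sum_mem _ fun i hi =>
        smul_mem_cone _ (hmemS i (Finset.mem_of_mem_erase hi)) (hc i)) hpos ?_
    rw [Finset.add_sum_erase S (fun i => c i • latVec i) hs, ← hsum]
    exact self_mem_hull _
  obtain ⟨t, ht⟩ := Submodule.mem_span_singleton.1 h1
  replace ht : (t : ℝ) • latVec n = latVec s := ht
  have h2 := congrArg (pairing u) ht
  rw [map_smul, pairing_latVec, pairing_latVec, hu n hn] at h2
  simp only [Int.cast_one, smul_eq_mul, mul_one] at h2
  have h0 : (t : ℝ) ≠ 0 := fun h0 => hs0 (by rw [← ht, h0, zero_smul])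
  refine ⟨s, hs, ?_⟩
  change ((u ⬝ᵥ s : ℤ) : ℝ)⁻¹ • latVec s = latVec n
  rw [← ht, ← h2, inv_smul_smul₀ h0]

end PolyhedralCones

end ToricGenus

end

noncomputable section

namespace ToricGenus

/-! ### Relative interiors and smallest faces -/

section Cores

variable {E : Type*} [AddCommGroup E] [Module ℝ E]

/-- The relative interior of a cone, described algebraically. -/
def core (C : PointedCone ℝ E) : Set E := {x | x ∈ C ∧ ∀ y ∈ C, ∃ ε : ℝ, 0 < ε ∧ x - ε • y ∈ C}

theorem core_add_mem {C : PointedCone ℝ E} {x y : E} (hx : x ∈ core C) (hy : y ∈ C) :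
    x + y ∈ core C := by
  refine ⟨C.add_mem hx.1 hy, fun z hz => ?_⟩
  obtain ⟨ε, hε, h⟩ := hx.2 z hz
  refine ⟨ε, hε, ?_⟩
  rw [add_sub_right_comm]
  exact C.add_mem h hy

theorem smul_mem_core {C : PointedCone ℝ E} {x : E} (hx : x ∈ core C) {c : ℝ} (hc : 0 < c) :
    c • x ∈ core C := by
  refine ⟨smul_mem_cone C hx.1 hc.le, fun z hz => ?_⟩
  obtain ⟨ε, hε, h⟩ := hx.2 z hz
  refine ⟨c * ε, by positivity, ?_⟩
  rw [mul_smul, ← smul_sub]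
  exact smul_mem_cone C h hc.le

theorem relOpen_core (C : PointedCone ℝ E) : RelOpen (core C) where
  convex := by
    intro x hx y hy a b ha hb hab
    rcases ha.eq_or_lt with rfl | ha
    · rw [zero_add] at hab; subst hab; simpa using hy
    · exact core_add_mem (smul_mem_core hx ha) (smul_mem_cone C hy.1 hb)
  extend := by
    intro x hx y hy
    obtain ⟨ε, hε, h⟩ := hx.2 y hy.1
    refine ⟨ε / 2, by positivity, ?_⟩
    have := core_add_mem (smul_mem_core hx (show 0 < 1 / 2 + ε / 2 by positivity))
      (smul_mem_cone C h (show (0 : ℝ) ≤ 1 / 2 by norm_num))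
    convert this using 1
    module

theorem core_nonempty {ι : Type*} (f : ι → E) (S : Finset ι) :
    (core (PointedCone.hull ℝ (f '' (S : Set ι)))).Nonempty := by
  refine ⟨∑ i ∈ S, f i, Submodule.sum_mem _ fun i hi => mem_hull_of_mem hi, fun y hy => ?_⟩
  obtain ⟨c, hc, rfl⟩ := (mem_hull_image _ _ _).1 hy
  have hpos : 0 < 1 + ∑ i ∈ S, c i := by
    have := Finset.sum_nonneg fun i (_ : i ∈ S) => hc i
    linarith
  -- The interior point is the sum of all generators; with this `ε` every generator keeps the
  -- coefficient `1 - ε c i ≥ 0`.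
  refine ⟨(1 + ∑ i ∈ S, c i)⁻¹, inv_pos.2 hpos, ?_⟩
  rw [Finset.smul_sum, ← Finset.sum_sub_distrib]
  refine Submodule.sum_mem _ fun i hi => ?_
  have h1 : c i ≤ ∑ i ∈ S, c i := Finset.single_le_sum (fun i _ => hc i) hi
  have h2 : (1 + ∑ i ∈ S, c i)⁻¹ * c i ≤ 1 := by
    rw [inv_mul_le_iff₀ hpos]
    linarith
  have : f i - (1 + ∑ i ∈ S, c i)⁻¹ • c i • f i = (1 - (1 + ∑ i ∈ S, c i)⁻¹ * c i) • f i := by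
    module
  rw [this]
  exact smul_mem_cone _ (mem_hull_of_mem hi) (by linarith)

/-- The smallest face of a cone that contains a given point. -/
def faceOf (C : PointedCone ℝ E) (x : E) (hx : x ∈ C) : PointedCone ℝ E where
  carrier := {y | y ∈ C ∧ ∃ ε : ℝ, 0 < ε ∧ x - ε • y ∈ C}
  zero_mem' := ⟨C.zero_mem, 1, one_pos, by simpa using hx⟩
  add_mem' := by
    rintro y z ⟨hy, ε, hε, h⟩ ⟨hz, δ, hδ, h'⟩
    refine ⟨C.add_mem hy hz, ε * δ / (ε + δ), by positivity, ?_⟩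
    have := C.add_mem (smul_mem_cone C h (show 0 ≤ δ / (ε + δ) by positivity))
      (smul_mem_cone C h' (show 0 ≤ ε / (ε + δ) by positivity))
    convert this using 1
    have e : x = (δ / (ε + δ) + ε / (ε + δ)) • x := by
      rw [← add_div, add_comm δ ε, div_self (by positivity), one_smul]
    conv_lhs => rw [e]
    rw [mul_div_assoc]
    module
  smul_mem' := by
    rintro ⟨c, hc⟩ y ⟨hy, ε, hε, h⟩
    refine ⟨smul_mem_cone C hy hc, ?_⟩
    change ∃ ε : ℝ, 0 < ε ∧ x - ε • c • y ∈ C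
    rcases hc.eq_or_lt with rfl | hc
    · exact ⟨1, one_pos, by simpa using hx⟩
    · refine ⟨ε / c, by positivity, ?_⟩
      rwa [smul_smul, div_mul_cancel₀ _ hc.ne']

theorem isFaceOf_faceOf (C : PointedCone ℝ E) (x : E) (hx : x ∈ C) :
    (faceOf C x hx).IsFaceOf C where
  le := fun _ h => h.1
  mem_of_smul_add_mem := by
    rintro y z a hy hz ha ⟨-, ε, hε, h⟩
    refine ⟨hy, ε * a, by positivity, ?_⟩
    have := C.add_mem h (smul_mem_cone C hz hε.le)
    convert this using 1
    module

theorem mem_core_faceOf (C : PointedCone ℝ E) (x : E) (hx : x ∈ C) : x ∈ core (faceOf C x hx) := by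
  refine ⟨⟨hx, 1, one_pos, by simp⟩, ?_⟩
  rintro y ⟨hy, ε, hε, h⟩
  refine ⟨ε, hε, h, 1, one_pos, ?_⟩
  rw [one_smul, sub_sub_cancel]
  exact smul_mem_cone C hy hε.le

/-- For `y ∈ C` the point `x` splits inside `C` as `ε y + (x - ε y)`, and a face contains the
summands of its points. -/
theorem le_of_mem_core {C F : PointedCone ℝ E} (hF : F.IsFaceOf C) {x : E} (hx : x ∈ core C)
    (hxF : x ∈ F) : C ≤ F := by
  intro y hy
  obtain ⟨ε, hε, h⟩ := hx.2 y hy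
  exact hF.mem_of_smul_add_mem hy h hε (by rwa [add_sub_cancel])

end Cores

/-! ### Closedness of cones with generators on an affine hyperplane -/

section ClosedCones

variable {d : ℕ}

/-- Near `x` the form `u` stays below `B = u x + 1`. As `u (∑ c i r_i) = ∑ c i`, the points of the
cone with `u < B` lie in the image of the cube `[0, B]^R`, which is compact. -/
theorem isClosed_hull (R : Finset (Fin d → ℤ)) (u : (Fin d → ℝ) →ₗ[ℝ] ℝ)
    (hu : ∀ r ∈ R, u (latVec r) = 1) :
    IsClosed (PointedCone.hull ℝ (latVec '' (R : Set (Fin d → ℤ))) : Set (Fin d → ℝ)) := by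
  rw [← isOpen_compl_iff, isOpen_iff_mem_nhds]
  intro x hx
  set B := u x + 1
  let K : Set (Fin d → ℝ) := (fun c : R → ℝ => ∑ i, c i • latVec (i : Fin d → ℤ)) ''
    Set.Icc 0 (fun _ => B)
  have hK : IsClosed K :=
    (isCompact_Icc.image (by fun_prop)).isClosed
  have hKC : K ⊆ PointedCone.hull ℝ (latVec '' (R : Set (Fin d → ℤ))) := by
    rintro _ ⟨c, hc, rfl⟩
    exact Submodule.sum_mem _ fun i _ => smul_mem_cone _ (mem_hull_of_mem i.2) (hc.1 i)
  have hcont : Continuous u := u.continuous_of_finiteDimensional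
  filter_upwards [hK.isOpen_compl.mem_nhds fun h => hx (hKC h),
    (isOpen_Iio.preimage hcont).mem_nhds (show x ∈ u ⁻¹' Set.Iio B by simp [B])] with y hy hyB hyC
  obtain ⟨c, hc, rfl⟩ := (mem_hull_image _ _ _).1 hyC
  have hsum : ∑ i ∈ R, c i < B := by
    have : u (∑ i ∈ R, c i • latVec i) = ∑ i ∈ R, c i := by
      rw [map_sum]
      exact Finset.sum_congr rfl fun i hi => by rw [map_smul, hu i hi, smul_eq_mul, mul_one]
    rw [← this]
    exact hyB
  refine hy ⟨fun i => c i, ⟨fun i => hc i, fun i => ?_⟩, Finset.sum_coe_sort R fun i => c i • latVec i⟩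
  exact (Finset.single_le_sum (f := c) (fun i _ => hc i) i.2).trans hsum.le

end ClosedCones

/-! ### The Euler relation in a complete fan -/

section FanEuler

variable {d : ℕ}

theorem Fan.exists_core (F : Fan d) {C : PointedCone ℝ (Fin d → ℝ)} (hC : C ∈ F.cones)
    {x : Fin d → ℝ} (hx : x ∈ C) : ∃ D ∈ F.cones, x ∈ core D :=
  ⟨_, F.face_mem C hC _ (isFaceOf_faceOf C x hx), mem_core_faceOf C x hx⟩

/-- `C ⊓ D` is a face of `C` meeting the relative interior of `C`, hence equal to `C`. Consequently
the relative interiors of different cones of a fan are disjoint. -/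
theorem Fan.le_of_mem_core (F : Fan d) {C D : PointedCone ℝ (Fin d → ℝ)} (hC : C ∈ F.cones)
    (hD : D ∈ F.cones) {x : Fin d → ℝ} (hx : x ∈ core C) (hxD : x ∈ D) : C ≤ D :=
  (ToricGenus.le_of_mem_core (F.inter_face C hC D hD) hx ⟨hx.1, hxD⟩).trans inf_le_right

/-- The rays of a cone of a fan, as a finite set. -/
structure Fan.RayData (F : Fan d) (deg : (Fin d → ℤ) → ℤ) (C : PointedCone ℝ (Fin d → ℝ)) where
  rays : Finset (Fin d → ℤ)
  coe_rays : (rays : Set (Fin d → ℤ)) = rayGens C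
  eq_hull : C = PointedCone.hull ℝ (latVec '' (rays : Set (Fin d → ℤ)))
  form : Fin d → ℤ
  form_rays : ∀ n ∈ rays, form ⬝ᵥ n = 1
  deg_eq : ∀ n, latVec n ∈ C → deg n = form ⬝ᵥ n

theorem Fan.exists_rayData (F : Fan d) {deg : (Fin d → ℤ) → ℤ} (hdeg : F.IsDegree deg)
    {C : PointedCone ℝ (Fin d → ℝ)} (hC : C ∈ F.cones) : Nonempty (F.RayData deg C) := by
  obtain ⟨⟨u, hu⟩, h1⟩ := hdeg C hC
  obtain ⟨S, hS⟩ := F.rational C hC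
  have hu1 : ∀ n ∈ rayGens C, u ⬝ᵥ n = 1 := fun n hn => by
    rw [← hu n (mem_of_mem_rayGens hn), h1 n hn]
  have hfin := finite_rayGens S hS u hu1
  refine ⟨⟨hfin.toFinset, by simp, ?_, u, fun n hn => hu1 n (by simpa using hn), hu⟩⟩
  rw [hfin.coe_toFinset]
  exact hull_rayGens S hS (F.salient C hC)

/-- Adding a small multiple of a relative interior point moves `x` into the relative interior
without leaving `U`; from a point there one can move a little along every `y ∈ C`. -/
theorem dirSpan_core_inter {ι : Type*} (f : ι → Fin d → ℝ) (S : Finset ι)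
    {C : PointedCone ℝ (Fin d → ℝ)} (hC : C = PointedCone.hull ℝ (f '' (S : Set ι)))
    {U : Set (Fin d → ℝ)} (hU : IsOpen U) {x : Fin d → ℝ} (hx : x ∈ C) (hxU : x ∈ U) :
    (core C ∩ U).Nonempty ∧ dirSpan (core C ∩ U) = Submodule.span ℝ (C : Set (Fin d → ℝ)) := by
  have hsmall : ∀ p ∈ U, ∀ y : Fin d → ℝ, ∃ ε : ℝ, 0 < ε ∧ p + ε • y ∈ U := by
    intro p hp y
    have hc : Filter.Tendsto (fun ε : ℝ => p + ε • y) (nhdsWithin 0 (Set.Ioi 0)) (nhds p) := by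
      have : Continuous fun ε : ℝ => p + ε • y := by fun_prop
      simpa using (this.tendsto 0).mono_left nhdsWithin_le_nhds
    obtain ⟨ε, h1, h2⟩ := ((hc.eventually (hU.mem_nhds hp)).and self_mem_nhdsWithin).exists
    exact ⟨ε, h2, h1⟩
  have hne : (core C ∩ U).Nonempty := by
    obtain ⟨c, hc⟩ := core_nonempty f S
    rw [← hC] at hc
    obtain ⟨ε, hε, h⟩ := hsmall x hxU c
    exact ⟨x + ε • c, by rw [add_comm]; exact core_add_mem (smul_mem_core hc hε) hx, h⟩
  refine ⟨hne, le_antisymm (Submodule.span_le.2 ?_) (Submodule.span_le.2 fun y hy => ?_)⟩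
  · rintro _ ⟨p, hp, r, hr, rfl⟩
    exact Submodule.sub_mem _ (Submodule.subset_span hp.1.1) (Submodule.subset_span hr.1.1)
  · obtain ⟨p, hp, hpU⟩ := hne
    obtain ⟨ε, hε, h⟩ := hsmall p hpU y
    have := sub_mem_dirSpan (A := core C ∩ U)
      ⟨core_add_mem hp (smul_mem_cone C hy hε.le), h⟩ ⟨hp, hpU⟩
    rw [add_sub_cancel_left] at this
    exact (Submodule.smul_mem_iff _ hε.ne').1 this

theorem RelOpen.inter_open {A U : Set (Fin d → ℝ)} (hA : RelOpen A) (hU : IsOpen U)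
    (hUc : Convex ℝ U) : RelOpen (A ∩ U) where
  convex := hA.convex.inter hUc
  extend := by
    rintro x ⟨hx, hxU⟩ y ⟨hy, hyU⟩
    obtain ⟨ε, hε, h⟩ := hA.extend x hx y hy
    have hc : Filter.Tendsto (fun ε : ℝ => x + ε • (x - y)) (nhdsWithin 0 (Set.Ioi 0))
        (nhds x) := by
      have : Continuous fun ε : ℝ => x + ε • (x - y) := by fun_prop
      simpa using (this.tendsto 0).mono_left nhdsWithin_le_nhds
    obtain ⟨δ, h1, h2, h3⟩ := ((hc.eventually (hU.mem_nhds hxU)).and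
      (Ioo_mem_nhdsGT hε)).exists
    exact ⟨δ, h2, add_smul_mem_of_le hA.convex hx h h2.le h3.le, h1⟩

/-- The Euler relation for the cones of a complete fan that contain a given point. -/
theorem Fan.sum_codim_eq_one (F : Fan d) (hF : F.IsComplete) {deg : (Fin d → ℤ) → ℤ}
    (hdeg : F.IsDegree deg) (x : Fin d → ℝ) :
    ∑ C ∈ F.cones, (-1 : ℤ) ^ (d - coneDim C) * Set.indicator (C : Set (Fin d → ℝ)) 1 x = 1 := by
  classical
  have hclosed : ∀ C ∈ F.cones, IsClosed (C : Set (Fin d → ℝ)) := by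
    intro C hC
    obtain ⟨D⟩ := F.exists_rayData hdeg hC
    rw [D.eq_hull]
    refine isClosed_hull D.rays (pairing D.form) fun r hr => ?_
    rw [pairing_latVec, D.form_rays r hr, Int.cast_one]
  set s := F.cones.filter fun C => x ∈ C with hs
  have hW : IsOpen (⋂ C ∈ F.cones.filter fun C => x ∉ C, (C : Set (Fin d → ℝ))ᶜ) :=
    isOpen_biInter_finset fun C hC => (hclosed C (Finset.mem_filter.1 hC).1).isOpen_compl
  -- The cones are closed and finite in number, so a small ball about `x` meets only those that
  -- contain `x`.
  obtain ⟨r, hr, hball⟩ := Metric.isOpen_iff.1 hW x (by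
    simp only [Set.mem_iInter]
    exact fun C hC => (Finset.mem_filter.1 hC).2)
  have hin : ∀ y ∈ Metric.ball x r, ∀ C ∈ F.cones, y ∈ C → x ∈ C := by
    intro y hy C hC hyC
    by_contra hx
    have := hball hy
    simp only [Set.mem_iInter] at this
    exact this C (Finset.mem_filter.2 ⟨hC, hx⟩) hyC
  -- The relation to be used: the ball, indexed by `none` with coefficient `-1`, is the disjoint
  -- union of its intersections with the relative interiors of the cones through `x`.
  let R : Option (PointedCone ℝ (Fin d → ℝ)) → Set (Fin d → ℝ) := fun o =>
    o.elim (Metric.ball x r) fun C => core C ∩ Metric.ball x r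
  let a : Option (PointedCone ℝ (Fin d → ℝ)) → ℤ := fun o => o.elim (-1) fun _ => 1
  have hdata : ∀ C ∈ s, (core C ∩ Metric.ball x r).Nonempty ∧
      dirSpan (core C ∩ Metric.ball x r) = Submodule.span ℝ (C : Set (Fin d → ℝ)) := by
    intro C hC
    obtain ⟨D⟩ := F.exists_rayData hdeg (Finset.mem_filter.1 hC).1
    exact dirSpan_core_inter latVec D.rays D.eq_hull Metric.isOpen_ball
      (Finset.mem_filter.1 hC).2 (Metric.mem_ball_self hr)
  have hROball : RelOpen (Metric.ball x r) := by
    have : RelOpen (Set.univ : Set (Fin d → ℝ)) := ⟨convex_univ, fun _ _ _ _ => ⟨1, one_pos, trivial⟩⟩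
    simpa using this.inter_open Metric.isOpen_ball (convex_ball x r)
  have hdirball : dirSpan (Metric.ball x r) = ⊤ := by
    rw [eq_top_iff]
    intro y _
    have hc : Filter.Tendsto (fun ε : ℝ => x + ε • y) (nhdsWithin 0 (Set.Ioi 0)) (nhds x) := by
      have : Continuous fun ε : ℝ => x + ε • y := by fun_prop
      simpa using (this.tendsto 0).mono_left nhdsWithin_le_nhds
    obtain ⟨ε, h1, h2⟩ := ((hc.eventually (Metric.ball_mem_nhds x hr)).and
      self_mem_nhdsWithin).exists
    have := sub_mem_dirSpan (A := Metric.ball x r) h1 (Metric.mem_ball_self hr)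
    rw [add_sub_cancel_left] at this
    exact (Submodule.smul_mem_iff _ (ne_of_gt h2)).1 this
  have key := euler_relation (Finset.insertNone s) a R ?_ ?_ ?_ ?_
  · rw [Finset.sum_insertNone] at key
    have e0 : Module.finrank ℝ (dirSpan (R none)) = d := by
      rw [show dirSpan (R none) = ⊤ from hdirball, finrank_top, Module.finrank_fin_fun]
    have e1 : ∀ C ∈ s, a (some C) * (-1) ^ Module.finrank ℝ (dirSpan (R (some C))) =
        (-1) ^ coneDim C := fun C hC => by
      rw [show dirSpan (R (some C)) = _ from (hdata C hC).2]
      exact one_mul _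
    rw [e0, Finset.sum_congr rfl e1, show a none = -1 from rfl] at key
    have h1 : ∑ C ∈ F.cones, (-1 : ℤ) ^ (d - coneDim C) *
        Set.indicator (C : Set (Fin d → ℝ)) 1 x = ∑ C ∈ s, (-1 : ℤ) ^ (d - coneDim C) := by
      rw [hs, Finset.sum_filter]
      refine Finset.sum_congr rfl fun C _ => ?_
      by_cases h : x ∈ C <;> simp [h]
    have h2 : ∀ C : PointedCone ℝ (Fin d → ℝ), (-1 : ℤ) ^ (d - coneDim C) =
        (-1) ^ d * (-1) ^ coneDim C := by
      clear key
      intro C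
      -- Makes the natural subtraction `d - coneDim C` the true codimension.
      have hle : coneDim C ≤ d := by
        have := Submodule.finrank_le (Submodule.span ℝ (C : Set (Fin d → ℝ)))
        rwa [Module.finrank_fin_fun] at this
      obtain ⟨k, hk⟩ := Nat.exists_eq_add_of_le hle
      generalize coneDim C = j at hk ⊢
      subst hk
      rw [Nat.add_sub_cancel_left, pow_add, mul_right_comm, ← mul_pow]
      simp
    rw [h1, Finset.sum_congr rfl fun C _ => h2 C, ← Finset.mul_sum]
    have h3 : ∑ C ∈ s, (-1 : ℤ) ^ coneDim C = (-1) ^ d := by linarith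
    rw [h3, ← mul_pow]
    simp
  · intro o ho
    cases o with
    | none => exact ⟨x, Metric.mem_ball_self hr⟩
    | some C => exact (hdata C (Finset.some_mem_insertNone.1 ho)).1
  · intro o ho
    cases o with
    | none => exact hROball
    | some C => exact (relOpen_core C).inter_open Metric.isOpen_ball (convex_ball x r)
  · intro l o _
    have hl : Bornology.IsBounded (l '' Metric.ball x r) := by
      have := (ProperSpace.isCompact_closedBall x r).image l.continuous_of_finiteDimensional
      exact this.isBounded.subset (Set.image_mono Metric.ball_subset_closedBall)
    cases o with
    | none => exact hl
    | some C => exact hl.subset (Set.image_mono Set.inter_subset_right)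
  · intro y
    rw [Finset.sum_insertNone]
    simp only [a, R, Option.elim_none, Option.elim_some, one_mul]
    by_cases hy : y ∈ Metric.ball x r
    · obtain ⟨C₀, hC₀, hyC₀⟩ := hF y
      obtain ⟨C, hC, hyC⟩ := F.exists_core hC₀ hyC₀
      have hCs : C ∈ s := Finset.mem_filter.2 ⟨hC, hin y hy C hC hyC.1⟩
      rw [Finset.sum_eq_single_of_mem C hCs, Set.indicator_of_mem hy,
        Set.indicator_of_mem (show y ∈ core C ∩ Metric.ball x r from ⟨hyC, hy⟩)]
      · simp
      · intro D hD hDC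
        refine Set.indicator_of_notMem (fun h => hDC ?_) _
        have hD' := (Finset.mem_filter.1 hD).1
        exact le_antisymm (F.le_of_mem_core hD' hC h.1 hyC.1) (F.le_of_mem_core hC hD' hyC h.1.1)
    · rw [Set.indicator_of_notMem hy, Finset.sum_eq_zero fun C _ => Set.indicator_of_notMem
        (fun h => hy h.2) _]
      simp

end FanEuler

end ToricGenus

end

noncomputable section

namespace ToricGenus

/-! ### Regular triangulations from generic heights -/

section Triangulation

variable {ι E : Type*} [AddCommGroup E] [Module ℝ E]

theorem exists_coords [DecidableEq ι] {f : ι → E} {I : Finset ι}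
    (hI : LinearIndepOn ℝ f (I : Set ι)) :
    ∃ co : ι → E →ₗ[ℝ] ℝ, ∀ i ∈ I, ∀ k ∈ I, co i (f k) = if i = k then 1 else 0 := by
  obtain ⟨g, hg⟩ := LinearMap.exists_leftInverse_of_injective
    (Finsupp.linearCombination ℝ fun i : (I : Set ι) => f i) (LinearMap.ker_eq_bot.2 hI)
  refine ⟨fun i => if h : i ∈ I then Finsupp.lapply (⟨i, h⟩ : (I : Set ι)) ∘ₗ g else 0, ?_⟩
  intro i hi k hk
  have hk' : g (f k) = Finsupp.single (⟨k, hk⟩ : (I : Set ι)) 1 := by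
    have := LinearMap.congr_fun hg (Finsupp.single (⟨k, hk⟩ : (I : Set ι)) 1)
    simpa using this
  simp only [hi, dif_pos, LinearMap.comp_apply, hk', Finsupp.lapply_apply, Finsupp.single_apply]
  simp [eq_comm]

theorem coords_sum [DecidableEq ι] {f : ι → E} {I : Finset ι} {co : ι → E →ₗ[ℝ] ℝ}
    (hco : ∀ i ∈ I, ∀ k ∈ I, co i (f k) = if i = k then 1 else 0) (c : ι → ℝ) {i : ι}
    (hi : i ∈ I) : co i (∑ k ∈ I, c k • f k) = c i := by
  rw [map_sum, Finset.sum_eq_single_of_mem i hi]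
  · rw [map_smul, hco i hi i hi]; simp
  · intro k hk hki
    rw [map_smul, hco i hi k hk, if_neg (Ne.symm hki), smul_zero]

theorem mem_hull_of_sum {f : ι → E} {I : Finset ι} {c : ι → ℝ} (hc : ∀ i ∈ I, 0 ≤ c i) :
    ∑ i ∈ I, c i • f i ∈ PointedCone.hull ℝ (f '' (I : Set ι)) :=
  Submodule.sum_mem _ fun i hi => smul_mem_cone _ (mem_hull_of_mem hi) (hc i hi)

/-- Carathéodory's theorem, with control on a linear cost. -/
theorem exists_basic_le [DecidableEq ι] (f : ι → E) (u : E →ₗ[ℝ] ℝ) (h : ι → ℝ) (R : Finset ι)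
    (hu : ∀ r ∈ R, u (f r) = 1) (c : ι → ℝ) (hc : ∀ i ∈ R, 0 ≤ c i) :
    ∃ I ⊆ R, LinearIndepOn ℝ f (I : Set ι) ∧ ∃ c' : ι → ℝ, (∀ i ∈ I, 0 ≤ c' i) ∧
      ∑ i ∈ R, c i • f i = ∑ i ∈ I, c' i • f i ∧ ∑ i ∈ I, c' i * h i ≤ ∑ i ∈ R, c i * h i := by
  induction hn : R.card using Nat.strong_induction_on generalizing R c with
  | _ n ih =>
    subst hn
    by_cases hR : LinearIndepOn ℝ f (R : Set ι)
    · exact ⟨R, subset_rfl, hR, c, hc, rfl, le_rfl⟩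
    rw [linearIndepOn_finset_iff] at hR
    push Not at hR
    obtain ⟨a, ha0, j, hj, haj⟩ := hR
    -- The sign of the relation is chosen so that subtracting it does not raise the cost.
    obtain ⟨a, ha0, haj, hah⟩ : ∃ a : ι → ℝ, ∑ i ∈ R, a i • f i = 0 ∧ (∃ j ∈ R, a j ≠ 0) ∧
        0 ≤ ∑ i ∈ R, a i * h i := by
      rcases le_total 0 (∑ i ∈ R, a i * h i) with hs | hs
      · exact ⟨a, ha0, ⟨j, hj, haj⟩, hs⟩
      · refine ⟨fun i => -a i, ?_, ⟨j, hj, neg_ne_zero.2 haj⟩, ?_⟩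
        · simp [ha0]
        · simpa using hs
    -- Applying `u` gives `∑ a i = 0`, so a nontrivial relation has a positive coefficient; the
    -- minimal ratio below is the step at which a first coefficient of `c` reaches zero.
    obtain ⟨i₁, hi₁, hai₁⟩ : ∃ i ∈ R, 0 < a i := by
      by_contra! hneg
      have hs : ∑ i ∈ R, a i = 0 := by
        have := congrArg u ha0
        rw [map_sum, map_zero] at this
        rw [← this]
        exact Finset.sum_congr rfl fun i hi => by rw [map_smul, hu i hi, smul_eq_mul, mul_one]
      obtain ⟨j, hj, haj⟩ := haj
      exact haj ((Finset.sum_eq_zero_iff_of_nonpos hneg).1 hs j hj)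
    obtain ⟨i₀, hi₀, hmin⟩ := Finset.exists_min_image (R.filter fun i => 0 < a i)
      (fun i => c i / a i) ⟨i₁, Finset.mem_filter.2 ⟨hi₁, hai₁⟩⟩
    obtain ⟨hi₀R, hai₀⟩ := Finset.mem_filter.1 hi₀
    set t := c i₀ / a i₀ with ht
    have ht0 : 0 ≤ t := div_nonneg (hc _ hi₀R) hai₀.le
    have hz : c i₀ - t * a i₀ = 0 := by rw [ht, div_mul_cancel₀ _ hai₀.ne', sub_self]
    obtain ⟨I, hIR, hI, c', hc', hsum, hcost⟩ := ih _ (Finset.card_erase_lt_of_mem hi₀R)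
      (R.erase i₀) (fun r hr => hu r (Finset.mem_of_mem_erase hr)) (fun i => c i - t * a i) (by
        intro i hi
        have hiR := Finset.mem_of_mem_erase hi
        rcases lt_or_ge 0 (a i) with hp | hp
        · have := hmin i (Finset.mem_filter.2 ⟨hiR, hp⟩)
          rw [le_div_iff₀ hp] at this
          linarith
        · nlinarith [hc i hiR]) rfl
    refine ⟨I, hIR.trans (Finset.erase_subset _ _), hI, c', hc', ?_, ?_⟩
    · rw [← hsum, Finset.sum_erase _ (by rw [hz, zero_smul])]
      simp only [sub_smul, Finset.sum_sub_distrib, mul_smul]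
      rw [← Finset.smul_sum, ha0, smul_zero, sub_zero]
    · refine hcost.trans ?_
      rw [Finset.sum_erase _ (by rw [hz, zero_mul])]
      simp only [sub_mul, Finset.sum_sub_distrib, mul_assoc]
      rw [← Finset.mul_sum]
      nlinarith

/-- A point is generic for a family of vectors if it lies in no proper subspace of their span that
is spanned by some of them. -/
def IsGenericFor (f : ι → E) (R : Finset ι) (p : E) : Prop :=
  ∀ J ⊆ R, Submodule.span ℝ (f '' (J : Set ι)) ≠ Submodule.span ℝ (f '' (R : Set ι)) →
    p ∉ Submodule.span ℝ (f '' (J : Set ι))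

/-- If a coefficient vanished, `p` would lie in the span of the remaining vectors of `I`, which is a
proper subspace by independence. -/
theorem IsGenericFor.coeff_ne_zero [DecidableEq ι] {f : ι → E} {R I : Finset ι} {p : E}
    (hp : IsGenericFor f R p) (hIR : I ⊆ R) (hI : LinearIndepOn ℝ f (I : Set ι)) {c : ι → ℝ}
    (hc : p = ∑ i ∈ I, c i • f i) {i : ι} (hi : i ∈ I) : c i ≠ 0 := by
  intro h0
  obtain ⟨co, hco⟩ := exists_coords hI
  refine hp (I.erase i) ((Finset.erase_subset _ _).trans hIR) (fun h => ?_) ?_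
  · have h1 : f i ∈ Submodule.span ℝ (f '' ((I.erase i : Finset ι) : Set ι)) := by
      rw [h]; exact Submodule.subset_span ⟨i, hIR hi, rfl⟩
    have h2 : Submodule.span ℝ (f '' ((I.erase i : Finset ι) : Set ι)) ≤ LinearMap.ker (co i) := by
      refine Submodule.span_le.2 ?_
      rintro _ ⟨k, hk, rfl⟩
      have hk' := Finset.mem_erase.1 (Finset.mem_coe.1 hk)
      change co i (f k) = 0
      rw [hco i hi k hk'.2, if_neg (Ne.symm hk'.1)]
    have h3 : co i (f i) = 0 := h2 h1
    rw [hco i hi i hi, if_pos rfl] at h3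
    exact one_ne_zero h3
  · rw [hc, ← Finset.sum_erase I (a := i) (by rw [h0, zero_smul])]
    exact Submodule.sum_mem _ fun k hk => Submodule.smul_mem _ _ (Submodule.subset_span ⟨k, hk, rfl⟩)

theorem mem_span_of_mem_hull {s : Set E} {p : E} (hp : p ∈ PointedCone.hull ℝ s) :
    p ∈ Submodule.span ℝ s := PointedCone.hull_le_span ℝ s hp

/-- Each condition excludes the kernel of one linear functional of `h`, nonzero because `h j` occurs
with coefficient 1. Finitely many nonzero functionals have a common nonzero point. -/
theorem exists_generic_heights [DecidableEq ι] (R : Finset ι)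
    (g : Finset ι → ι → ι → ℝ) :
    ∃ h : ι → ℝ, ∀ I ⊆ R, ∀ j ∈ R, j ∉ I → ∑ i ∈ I, h i * g I j i ≠ h j := by
  -- Erasing `j` from `I` keeps the functional nonzero also for the irrelevant pairs with `j ∈ I`.
  let φ : (R.powerset ×ˢ R : Finset (Finset ι × ι)) → Module.Dual ℝ (ι → ℝ) := fun x =>
    LinearMap.proj x.1.2 - ∑ i ∈ x.1.1.erase x.1.2, g x.1.1 x.1.2 i • LinearMap.proj i
  obtain ⟨h, hh⟩ := Module.Dual.exists_forall_ne_zero_of_forall_exists φ fun x => by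
    refine ⟨Pi.single x.1.2 1, ?_⟩
    simp only [φ, LinearMap.sub_apply, LinearMap.proj_apply, Pi.single_eq_same,
      LinearMap.sum_apply, LinearMap.smul_apply]
    rw [Finset.sum_eq_zero fun i hi => by
      rw [Pi.single_eq_of_ne (Finset.ne_of_mem_erase hi), smul_zero]]
    simp
  refine ⟨h, fun I hI j hj hjI heq => ?_⟩
  refine hh ⟨(I, j), Finset.mem_product.2 ⟨Finset.mem_powerset.2 hI, hj⟩⟩ ?_
  simp only [φ, LinearMap.sub_apply, LinearMap.proj_apply, LinearMap.sum_apply,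
    LinearMap.smul_apply, Finset.erase_eq_of_notMem hjI, smul_eq_mul]
  rw [← heq, sub_eq_zero]
  exact Finset.sum_congr rfl fun i _ => mul_comm _ _

/-- Every cone with generators on an affine hyperplane has a triangulation with the same
generators. -/
theorem exists_triangulation [DecidableEq ι] (f : ι → E) (u : E →ₗ[ℝ] ℝ) (R : Finset ι)
    (hu : ∀ r ∈ R, u (f r) = 1) :
    ∃ T : Finset (Finset ι), (∀ I ∈ T, I ⊆ R ∧ LinearIndepOn ℝ f (I : Set ι) ∧
      Submodule.span ℝ (f '' (I : Set ι)) = Submodule.span ℝ (f '' (R : Set ι))) ∧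
      ∀ p, IsGenericFor f R p → p ∈ PointedCone.hull ℝ (f '' (R : Set ι)) →
        ∃! I, I ∈ T ∧ p ∈ PointedCone.hull ℝ (f '' (I : Set ι)) := by
  classical
  have hex : ∀ I : Finset ι, ∃ co : ι → E →ₗ[ℝ] ℝ, LinearIndepOn ℝ f (I : Set ι) →
      ∀ i ∈ I, ∀ k ∈ I, co i (f k) = if i = k then 1 else 0 := fun I => by
    by_cases hI : LinearIndepOn ℝ f (I : Set ι)
    · obtain ⟨co, hco⟩ := exists_coords hI
      exact ⟨co, fun _ => hco⟩
    · exact ⟨0, fun h => absurd h hI⟩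
  choose co hco using hex
  obtain ⟨h, hh⟩ := exists_generic_heights R fun I j i => co I i (f j)
  -- For independent `I`, `ω I` is a linear function with the prescribed heights on `I`.
  let ω : Finset ι → E →ₗ[ℝ] ℝ := fun I => ∑ i ∈ I, h i • co I i
  have hω : ∀ I : Finset ι, ∀ x, ω I x = ∑ i ∈ I, h i * co I i x := fun I x => by
    simp [ω, LinearMap.sum_apply]
  have hωI : ∀ I : Finset ι, LinearIndepOn ℝ f (I : Set ι) → ∀ i ∈ I, ω I (f i) = h i := by
    intro I hI i hi
    rw [hω, Finset.sum_eq_single_of_mem i hi]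
    · rw [hco I hI i hi i hi]; simp
    · intro k hk hki
      rw [hco I hI k hk i hi, if_neg hki, mul_zero]
  have hωsum : ∀ I : Finset ι, ∀ J : Finset ι, ∀ c : ι → ℝ,
      ω I (∑ i ∈ J, c i • f i) = ∑ i ∈ J, c i * ω I (f i) := fun I J c => by
    simp [map_sum]
  -- The simplices of the lower hull: the other generators, lifted to their heights, lie strictly
  -- above the graph of `ω I`.
  let T := R.powerset.filter fun I : Finset ι => LinearIndepOn ℝ f (I : Set ι) ∧
    Submodule.span ℝ (f '' (I : Set ι)) = Submodule.span ℝ (f '' (R : Set ι)) ∧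
    ∀ j ∈ R, j ∉ I → ω I (f j) < h j
  have hT : ∀ I : Finset ι, I ∈ T ↔ I ⊆ R ∧ LinearIndepOn ℝ f (I : Set ι) ∧
      Submodule.span ℝ (f '' (I : Set ι)) = Submodule.span ℝ (f '' (R : Set ι)) ∧
      ∀ j ∈ R, j ∉ I → ω I (f j) < h j := fun I => by
    simp [T]
  refine ⟨T, fun I hI => ?_, fun p hp hpR => ?_⟩
  · obtain ⟨h1, h2, h3, -⟩ := (hT I).1 hI
    exact ⟨h1, h2, h3⟩
  obtain ⟨I, ⟨hIT, hpI⟩⟩ : ∃ I : Finset ι, I ∈ T ∧ p ∈ PointedCone.hull ℝ (f '' (I : Set ι)) := by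
    -- Existence is linear programming: among the independent `I` whose cone contains `p`, the one
    -- with least cost `ω I p` belongs to `T`.
    let B := R.powerset.filter fun I : Finset ι => LinearIndepOn ℝ f (I : Set ι) ∧
      p ∈ PointedCone.hull ℝ (f '' (I : Set ι))
    have hB : B.Nonempty := by
      obtain ⟨c, hc, rfl⟩ := (mem_hull_image _ _ _).1 hpR
      obtain ⟨I, hIR, hI, c', hc', hsum, -⟩ := exists_basic_le f u 0 R hu c fun i _ => hc i
      exact ⟨I, Finset.mem_filter.2 ⟨Finset.mem_powerset.2 hIR, hI, hsum ▸ mem_hull_of_sum hc'⟩⟩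
    obtain ⟨I, hIB, hmin⟩ := Finset.exists_min_image B (fun I : Finset ι => ω I p) hB
    obtain ⟨hIR, hI, hpI⟩ := Finset.mem_filter.1 hIB
    rw [Finset.mem_powerset] at hIR
    have hspan : Submodule.span ℝ (f '' (I : Set ι)) = Submodule.span ℝ (f '' (R : Set ι)) := by
      by_contra hne
      exact hp I hIR hne (mem_span_of_mem_hull hpI)
    obtain ⟨c, hc, hpc⟩ := (mem_hull_image _ _ _).1 hpI
    have hcpos : ∀ i ∈ I, 0 < c i := fun i hi =>
      lt_of_le_of_ne (hc i) (Ne.symm (hp.coeff_ne_zero hIR hI hpc hi))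
    refine ⟨I, (hT I).2 ⟨hIR, hI, hspan, fun j hj hjI => ?_⟩, hpI⟩
    by_contra hlt
    have hne : ω I (f j) ≠ h j := by
      rw [hω]; exact hh I hIR j hj hjI
    have hgt : h j < ω I (f j) := lt_of_le_of_ne (not_lt.1 hlt) hne.symm
    have hjspan : f j ∈ Submodule.span ℝ (f '' (I : Set ι)) := by
      rw [hspan]; exact Submodule.subset_span ⟨j, hj, rfl⟩
    rw [Submodule.mem_span_image_finset_iff_exists_fun'] at hjspan
    obtain ⟨a, ha⟩ := hjspan
    -- If `f j` lies below the graph, trade a small amount `s` of its expansion in `I` for `f j`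
    -- itself. The new representation of `p` is strictly cheaper, and passing to an independent
    -- subset contradicts minimality.
    obtain ⟨s, hs, hsa⟩ : ∃ s > (0 : ℝ), ∀ i ∈ I, 0 ≤ c i - s * a i := by
      clear hpc hspan hpI hI hIR hmin hIB ha hne hgt hlt hjI
      induction I using Finset.induction_on with
      | empty => exact ⟨1, one_pos, by simp⟩
      | insert x I _ ih =>
        obtain ⟨s, hs, hsa⟩ := ih fun i hi => hcpos i (Finset.mem_insert_of_mem hi)
        have hx := hcpos x (Finset.mem_insert_self _ _)
        have hd : 0 < 1 + |a x| := by positivity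
        refine ⟨min s (c x / (1 + |a x|)), lt_min hs (by positivity), fun i hi => ?_⟩
        have hm : 0 < min s (c x / (1 + |a x|)) := lt_min hs (by positivity)
        rcases Finset.mem_insert.1 hi with rfl | hi
        · have h1 : min s (c i / (1 + |a i|)) * (1 + |a i|) ≤ c i := by
            rw [← le_div_iff₀ hd]; exact min_le_right _ _
          nlinarith [le_abs_self (a i)]
        · have h1 := hsa i hi
          rcases le_total 0 (a i) with h2 | h2
          · nlinarith [min_le_left s (c x / (1 + |a x|))]
          · nlinarith [hc i]
    let c₂ : ι → ℝ := fun i => if i = j then s else c i - s * a i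
    have hij : ∀ i ∈ I, i ≠ j := fun i hi hij => hjI (hij ▸ hi)
    have hc₂ : ∀ g : ι → ℝ, ∑ i ∈ I, c₂ i * g i = ∑ i ∈ I, (c i - s * a i) * g i := fun g =>
      Finset.sum_congr rfl fun i hi => by
        simp only [c₂]; rw [if_neg (hij i hi)]
    obtain ⟨I', hI'sub, hI', c', hc', hsum, hcost⟩ := exists_basic_le f u h (insert j I)
      (fun r hr => hu r (by
        rcases Finset.mem_insert.1 hr with rfl | hr
        exacts [hj, hIR hr])) c₂ (fun i hi => by
          simp only [c₂]
          split_ifs with hij'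
          · exact hs.le
          · exact hsa i ((Finset.mem_insert.1 hi).resolve_left hij'))
    have hp2 : ∑ i ∈ insert j I, c₂ i • f i = p := by
      rw [Finset.sum_insert hjI, hpc, Finset.sum_congr rfl (g := fun i => c i • f i - s • a i • f i)
        fun i hi => by
          simp only [c₂]; rw [if_neg (hij i hi)]; module]
      rw [Finset.sum_sub_distrib, ← Finset.smul_sum, ha]
      simp [c₂]
    rw [hp2] at hsum
    have hI'B : I' ∈ B := by
      refine Finset.mem_filter.2 ⟨Finset.mem_powerset.2 (hI'sub.trans ?_), hI',
        hsum ▸ mem_hull_of_sum hc'⟩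
      exact Finset.insert_subset hj hIR
    have h1 := hmin I' hI'B
    have h2 : ω I' p = ∑ i ∈ I', c' i * h i := by
      rw [hsum, hωsum]
      exact Finset.sum_congr rfl fun i hi => by rw [hωI I' hI' i hi]
    have h3 : ω I p = ∑ i ∈ I, c i * h i := by
      rw [hpc, hωsum]
      exact Finset.sum_congr rfl fun i hi => by rw [hωI I hI i hi]
    have h4 : ω I (f j) = ∑ i ∈ I, a i * h i := by
      rw [← ha, hωsum]
      exact Finset.sum_congr rfl fun i hi => by rw [hωI I hI i hi]
    rw [Finset.sum_insert hjI, hc₂ h] at hcost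
    simp only [c₂, if_pos, sub_mul, Finset.sum_sub_distrib, mul_assoc] at hcost
    rw [← Finset.mul_sum, ← h4, ← h3] at hcost
    nlinarith [mul_pos hs (sub_pos.2 hgt)]
  refine ⟨I, ⟨hIT, hpI⟩, ?_⟩
  -- Each of the two expansions of `p` costs at most as much as the other, so equality holds term by
  -- term. The coefficients are nonzero, so each `i ∈ J` lies on the graph of `ω I`, which forces `i
  -- ∈ I`.
  have main : ∀ I J : Finset ι, I ∈ T → J ∈ T → p ∈ PointedCone.hull ℝ (f '' (I : Set ι)) →
      p ∈ PointedCone.hull ℝ (f '' (J : Set ι)) → J ⊆ I := by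
    have hle : ∀ I J : Finset ι, I ∈ T → J ∈ T → ∀ c c' : ι → ℝ, (∀ i, 0 ≤ c' i) →
        p = ∑ i ∈ I, c i • f i → p = ∑ i ∈ J, c' i • f i →
        ∑ i ∈ I, c i * h i = ∑ i ∈ J, c' i * ω I (f i) ∧
        ∀ i ∈ J, c' i * ω I (f i) ≤ c' i * h i := by
      intro I J hI hJ c c' hc' h1 h2
      obtain ⟨hIR, hIL, -, hIω⟩ := (hT I).1 hI
      refine ⟨?_, fun i hi => mul_le_mul_of_nonneg_left ?_ (hc' i)⟩
      · rw [← hωsum, ← h2, h1, hωsum]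
        exact Finset.sum_congr rfl fun i hi => by rw [hωI I hIL i hi]
      · by_cases hiI : i ∈ I
        · exact (hωI I hIL i hiI).le
        · exact (hIω i (((hT J).1 hJ).1 hi) hiI).le
    intro I J hI hJ hpI hpJ
    obtain ⟨c, hc, h1⟩ := (mem_hull_image _ _ _).1 hpI
    obtain ⟨c', hc', h2⟩ := (mem_hull_image _ _ _).1 hpJ
    obtain ⟨e1, l1⟩ := hle I J hI hJ c c' hc' h1 h2
    obtain ⟨e2, l2⟩ := hle J I hJ hI c' c hc h2 h1
    have k1 := Finset.sum_le_sum l1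
    have k2 := Finset.sum_le_sum l2
    have heq : ∑ i ∈ J, c' i * ω I (f i) = ∑ i ∈ J, c' i * h i := by
      apply le_antisymm k1
      rw [e2]
      exact k2.trans e1.le
    intro i hi
    obtain ⟨hJR, hJL, -, -⟩ := (hT J).1 hJ
    obtain ⟨-, -, -, hIω⟩ := (hT I).1 hI
    by_contra hiI
    have h3 := (Finset.sum_eq_sum_iff_of_le l1).1 heq i hi
    have h4 := mul_left_cancel₀ (hp.coeff_ne_zero hJR hJL h2 hi) h3
    exact (hIω i (hJR hi) hiI).ne h4
  rintro J ⟨hJT, hpJ⟩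
  exact (main I J hIT hJT hpI hpJ).antisymm (main J I hJT hIT hpJ hpI)

end Triangulation

end ToricGenus

end

noncomputable section

namespace ToricGenus

/-! ### Half-open simplicial cones and the decomposition of space -/

section HalfOpenCones

variable {d : ℕ}

/-- The real span of a finite set of lattice vectors. -/
abbrev latSpan (I : Finset (Fin d → ℤ)) : Submodule ℝ (Fin d → ℝ) :=
  Submodule.span ℝ (latVec '' (I : Set (Fin d → ℤ)))

/-- The cone generated by a finite set of lattice vectors. -/
abbrev latHull (I : Finset (Fin d → ℤ)) : PointedCone ℝ (Fin d → ℝ) :=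
  PointedCone.hull ℝ (latVec '' (I : Set (Fin d → ℤ)))

/-- Linear independence over `ℝ` of a finite set of lattice vectors. -/
abbrev LatIndep (I : Finset (Fin d → ℤ)) : Prop :=
  LinearIndepOn ℝ latVec (I : Set (Fin d → ℤ))

open Classical in
/-- Coordinate functionals for linearly independent lattice vectors. -/
def co (I : Finset (Fin d → ℤ)) : (Fin d → ℤ) → (Fin d → ℝ) →ₗ[ℝ] ℝ :=
  if h : LatIndep I then (exists_coords h).choose else 0

theorem co_gen {I : Finset (Fin d → ℤ)} (hI : LatIndep I) {i k : Fin d → ℤ} (hi : i ∈ I)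
    (hk : k ∈ I) : co I i (latVec k) = if i = k then 1 else 0 := by
  classical
  rw [co, dif_pos hI]
  convert (exists_coords hI).choose_spec i hi k hk

theorem sum_co {I : Finset (Fin d → ℤ)} (hI : LatIndep I) {x : Fin d → ℝ} (hx : x ∈ latSpan I) :
    x = ∑ i ∈ I, co I i x • latVec i := by
  classical
  obtain ⟨c, rfl⟩ := Submodule.mem_span_image_finset_iff_exists_fun' ℝ |>.1 hx
  exact Finset.sum_congr rfl fun i hi => by
    rw [coords_sum (fun i hi k hk => co_gen hI hi hk) c hi]

theorem mem_latHull_iff {I : Finset (Fin d → ℤ)} (hI : LatIndep I) (x : Fin d → ℝ) :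
    x ∈ latHull I ↔ x ∈ latSpan I ∧ ∀ i ∈ I, 0 ≤ co I i x := by
  classical
  constructor
  · intro hx
    refine ⟨mem_span_of_mem_hull hx, fun i hi => ?_⟩
    obtain ⟨c, hc, rfl⟩ := (mem_hull_image _ _ _).1 hx
    rw [coords_sum (fun i hi k hk => co_gen hI hi hk) c hi]
    exact hc i
  · rintro ⟨hx, h⟩
    rw [sum_co hI hx]
    exact mem_hull_of_sum h

/-- The simplicial cone generated by `I` without those faces through which one leaves it in the
direction `-v`. -/
def halfOpen (I : Finset (Fin d → ℤ)) (v : Fin d → ℝ) : Set (Fin d → ℝ) :=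
  {x | x ∈ latSpan I ∧ ∀ i ∈ I, 0 < co I i x ∨ (co I i x = 0 ∧ 0 < co I i v)}

theorem halfOpen_subset {I : Finset (Fin d → ℤ)} (hI : LatIndep I) {v x : Fin d → ℝ}
    (hx : x ∈ halfOpen I v) : x ∈ latHull I :=
  (mem_latHull_iff hI x).2 ⟨hx.1, fun i hi => by
    rcases hx.2 i hi with h | h
    exacts [h.le, h.1.ge]⟩

open Filter Topology

/-- Two different parameters `ε` with `x + ε • v ∈ W` would put `v` into `W`. -/
theorem eventually_notMem {W : Submodule ℝ (Fin d → ℝ)} {v : Fin d → ℝ} (hv : v ∉ W)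
    (x : Fin d → ℝ) : ∀ᶠ ε : ℝ in 𝓝[>] 0, x + ε • v ∉ W := by
  by_cases h : ∃ ε₀ : ℝ, 0 < ε₀ ∧ x + ε₀ • v ∈ W
  · obtain ⟨ε₀, h0, h⟩ := h
    filter_upwards [Ioo_mem_nhdsGT h0] with ε hε hmem
    have h1 := W.sub_mem h hmem
    rw [add_sub_add_left_eq_sub, ← sub_smul] at h1
    exact hv ((W.smul_mem_iff (sub_ne_zero.2 hε.2.ne')).1 h1)
  · push Not at h
    filter_upwards [self_mem_nhdsWithin] with ε hε using h ε hε

theorem tendsto_add_smul (x v : Fin d → ℝ) :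
    Tendsto (fun ε : ℝ => x + ε • v) (𝓝[>] 0) (𝓝 x) := by
  have : Continuous fun ε : ℝ => x + ε • v := by fun_prop
  simpa using (this.tendsto 0).mono_left nhdsWithin_le_nhds

/-- For small `ε` the sign of `co I i x + ε * co I i v` is that of the first term unless this
vanishes, and then that of `co I i v`. Statements on half-open cones thus reduce to generic points
`x + ε • v`. -/
theorem eventually_mem_latHull_iff {I : Finset (Fin d → ℤ)} (hI : LatIndep I) {v : Fin d → ℝ}
    (hv : v ∈ latSpan I) (hv0 : ∀ i ∈ I, co I i v ≠ 0) (x : Fin d → ℝ) :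
    ∀ᶠ ε : ℝ in 𝓝[>] 0, (x + ε • v ∈ latHull I ↔ x ∈ halfOpen I v) := by
  have h1 : ∀ᶠ ε : ℝ in 𝓝[>] 0, ∀ i ∈ I,
      (0 ≤ co I i (x + ε • v) ↔ (0 < co I i x ∨ (co I i x = 0 ∧ 0 < co I i v))) := by
    rw [eventually_all_finset]
    intro i hi
    have ht : Tendsto (fun ε : ℝ => co I i (x + ε • v)) (𝓝[>] 0) (𝓝 (co I i x)) :=
      ((co I i).continuous_of_finiteDimensional.tendsto x).comp (tendsto_add_smul x v)
    rcases lt_trichotomy (co I i x) 0 with h | h | h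
    · filter_upwards [ht.eventually (gt_mem_nhds h)] with ε hε
      exact iff_of_false hε.not_ge (by simp [h.not_gt, h.ne])
    · filter_upwards [self_mem_nhdsWithin] with ε hε
      rw [map_add, map_smul, h, zero_add, smul_eq_mul, mul_nonneg_iff_of_pos_left hε]
      simp only [lt_irrefl, false_or, true_and]
      exact ⟨fun h' => lt_of_le_of_ne h' (hv0 i hi).symm, le_of_lt⟩
    · filter_upwards [ht.eventually (lt_mem_nhds h)] with ε hε
      exact iff_of_true hε.le (Or.inl h)
  filter_upwards [h1] with ε hε
  rw [mem_latHull_iff hI, halfOpen]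
  refine and_congr ?_ (forall₂_congr hε)
  exact (Submodule.add_mem_iff_left _ (Submodule.smul_mem _ _ hv))

theorem IsGenericFor.eventually {R : Finset (Fin d → ℤ)} {v : Fin d → ℝ}
    (hv : IsGenericFor latVec R v) (x : Fin d → ℝ) :
    ∀ᶠ ε : ℝ in 𝓝[>] 0, IsGenericFor latVec R (x + ε • v) := by
  have : ∀ᶠ ε : ℝ in 𝓝[>] 0, ∀ J ∈ R.powerset, latSpan J ≠ latSpan R → x + ε • v ∉ latSpan J := by
    rw [eventually_all_finset]
    intro J hJ
    by_cases h : latSpan J = latSpan R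
    · simp [h]
    · filter_upwards [eventually_notMem (hv J (Finset.mem_powerset.1 hJ) h) x] with ε hε _ using hε
  filter_upwards [this] with ε hε J hJ using hε J (Finset.mem_powerset.2 hJ)

theorem IsGenericFor.co_ne_zero {R I : Finset (Fin d → ℤ)} {v : Fin d → ℝ}
    (hv : IsGenericFor latVec R v) (hIR : I ⊆ R) (hI : LatIndep I) (hvI : v ∈ latSpan I)
    {i : Fin d → ℤ} (hi : i ∈ I) : co I i v ≠ 0 := by
  classical
  exact hv.coeff_ne_zero hIR hI (sum_co hI hvI) hi

theorem exists_isGenericFor (R : Finset (Fin d → ℤ)) :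
    ∃ v ∈ latSpan R, IsGenericFor latVec R v := by
  -- A real vector space is no finite union of proper subspaces. The sets `J` that span everything
  -- impose no condition and are given `⊥`, which is proper unless the span of `R` is zero.
  let p : R.powerset → Submodule ℝ (latSpan R) := fun J =>
    if latSpan (J : Finset (Fin d → ℤ)) = latSpan R then ⊥ else
      (latSpan (J : Finset (Fin d → ℤ))).comap (latSpan R).subtype
  by_cases htriv : latSpan R = ⊥
  · refine ⟨0, Submodule.zero_mem _, fun J hJ hne => absurd ?_ hne⟩
    change latSpan J = latSpan R
    rw [htriv, eq_bot_iff, ← htriv]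
    exact Submodule.span_mono (Set.image_mono (Finset.coe_subset.2 hJ))
  have hp : ∀ J, p J ≠ ⊤ := by
    intro J hJ
    simp only [p] at hJ
    split_ifs at hJ with h
    · obtain ⟨x, hx, hx0⟩ := Submodule.exists_mem_ne_zero_of_ne_bot htriv
      have : (⟨x, hx⟩ : latSpan R) ∈ (⊥ : Submodule ℝ (latSpan R)) := hJ ▸ Submodule.mem_top
      exact hx0 (congrArg Subtype.val ((Submodule.mem_bot ℝ).1 this))
    · refine h (le_antisymm
        (Submodule.span_mono (Set.image_mono (Finset.coe_subset.2 (Finset.mem_powerset.1 J.2)))) ?_)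
      intro x hx
      have : (⟨x, hx⟩ : latSpan R) ∈
          (latSpan (J : Finset (Fin d → ℤ))).comap (latSpan R).subtype := hJ ▸ Submodule.mem_top
      exact this
  obtain ⟨v, hv⟩ := Submodule.exists_forall_notMem_of_forall_ne_top p hp
  refine ⟨v, v.2, fun J hJ hne hmem => hv ⟨J, Finset.mem_powerset.2 hJ⟩ ?_⟩
  simp only [p]
  rw [if_neg hne]
  exact hmem

open Classical in
/-- A decomposition of the indicator function of a cone. -/
theorem indicator_latHull_eq_sum {R : Finset (Fin d → ℤ)} {T : Finset (Finset (Fin d → ℤ))}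
    (hT : ∀ I ∈ T, I ⊆ R ∧ LatIndep I ∧ latSpan I = latSpan R)
    {p : Fin d → ℝ} (hu : p ∈ latHull R → ∃! I, I ∈ T ∧ p ∈ latHull I) :
    Set.indicator (latHull R : Set (Fin d → ℝ)) (1 : (Fin d → ℝ) → ℤ) p =
      ∑ I ∈ T, Set.indicator (latHull I : Set (Fin d → ℝ)) (1 : (Fin d → ℝ) → ℤ) p := by
  by_cases hp : p ∈ latHull R
  · obtain ⟨I, ⟨hIT, hpI⟩, huniq⟩ := hu hp
    rw [Set.indicator_of_mem hp, Finset.sum_eq_single_of_mem I hIT, Set.indicator_of_mem (show p ∈ (latHull I : Set (Fin d → ℝ)) from hpI)]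
    · intro J hJ hJI
      exact Set.indicator_of_notMem (fun h => hJI (huniq J ⟨hJ, h⟩)) _
  · rw [Set.indicator_of_notMem hp, Finset.sum_eq_zero fun I hI => Set.indicator_of_notMem
      (fun h => hp ?_) _]
    exact Submodule.span_mono (Set.image_mono (Finset.coe_subset.2 (hT I hI).1)) h

theorem indicator_congr_iff {A B : Set (Fin d → ℝ)} {p x : Fin d → ℝ} (h : p ∈ A ↔ x ∈ B) :
    Set.indicator A (1 : (Fin d → ℝ) → ℤ) p = Set.indicator B (1 : (Fin d → ℝ) → ℤ) x := by
  classical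
  simp only [Set.indicator_apply, h, Pi.one_apply]

/-- The indicator function of a cone is a sum of indicator functions of half-open simplicial
cones with the same generators. -/
theorem exists_halfOpen_decomposition (R : Finset (Fin d → ℤ)) (u : (Fin d → ℝ) →ₗ[ℝ] ℝ)
    (hu : ∀ r ∈ R, u (latVec r) = 1) :
    ∃ (T : Finset (Finset (Fin d → ℤ))) (v : Fin d → ℝ), (∀ I ∈ T, I ⊆ R ∧ LatIndep I) ∧
      ∀ x, Set.indicator (latHull R : Set (Fin d → ℝ)) (1 : (Fin d → ℝ) → ℤ) x =
        ∑ I ∈ T, Set.indicator (halfOpen I v) (1 : (Fin d → ℝ) → ℤ) x := by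
  classical
  obtain ⟨T, hT, hTp⟩ := exists_triangulation latVec u R hu
  obtain ⟨w, hwR, hw⟩ := exists_isGenericFor R
  obtain ⟨c, hc⟩ := core_nonempty latVec R
  have hdir : dirSpan (core (latHull R)) = latSpan R := by
    have := (dirSpan_core_inter latVec R rfl isOpen_univ (Submodule.zero_mem (latHull R))
      (Set.mem_univ 0)).2
    rw [Set.inter_univ] at this
    rw [this]
    refine le_antisymm (Submodule.span_le.2 fun x hx => mem_span_of_mem_hull hx)
      (Submodule.span_mono PointedCone.subset_hull)
  -- A relative interior point is moved slightly to become generic. Being interior, `v` makes the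
  -- closed cone itself the half-open version of the whole cone, see `h2`.
  obtain ⟨η, hη, hcη⟩ := (relOpen_core (latHull R)).exists_add_smul_mem hc (hdir ▸ hwR)
  obtain ⟨ε, hgen, hε⟩ := ((hw.eventually c).and (Ioo_mem_nhdsGT hη)).exists
  set v := c + ε • w with hv
  have hvcore : v ∈ core (latHull R) :=
    add_smul_mem_of_le (relOpen_core (latHull R)).convex hc hcη hε.1.le hε.2.le
  have hvR : v ∈ latSpan R := mem_span_of_mem_hull hvcore.1
  refine ⟨T, v, fun I hI => ⟨(hT I hI).1, (hT I hI).2.1⟩, fun x => ?_⟩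
  have h1 : ∀ᶠ δ : ℝ in 𝓝[>] 0, ∀ I ∈ T, (x + δ • v ∈ latHull I ↔ x ∈ halfOpen I v) := by
    rw [eventually_all_finset]
    intro I hI
    obtain ⟨hIR, hIL, hspan⟩ := hT I hI
    have hvI : v ∈ latSpan I := by rw [latSpan, hspan]; exact hvR
    exact eventually_mem_latHull_iff hIL hvI (fun i hi => hgen.co_ne_zero hIR hIL hvI hi) x
  have h2 : ∀ᶠ δ : ℝ in 𝓝[>] 0, (x + δ • v ∈ latHull R ↔ x ∈ latHull R) := by
    by_cases hx : x ∈ latHull R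
    · filter_upwards [self_mem_nhdsWithin] with δ hδ
      exact iff_of_true ((latHull R).add_mem hx
        (smul_mem_cone _ hvcore.1 (le_of_lt hδ))) hx
    · have hcl := (isClosed_hull R u hu).isOpen_compl.mem_nhds hx
      filter_upwards [(tendsto_add_smul x v).eventually hcl] with δ hδ
      exact iff_of_false hδ hx
  obtain ⟨δ, h1, h2, h3⟩ := (h1.and (h2.and (hgen.eventually x))).exists
  rw [← indicator_congr_iff (B := (latHull R : Set (Fin d → ℝ))) (x := x) h2,
    indicator_latHull_eq_sum hT (hTp _ h3)]
  exact Finset.sum_congr rfl fun I hI => indicator_congr_iff (h1 I hI)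

/-- A full-dimensional simplicial cone with lattice generators together with a linear form that
equals `1` on the generators. -/
structure Piece (d : ℕ) where
  gens : Finset (Fin d → ℤ)
  indep : LatIndep gens
  span_eq_top : latSpan gens = ⊤
  form : Fin d → ℤ
  form_gens : ∀ n ∈ gens, form ⬝ᵥ n = 1

/-- Here `D` is a face of `C`. As `D` spans the space, `p - η y` stays in `D` for `y ∈ C` and small
`η`, and `p = (p - η y) + η y` then puts `y` into the face `D`. -/
theorem Fan.eq_of_mem_core (F : Fan d) {deg : (Fin d → ℤ) → ℤ} (hdeg : F.IsDegree deg)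
    {C D : PointedCone ℝ (Fin d → ℝ)} (hC : C ∈ F.cones) (hD : D ∈ F.cones)
    (hspan : Submodule.span ℝ (D : Set (Fin d → ℝ)) = ⊤) {p : Fin d → ℝ} (hp : p ∈ core D)
    (hpC : p ∈ C) : C = D := by
  have hDC : D ≤ C := F.le_of_mem_core hD hC hp hpC
  refine le_antisymm (fun y hy => ?_) hDC
  obtain ⟨A⟩ := F.exists_rayData hdeg hD
  have hdir : dirSpan (core D) = ⊤ := by
    have := (dirSpan_core_inter latVec A.rays A.eq_hull isOpen_univ (Submodule.zero_mem D)
      (Set.mem_univ 0)).2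
    rw [Set.inter_univ] at this
    rw [this, hspan]
  obtain ⟨η, hη, h⟩ := (relOpen_core D).exists_add_smul_mem hp
    (w := -y) (hdir ▸ Submodule.mem_top)
  have hface := F.inter_face C hC D hD
  rw [inf_eq_right.2 hDC] at hface
  refine hface.mem_of_smul_add_mem hy (hDC h.1) hη ?_
  rw [smul_neg, add_neg_cancel_comm_assoc]
  exact hp.1

/-- A complete Gorenstein fan has a triangulation without new rays; for all directions `v` outside
some proper subspaces the half-open cones determined by `v` form a partition. -/
theorem Fan.exists_pieces (F : Fan d) (hF : F.IsComplete) {deg : (Fin d → ℤ) → ℤ}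
    (hdeg : F.IsDegree deg) :
    ∃ (κ : Type) (_ : Fintype κ) (P : κ → Piece d) (bad : Finset (Submodule ℝ (Fin d → ℝ))),
      (∀ B ∈ bad, B ≠ ⊤) ∧
      (∀ v, (∀ B ∈ bad, v ∉ B) → (∀ k, ∀ i ∈ (P k).gens, co (P k).gens i v ≠ 0) ∧
        ∀ x, ∑ k, Set.indicator (halfOpen (P k).gens v) (1 : (Fin d → ℝ) → ℤ) x = 1) ∧
      ∀ k n, latVec n ∈ latHull (P k).gens → deg n = (P k).form ⬝ᵥ n := by
  classical
  let A : ∀ C : F.cones, F.RayData deg C := fun C => (F.exists_rayData hdeg C.2).some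
  have hspan : ∀ C : F.cones, Submodule.span ℝ ((C : PointedCone ℝ (Fin d → ℝ)) : Set (Fin d → ℝ)) =
      latSpan (A C).rays := by
    intro C
    apply le_antisymm
    · refine Submodule.span_le.2 fun x hx => ?_
      rw [SetLike.mem_coe, (A C).eq_hull] at hx
      exact mem_span_of_mem_hull hx
    · refine Submodule.span_mono ?_
      conv_rhs => rw [(A C).eq_hull]
      exact PointedCone.subset_hull
  have hform : ∀ C : F.cones, ∀ r ∈ (A C).rays, pairing (A C).form (latVec r) = 1 := by
    intro C r hr
    rw [pairing_latVec, (A C).form_rays r hr, Int.cast_one]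
  choose T hT hTp using fun C : F.cones =>
    exists_triangulation latVec (pairing (A C).form) (A C).rays (hform C)
  let top : Finset F.cones := Finset.univ.filter fun C => latSpan (A C).rays = ⊤
  -- Contains the spans of the lower-dimensional cones as well as the proper subspaces that obstruct
  -- genericity in full-dimensional ones.
  let bad : Finset (Submodule ℝ (Fin d → ℝ)) :=
    (Finset.univ.biUnion fun C : F.cones => (A C).rays.powerset.image latSpan).filter (· ≠ ⊤)
  have hbad : ∀ C : F.cones, ∀ J ⊆ (A C).rays, latSpan J ≠ ⊤ → latSpan J ∈ bad := by
    intro C J hJ hne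
    refine Finset.mem_filter.2 ⟨Finset.mem_biUnion.2 ⟨C, Finset.mem_univ _, ?_⟩, hne⟩
    exact Finset.mem_image_of_mem _ (Finset.mem_powerset.2 hJ)
  have htop : ∀ C ∈ top, latSpan (A C).rays = ⊤ := fun C hC => (Finset.mem_filter.1 hC).2
  let P : (Σ C : top, T C) → Piece d := fun k =>
    { gens := k.2
      indep := (hT k.1 k.2 k.2.2).2.1
      span_eq_top := (hT k.1 k.2 k.2.2).2.2.trans (htop _ k.1.2)
      form := (A k.1).form
      form_gens := fun n hn => (A k.1).form_rays n ((hT k.1 k.2 k.2.2).1 hn) }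
  refine ⟨Σ C : top, T C, inferInstance, P, bad, fun B hB => (Finset.mem_filter.1 hB).2, ?_, ?_⟩
  · intro v hv
    have hgen : ∀ C ∈ top, IsGenericFor latVec (A C).rays v := by
      intro C hC J hJ hne
      refine hv _ (hbad C J hJ fun h => hne ?_)
      exact h.trans (htop C hC).symm
    have hco : ∀ k, ∀ i ∈ (P k).gens, co (P k).gens i v ≠ 0 := fun k i hi =>
      (hgen k.1 k.1.2).co_ne_zero (hT k.1 k.2 k.2.2).1 (P k).indep
        ((P k).span_eq_top ▸ Submodule.mem_top) hi
    refine ⟨hco, fun x => ?_⟩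
    -- The partition property at `x` is read off at the generic point `x + ε • v`, where closed and
    -- half-open cones agree.
    have h1 : ∀ᶠ ε : ℝ in 𝓝[>] 0, ∀ k : Σ C : top, T C,
        (x + ε • v ∈ latHull (P k).gens ↔ x ∈ halfOpen (P k).gens v) := by
      rw [eventually_all]
      exact fun k => eventually_mem_latHull_iff (P k).indep
        ((P k).span_eq_top ▸ Submodule.mem_top) (hco k) x
    have h2 : ∀ᶠ ε : ℝ in 𝓝[>] 0, ∀ C ∈ top, IsGenericFor latVec (A C).rays (x + ε • v) := by
      rw [eventually_all_finset]
      exact fun C hC => (hgen C hC).eventually x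
    have h3 : ∀ᶠ ε : ℝ in 𝓝[>] 0, ∀ B ∈ bad, x + ε • v ∉ B := by
      rw [eventually_all_finset]
      exact fun B hB => eventually_notMem (hv B hB) x
    obtain ⟨ε, h1, h2, h3⟩ := (h1.and (h2.and h3)).exists
    set p := x + ε • v with hp
    rw [Finset.sum_congr rfl fun k _ => (indicator_congr_iff (h1 k)).symm, Fintype.sum_sigma]
    have h4 : ∀ C : top, ∑ I : T C, Set.indicator (latHull (P ⟨C, I⟩).gens : Set (Fin d → ℝ))
        (1 : (Fin d → ℝ) → ℤ) p = Set.indicator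
          ((C : F.cones) : PointedCone ℝ (Fin d → ℝ)) (1 : (Fin d → ℝ) → ℤ) p := by
      intro C
      rw [(A C).eq_hull, indicator_latHull_eq_sum (hT C) (hTp C p (h2 C C.2))]
      exact Finset.sum_coe_sort (T C) fun I => Set.indicator (latHull I : Set (Fin d → ℝ))
        (1 : (Fin d → ℝ) → ℤ) p
    rw [Finset.sum_congr rfl fun C _ => h4 C]
    obtain ⟨C₀, hC₀, hpC₀⟩ := hF p
    obtain ⟨D, hD, hpD⟩ := F.exists_core hC₀ hpC₀
    -- A generic point avoids all lower-dimensional cones, so the cone with `p` in its relative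
    -- interior is full-dimensional.
    have hDtop : latSpan (A ⟨D, hD⟩).rays = ⊤ := by
      by_contra hne
      refine h3 _ (hbad ⟨D, hD⟩ _ subset_rfl hne) ?_
      rw [← hspan]
      exact Submodule.subset_span hpD.1
    have hDmem : (⟨D, hD⟩ : F.cones) ∈ top := Finset.mem_filter.2 ⟨Finset.mem_univ _, hDtop⟩
    rw [Finset.sum_eq_single (⟨⟨D, hD⟩, hDmem⟩ : top), Set.indicator_of_mem
      (show p ∈ (D : Set (Fin d → ℝ)) from hpD.1)]
    · rfl
    · intro C _ hCD
      refine Set.indicator_of_notMem (fun hpC => hCD ?_) _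
      have := F.eq_of_mem_core hdeg C.1.2 hD ((hspan ⟨D, hD⟩).trans hDtop) hpD hpC
      exact Subtype.ext (Subtype.ext this)
    · intro h
      exact absurd (Finset.mem_univ _) h
  · intro k n hn
    refine (A k.1).deg_eq n ?_
    rw [(A k.1).eq_hull]
    exact Submodule.span_mono (Set.image_mono (Finset.coe_subset.2 (hT k.1 k.2 k.2.2).1)) hn

end HalfOpenCones

end ToricGenus

end

noncomputable section

namespace ToricGenus

/-! ### Rational functions represented by formal sums over the lattice -/

section RationalSums

variable {d : ℕ}

/-- Multiplication by `1 + x^r` of the formal sum `∑ g n x^n`. -/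
def shiftAdd (r : Fin d → ℤ) (g : (Fin d → ℤ) → ℂ) : (Fin d → ℤ) → ℂ := fun n => g n + g (n - r)

instance : LeftCommutative (shiftAdd (d := d)) where
  left_comm r s g := by
    funext n
    simp only [shiftAdd]
    rw [sub_right_comm]
    ring

/-- Multiplication by `∏ (1 + x^r)` of the formal sum `∑ g n x^n`. -/
def shiftProd (l : List (Fin d → ℤ)) (g : (Fin d → ℤ) → ℂ) : (Fin d → ℤ) → ℂ :=
  l.foldr shiftAdd g

theorem shiftProd_append (l l' : List (Fin d → ℤ)) (g : (Fin d → ℤ) → ℂ) :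
    shiftProd (l ++ l') g = shiftProd l (shiftProd l' g) := List.foldr_append

theorem shiftProd_perm {l l' : List (Fin d → ℤ)} (h : l.Perm l') (g : (Fin d → ℤ) → ℂ) :
    shiftProd l g = shiftProd l' g := h.foldr_eq g

theorem shiftProd_add (l : List (Fin d → ℤ)) (g g' : (Fin d → ℤ) → ℂ) :
    shiftProd l (g + g') = shiftProd l g + shiftProd l g' := by
  induction l with
  | nil => rfl
  | cons r l ih =>
    change shiftAdd r (shiftProd l (g + g')) = shiftAdd r (shiftProd l g) + shiftAdd r (shiftProd l g')
    rw [ih]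
    funext n
    simp only [shiftAdd, Pi.add_apply]
    ring

theorem shiftProd_smul (l : List (Fin d → ℤ)) (a : ℂ) (g : (Fin d → ℤ) → ℂ) :
    shiftProd l (a • g) = a • shiftProd l g := by
  induction l with
  | nil => rfl
  | cons r l ih =>
    change shiftAdd r (shiftProd l (a • g)) = a • shiftAdd r (shiftProd l g)
    rw [ih]
    funext n
    simp only [shiftAdd, Pi.smul_apply, smul_eq_mul]
    ring

theorem shiftProd_toList (I : Finset (Fin d → ℤ)) (g : (Fin d → ℤ) → ℂ) (n : Fin d → ℤ) :
    shiftProd I.toList g n = ∑ S ∈ I.powerset, g (n - ∑ i ∈ S, i) := by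
  classical
  induction I using Finset.induction_on generalizing n with
  | empty => simp [shiftProd]
  | insert r I hr ih =>
    rw [shiftProd_perm (Finset.toList_insert hr), Finset.sum_powerset_insert hr]
    change shiftProd I.toList g n + shiftProd I.toList g (n - r) = _
    rw [ih, ih]
    congr 1
    refine Finset.sum_congr rfl fun S hS => ?_
    rw [Finset.sum_insert (fun h => hr (Finset.mem_powerset.1 hS h)), sub_sub]

theorem finite_support_shiftAdd (r : Fin d → ℤ) {g : (Fin d → ℤ) → ℂ}
    (hg : g.support.Finite) : (shiftAdd r g).support.Finite := by
  refine (hg.union (hg.image (· + r))).subset fun n hn => ?_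
  by_contra h
  rw [Set.mem_union, not_or, Function.notMem_support] at h
  refine hn ?_
  have h2 : g (n - r) = 0 := by
    by_contra h3
    exact h.2 ⟨n - r, h3, sub_add_cancel _ _⟩
  simp [shiftAdd, h.1, h2]

theorem finite_support_shiftProd (l : List (Fin d → ℤ)) {g : (Fin d → ℤ) → ℂ}
    (hg : g.support.Finite) : (shiftProd l g).support.Finite := by
  induction l with
  | nil => exact hg
  | cons r l ih => exact finite_support_shiftAdd r ih

/-- The value of a finite sum `∑ g n x^n` at `x^n = q^{m · n}`. -/
def finiteSum (m : Fin d → ℤ) (g : (Fin d → ℤ) → ℂ) : LaurentSeries ℂ :=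
  ∑ᶠ n, HahnSeries.single (m ⬝ᵥ n) (g n)

theorem finite_support_single (m : Fin d → ℤ) {g : (Fin d → ℤ) → ℂ} (hg : g.support.Finite) :
    (Function.support fun n => (HahnSeries.single (m ⬝ᵥ n) (g n) : LaurentSeries ℂ)).Finite :=
  hg.subset fun n hn h => hn (by simp [h])

theorem finiteSum_add (m : Fin d → ℤ) {g g' : (Fin d → ℤ) → ℂ} (hg : g.support.Finite)
    (hg' : g'.support.Finite) : finiteSum m (g + g') = finiteSum m g + finiteSum m g' := by
  rw [finiteSum, finiteSum, finiteSum, ← finsum_add_distrib (finite_support_single m hg)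
    (finite_support_single m hg')]
  simp

theorem finiteSum_smul (m : Fin d → ℤ) (a : ℂ) {g : (Fin d → ℤ) → ℂ} (hg : g.support.Finite) :
    finiteSum m (a • g) = HahnSeries.C a * finiteSum m g := by
  rw [finiteSum, finiteSum, mul_finsum' _ _ (finite_support_single m hg)]
  simp [HahnSeries.C_apply, HahnSeries.single_mul_single]

theorem finiteSum_shiftAdd (m r : Fin d → ℤ) {g : (Fin d → ℤ) → ℂ} (hg : g.support.Finite) :
    finiteSum m (shiftAdd r g) = (1 + HahnSeries.single (m ⬝ᵥ r) 1) * finiteSum m g := by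
  have h2 : (fun n => g (n - r)).support.Finite := by
    refine (hg.image (· + r)).subset fun n hn => ⟨n - r, hn, sub_add_cancel _ _⟩
  have : shiftAdd r g = g + fun n => g (n - r) := rfl
  rw [this, finiteSum_add m hg h2, add_mul, one_mul]
  congr 1
  rw [finiteSum, finiteSum, mul_finsum' _ _ (finite_support_single m hg),
    ← finsum_comp_equiv (Equiv.addRight r)]
  refine finsum_congr fun n => ?_
  rw [Equiv.coe_addRight, add_sub_cancel_right, HahnSeries.single_mul_single, one_mul,
    dotProduct_add, add_comm]

/-- The product of the binomials `1 + q^{m · r}`. -/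
def binomials (m : Fin d → ℤ) (l : List (Fin d → ℤ)) : LaurentSeries ℂ :=
  (l.map fun r => 1 + HahnSeries.single (m ⬝ᵥ r) (1 : ℂ)).prod

theorem binomial_ne_zero (k : ℤ) : (1 + HahnSeries.single k 1 : LaurentSeries ℂ) ≠ 0 := by
  intro h
  have := congrArg (fun f : LaurentSeries ℂ => f.coeff 0) h
  simp only [HahnSeries.coeff_add, HahnSeries.coeff_one, HahnSeries.coeff_single,
    HahnSeries.coeff_zero, if_true] at this
  split_ifs at this <;> norm_num at this

theorem binomials_ne_zero (m : Fin d → ℤ) (l : List (Fin d → ℤ)) : binomials m l ≠ 0 := by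
  rw [binomials]
  refine List.prod_ne_zero ?_
  simp only [List.mem_map, not_exists, not_and]
  exact fun r _ => binomial_ne_zero _

theorem finiteSum_shiftProd (m : Fin d → ℤ) (l : List (Fin d → ℤ)) {g : (Fin d → ℤ) → ℂ}
    (hg : g.support.Finite) : finiteSum m (shiftProd l g) = binomials m l * finiteSum m g := by
  induction l with
  | nil => simp [shiftProd, binomials]
  | cons r l ih =>
    change finiteSum m (shiftAdd r (shiftProd l g)) = _
    rw [finiteSum_shiftAdd m r (finite_support_shiftProd l hg), ih]
    simp only [binomials, List.map_cons, List.prod_cons, mul_assoc]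

theorem binomials_append (m : Fin d → ℤ) (l l' : List (Fin d → ℤ)) :
    binomials m (l ++ l') = binomials m l * binomials m l' := by
  simp [binomials]

/-- The formal sum `∑ g n q^{m · n}` represents the rational function `A`. -/
def HasRationalSum (m : Fin d → ℤ) (g : (Fin d → ℤ) → ℂ) (A : LaurentSeries ℂ) : Prop :=
  ∃ l : List (Fin d → ℤ), (shiftProd l g).support.Finite ∧
    finiteSum m (shiftProd l g) = binomials m l * A

namespace HasRationalSum

variable {m : Fin d → ℤ} {g g' : (Fin d → ℤ) → ℂ} {A A' : LaurentSeries ℂ}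

/-- Multiply by both lists of binomials at once; the binomials are nonzero in the field of Laurent
series and can be cancelled. -/
theorem unique (h : HasRationalSum m g A) (h' : HasRationalSum m g A') : A = A' := by
  obtain ⟨l, hl, e⟩ := h
  obtain ⟨l', hl', e'⟩ := h'
  have h1 : finiteSum m (shiftProd (l ++ l') g) = binomials m l * (binomials m l' * A') := by
    rw [shiftProd_append, finiteSum_shiftProd m l hl', e']
  have h2 : finiteSum m (shiftProd (l ++ l') g) = binomials m l * (binomials m l' * A) := by
    rw [shiftProd_perm List.perm_append_comm, shiftProd_append, finiteSum_shiftProd m l' hl, e,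
      mul_left_comm]
  exact mul_left_cancel₀ (binomials_ne_zero m l') (mul_left_cancel₀ (binomials_ne_zero m l)
    (h2.symm.trans h1))

theorem add (h : HasRationalSum m g A) (h' : HasRationalSum m g' A') :
    HasRationalSum m (g + g') (A + A') := by
  obtain ⟨l, hl, e⟩ := h
  obtain ⟨l', hl', e'⟩ := h'
  have h1 : shiftProd (l ++ l') g = shiftProd l' (shiftProd l g) := by
    rw [shiftProd_perm List.perm_append_comm, shiftProd_append]
  have h2 : shiftProd (l ++ l') g' = shiftProd l (shiftProd l' g') := shiftProd_append _ _ _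
  have f1 : (shiftProd (l ++ l') g).support.Finite := h1 ▸ finite_support_shiftProd l' hl
  have f2 : (shiftProd (l ++ l') g').support.Finite := h2 ▸ finite_support_shiftProd l hl'
  refine ⟨l ++ l', ?_, ?_⟩
  · rw [shiftProd_add]
    exact (f1.union f2).subset (Function.support_add _ _)
  · rw [shiftProd_add, finiteSum_add m f1 f2, h1, h2, finiteSum_shiftProd m _ hl,
      finiteSum_shiftProd m _ hl', e, e', binomials_append]
    ring

theorem smul (a : ℂ) (h : HasRationalSum m g A) :
    HasRationalSum m (a • g) (HahnSeries.C a * A) := by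
  obtain ⟨l, hl, e⟩ := h
  refine ⟨l, ?_, ?_⟩
  · rw [shiftProd_smul]
    exact hl.subset (Function.support_const_smul_subset _ _)
  · rw [shiftProd_smul, finiteSum_smul m a hl, e]
    ring

theorem zero : HasRationalSum m 0 0 :=
  ⟨[], by simp [shiftProd], by simp [shiftProd, finiteSum]⟩

theorem sum {ι : Type*} (s : Finset ι) {g : ι → (Fin d → ℤ) → ℂ} {A : ι → LaurentSeries ℂ}
    (h : ∀ k ∈ s, HasRationalSum m (g k) (A k)) :
    HasRationalSum m (∑ k ∈ s, g k) (∑ k ∈ s, A k) := by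
  classical
  induction s using Finset.induction_on with
  | empty => exact zero
  | insert k s hk ih =>
    rw [Finset.sum_insert hk, Finset.sum_insert hk]
    exact (h k (Finset.mem_insert_self _ _)).add
      (ih fun j hj => h j (Finset.mem_insert_of_mem hj))

end HasRationalSum

/-- The indicator function of `A` on the lattice, multiplied by the character `(-1)^{u · n}`. -/
def twisted (A : Set (Fin d → ℝ)) (u : Fin d → ℤ) (n : Fin d → ℤ) : ℂ :=
  ((Set.indicator A (1 : (Fin d → ℝ) → ℤ) (latVec n) : ℤ) : ℂ) * (-1) ^ (u ⬝ᵥ n)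

/-- The fundamental parallelepiped of the half-open simplicial cone. -/
def box (I : Finset (Fin d → ℤ)) (v : Fin d → ℝ) : Set (Fin d → ℝ) :=
  {x | x ∈ latSpan I ∧ ∀ i ∈ I, (0 < co I i x ∨ (co I i x = 0 ∧ 0 < co I i v)) ∧
    ¬ (0 < co I i x - 1 ∨ (co I i x - 1 = 0 ∧ 0 < co I i v))}

theorem box_co_mem {I : Finset (Fin d → ℤ)} {v x : Fin d → ℝ} (hx : x ∈ box I v)
    {i : Fin d → ℤ} (hi : i ∈ I) : 0 ≤ co I i x ∧ co I i x ≤ 1 := by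
  obtain ⟨h1, h2⟩ := hx.2 i hi
  refine ⟨?_, ?_⟩
  · rcases h1 with h | h
    exacts [h.le, h.1.ge]
  · push Not at h2
    linarith [h2.1]

theorem finite_box {I : Finset (Fin d → ℤ)} (hI : LatIndep I) (v : Fin d → ℝ) :
    {n : Fin d → ℤ | latVec n ∈ box I v}.Finite := by
  refine (Set.finite_Icc (fun j => -∑ i ∈ I, |i j|) (fun j => ∑ i ∈ I, |i j|)).subset fun n hn => ?_
  have hb : ∀ j, |n j| ≤ ∑ i ∈ I, |i j| := by
    intro j
    have h := congrFun (sum_co hI hn.1) j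
    have h1 : |(n j : ℝ)| ≤ ∑ i ∈ I, |(i j : ℝ)| := by
      change |latVec n j| ≤ _
      rw [h, Finset.sum_apply]
      refine (Finset.abs_sum_le_sum_abs _ _).trans (Finset.sum_le_sum fun i hi => ?_)
      obtain ⟨h0, h1⟩ := box_co_mem hn hi
      rw [Pi.smul_apply, smul_eq_mul, abs_mul, abs_of_nonneg h0]
      exact mul_le_of_le_one_left (abs_nonneg _) h1
    exact_mod_cast h1
  exact ⟨fun j => (abs_le.1 (hb j)).1, fun j => (abs_le.1 (hb j)).2⟩

theorem neg_one_zpow_sub_card {u n : Fin d → ℤ} {S : Finset (Fin d → ℤ)}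
    (hS : ∀ i ∈ S, u ⬝ᵥ i = 1) :
    (-1 : ℂ) ^ (u ⬝ᵥ (n - ∑ i ∈ S, i)) = (-1) ^ S.card * (-1) ^ (u ⬝ᵥ n) := by
  have h : u ⬝ᵥ (∑ i ∈ S, i) = S.card := by
    rw [dotProduct_sum, Finset.sum_congr rfl hS]
    simp
  rw [dotProduct_sub, h, zpow_sub₀ (by norm_num), zpow_natCast, div_eq_mul_inv, ← inv_pow, mul_comm]
  norm_num

/-- Since `u` is 1 on the generators, the twist turns multiplication by `1 + x^r` into
multiplication by `1 - x^r`, so the shifts of the indicator function come with alternating signs. -/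
theorem shiftProd_twisted (A : Set (Fin d → ℝ)) {u : Fin d → ℤ} {I : Finset (Fin d → ℤ)}
    (hu : ∀ i ∈ I, u ⬝ᵥ i = 1) (n : Fin d → ℤ) :
    shiftProd I.toList (twisted A u) n =
      ((∑ S ∈ I.powerset, (-1 : ℤ) ^ S.card *
        Set.indicator A (1 : (Fin d → ℝ) → ℤ) (latVec (n - ∑ i ∈ S, i)) : ℤ) : ℂ) *
        (-1) ^ (u ⬝ᵥ n) := by
  rw [shiftProd_toList, Int.cast_sum, Finset.sum_mul]
  refine Finset.sum_congr rfl fun S hS => ?_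
  rw [twisted, neg_one_zpow_sub_card fun i hi => hu i (Finset.mem_powerset.1 hS hi)]
  push_cast
  ring

/-- The sum over subsets factors over the generators. The factor of `i` is the difference of the
conditions on the coordinate and on the coordinate minus 1; the latter implies the former, so the
difference is the indicator of the condition in `box`. -/
theorem sum_powerset_halfOpen {I : Finset (Fin d → ℤ)} (hI : LatIndep I) (v : Fin d → ℝ)
    (n : Fin d → ℤ) :
    ∑ S ∈ I.powerset, (-1 : ℤ) ^ S.card *
      Set.indicator (halfOpen I v) (1 : (Fin d → ℝ) → ℤ) (latVec (n - ∑ i ∈ S, i)) =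
    Set.indicator (box I v) (1 : (Fin d → ℝ) → ℤ) (latVec n) := by
  classical
  let pos : (Fin d → ℤ) → ℝ → Prop := fun i c => 0 < c ∨ (c = 0 ∧ 0 < co I i v)
  have hS : ∀ S ⊆ I, latVec (∑ i ∈ S, i) ∈ latSpan I := fun S hS => by
    rw [latVec_sum]
    exact Submodule.sum_mem _ fun i hi => Submodule.subset_span ⟨i, hS hi, rfl⟩
  by_cases hn : latVec n ∈ latSpan I
  · have h1 : ∀ S ∈ I.powerset, (-1 : ℤ) ^ S.card *
        Set.indicator (halfOpen I v) (1 : (Fin d → ℝ) → ℤ) (latVec (n - ∑ i ∈ S, i)) =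
        (∏ i ∈ S, -(if pos i (co I i (latVec n) - 1) then 1 else 0 : ℤ)) *
          ∏ i ∈ I \ S, (if pos i (co I i (latVec n)) then 1 else 0 : ℤ) := by
      intro S hSI
      rw [Finset.mem_powerset] at hSI
      have hco : ∀ i ∈ I, co I i (latVec (n - ∑ i ∈ S, i)) =
          co I i (latVec n) - if i ∈ S then 1 else 0 := by
        intro i hi
        rw [latVec_sub, map_sub, latVec_sum, map_sum,
          Finset.sum_congr rfl fun k hk => co_gen hI hi (hSI hk), Finset.sum_ite_eq]
      have hmem : latVec (n - ∑ i ∈ S, i) ∈ halfOpen I v ↔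
          (∀ i ∈ S, pos i (co I i (latVec n) - 1)) ∧ ∀ i ∈ I \ S, pos i (co I i (latVec n)) := by
        have hsp : latVec (n - ∑ i ∈ S, i) ∈ latSpan I := by
          rw [latVec_sub]; exact Submodule.sub_mem _ hn (hS S hSI)
        constructor
        · intro h
          refine ⟨fun i hi => ?_, fun i hi => ?_⟩
          · have := h.2 i (hSI hi)
            rwa [hco i (hSI hi), if_pos hi] at this
          · have hi' := Finset.mem_sdiff.1 hi
            have := h.2 i hi'.1
            rwa [hco i hi'.1, if_neg hi'.2, sub_zero] at this
        · rintro ⟨ha, hb⟩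
          refine ⟨hsp, fun i hi => ?_⟩
          rw [hco i hi]
          by_cases hiS : i ∈ S
          · rw [if_pos hiS]; exact ha i hiS
          · rw [if_neg hiS, sub_zero]; exact hb i (Finset.mem_sdiff.2 ⟨hi, hiS⟩)
      rw [Finset.prod_neg, mul_assoc]
      congr 1
      rw [Finset.prod_ite_zero, Finset.prod_ite_zero, Finset.prod_const_one, Finset.prod_const_one,
        Set.indicator_apply]
      simp only [hmem, ite_and, Pi.one_apply]
      split_ifs <;> simp
    rw [Finset.sum_congr rfl h1, ← Finset.prod_add, Set.indicator_apply]
    have h2 : ∀ i ∈ I, (-(if pos i (co I i (latVec n) - 1) then 1 else 0 : ℤ)) +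
        (if pos i (co I i (latVec n)) then 1 else 0 : ℤ) =
        if pos i (co I i (latVec n)) ∧ ¬ pos i (co I i (latVec n) - 1) then 1 else 0 := by
      intro i _
      by_cases ha : pos i (co I i (latVec n) - 1)
      · have hb : pos i (co I i (latVec n)) := by
          rcases ha with h | h
          · exact Or.inl (by linarith)
          · exact Or.inl (by linarith [h.1])
        simp [ha, hb]
      · by_cases hb : pos i (co I i (latVec n)) <;> simp [ha, hb]
    rw [Finset.prod_congr rfl h2, Finset.prod_ite_zero, Finset.prod_const_one]
    have h3 : latVec n ∈ box I v ↔
        ∀ i ∈ I, pos i (co I i (latVec n)) ∧ ¬ pos i (co I i (latVec n) - 1) :=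
      ⟨fun h => h.2, fun h => ⟨hn, h⟩⟩
    simp only [h3, Pi.one_apply]
  · rw [Set.indicator_of_notMem (fun h => hn h.1), Finset.sum_eq_zero fun S hSI => ?_]
    rw [Set.indicator_of_notMem, mul_zero]
    intro h
    have := h.1
    rw [latVec_sub, Submodule.sub_mem_iff_left _ (hS S (Finset.mem_powerset.1 hSI))] at this
    exact hn this

theorem shiftProd_halfOpen {I : Finset (Fin d → ℤ)} (hI : LatIndep I) (v : Fin d → ℝ)
    {u : Fin d → ℤ} (hu : ∀ i ∈ I, u ⬝ᵥ i = 1) :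
    shiftProd I.toList (twisted (halfOpen I v) u) = twisted (box I v) u := by
  funext n
  rw [shiftProd_twisted _ hu, sum_powerset_halfOpen hI, twisted]

theorem finite_support_twisted_box {I : Finset (Fin d → ℤ)} (hI : LatIndep I) (v : Fin d → ℝ)
    (u : Fin d → ℤ) : (twisted (box I v) u).support.Finite := by
  refine (finite_box hI v).subset fun n hn => ?_
  by_contra h
  exact hn (by rw [twisted, Set.indicator_of_notMem (show latVec n ∉ box I v from h)]; simp)

end RationalSums

end ToricGenus

end

noncomputable section

namespace ToricGenus

/-! ### From the cones of the fan to power series of half-open cones -/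

section PieceSeries

variable {d : ℕ}

theorem numCoeff_eq_sum {C : PointedCone ℝ (Fin d → ℝ)} {R : Finset (Fin d → ℤ)}
    (hR : (R : Set (Fin d → ℤ)) = rayGens C) (n : Fin d → ℤ) :
    numCoeff C n = ∑ S ∈ R.powerset, (-1 : ℤ) ^ S.card *
      Set.indicator (C : Set (Fin d → ℝ)) (1 : (Fin d → ℝ) → ℤ) (latVec (n - ∑ i ∈ S, i)) := by
  classical
  have hset : {S : Finset (Fin d → ℤ) | (S : Set (Fin d → ℤ)) ⊆ rayGens C} =
      ((R.powerset : Finset (Finset (Fin d → ℤ))) : Set (Finset (Fin d → ℤ))) := by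
    ext S
    rw [← hR]
    simp
  rw [numCoeff, hset, finsum_mem_coe_finset]
  refine Finset.sum_congr rfl fun S _ => ?_
  simp [Set.indicator_apply]

theorem binomials_toList (m : Fin d → ℤ) (I : Finset (Fin d → ℤ)) :
    binomials m I.toList = ∏ i ∈ I, (1 + HahnSeries.single (m ⬝ᵥ i) 1) := by
  rw [binomials, Finset.prod_map_toList]

theorem finite_support_shiftProd_of_subset {I R : Finset (Fin d → ℤ)} (hIR : I ⊆ R)
    {g : (Fin d → ℤ) → ℂ} (hg : (shiftProd I.toList g).support.Finite) :
    (shiftProd R.toList g).support.Finite := by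
  classical
  have : R.toList.Perm ((R \ I).toList ++ I.toList) := by
    refine List.perm_of_nodup_nodup_toFinset_eq (Finset.nodup_toList _) ?_ ?_
    · refine (Finset.nodup_toList _).append (Finset.nodup_toList _) fun a ha hb => ?_
      rw [Finset.mem_toList] at ha hb
      exact (Finset.mem_sdiff.1 ha).2 hb
    · ext a
      simp only [List.mem_toFinset, List.mem_append, Finset.mem_toList, Finset.mem_sdiff]
      exact ⟨fun h => (em (a ∈ I)).elim Or.inr fun h' => Or.inl ⟨h, h'⟩,
        fun h => h.elim And.left fun h => hIR h⟩
  rw [shiftProd_perm this, shiftProd_append]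
  exact finite_support_shiftProd _ hg

theorem twisted_sum {ι : Type*} (s : Finset ι) (A : ι → Set (Fin d → ℝ)) (B : Set (Fin d → ℝ))
    (u : Fin d → ℤ) (h : ∀ x, Set.indicator B (1 : (Fin d → ℝ) → ℤ) x =
      ∑ k ∈ s, Set.indicator (A k) (1 : (Fin d → ℝ) → ℤ) x) :
    twisted B u = ∑ k ∈ s, twisted (A k) u := by
  funext n
  rw [Finset.sum_apply]
  simp only [twisted]
  rw [h, Int.cast_sum, Finset.sum_mul]

/-- The rational function attached to a cone of the fan in the definition of the elliptic genus
represents the sum over the lattice points of the cone. -/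
theorem Fan.RayData.hasRationalSum_coneSeries {F : Fan d} {deg : (Fin d → ℤ) → ℤ}
    {C : PointedCone ℝ (Fin d → ℝ)} (D : F.RayData deg C) (m : Fin d → ℤ) :
    HasRationalSum m (twisted C D.form) (coneSeries deg (-1) m C) := by
  classical
  -- The cone is a sum of half-open simplicial cones with generators among its rays; already the
  -- binomials of those generators reduce each piece to its finite parallelepiped.
  have hfin : (shiftProd D.rays.toList (twisted C D.form)).support.Finite := by
    obtain ⟨T, v, hT, hsum⟩ := exists_halfOpen_decomposition D.rays (pairing D.form)
      fun r hr => by rw [pairing_latVec, D.form_rays r hr, Int.cast_one]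
    have h1 : twisted C D.form = ∑ I ∈ T, twisted (halfOpen I v) D.form := by
      refine twisted_sum T _ _ _ fun x => ?_
      rw [← hsum x]
      exact congrArg (fun K : PointedCone ℝ (Fin d → ℝ) =>
        Set.indicator (K : Set (Fin d → ℝ)) (1 : (Fin d → ℝ) → ℤ) x) D.eq_hull
    have h2 : shiftProd D.rays.toList (∑ I ∈ T, twisted (halfOpen I v) D.form) =
        ∑ I ∈ T, shiftProd D.rays.toList (twisted (halfOpen I v) D.form) := by
      clear h1 hsum hT
      induction T using Finset.induction_on with
      | empty =>
        simp only [Finset.sum_empty]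
        have := shiftProd_smul D.rays.toList 0 (0 : (Fin d → ℤ) → ℂ)
        simpa using this
      | insert I T hI ih => rw [Finset.sum_insert hI, Finset.sum_insert hI, shiftProd_add, ih]
    rw [h1, h2]
    refine Set.Finite.subset (Set.Finite.biUnion T.finite_toSet fun I hI =>
      finite_support_shiftProd_of_subset (hT I hI).1
        (g := twisted (halfOpen I v) D.form) ?_) (?_ : _ ⊆ ⋃ I ∈ (T : Set _),
          (shiftProd D.rays.toList (twisted (halfOpen I v) D.form)).support)
    · rw [shiftProd_halfOpen (hT I hI).2 v fun i hi => D.form_rays i ((hT I hI).1 hi)]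
      exact finite_support_twisted_box (hT I hI).2 v _
    · intro n hn
      by_contra h
      simp only [Set.mem_iUnion, not_exists, Function.notMem_support] at h
      refine hn ?_
      rw [Finset.sum_apply]
      exact Finset.sum_eq_zero fun I hI => h I hI
  refine ⟨D.rays.toList, hfin, ?_⟩
  -- Nonzero numerator coefficients occur only at points of `C`, where `deg` agrees with the linear
  -- form.
  have hnum : ∀ n, (numCoeff C n : ℂ) * (-1) ^ deg n =
      shiftProd D.rays.toList (twisted C D.form) n := by
    intro n
    rw [shiftProd_twisted _ D.form_rays, ← numCoeff_eq_sum D.coe_rays]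
    by_cases h : numCoeff C n = 0
    · simp [h]
    · congr 2
      refine D.deg_eq n ?_
      rw [numCoeff_eq_sum D.coe_rays] at h
      obtain ⟨S, hS, hne⟩ := Finset.exists_ne_zero_of_sum_ne_zero h
      have hmem : latVec (n - ∑ i ∈ S, i) ∈ C := by
        by_contra hmem
        exact hne (by rw [Set.indicator_of_notMem hmem, mul_zero])
      have : latVec n = latVec (n - ∑ i ∈ S, i) + ∑ i ∈ S, latVec i := by
        rw [latVec_sub, latVec_sum, sub_add_cancel]
      rw [this]
      refine C.add_mem hmem (Submodule.sum_mem _ fun i hi => mem_of_mem_rayGens ?_)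
      rw [← D.coe_rays]
      exact Finset.mem_powerset.1 hS hi
  have hden : ∏ᶠ n ∈ rayGens C, (1 - HahnSeries.single (m ⬝ᵥ n) (-1 : ℂ) : LaurentSeries ℂ) =
      binomials m D.rays.toList := by
    rw [← D.coe_rays, finprod_mem_coe_finset, binomials_toList]
    refine Finset.prod_congr rfl fun n _ => ?_
    rw [HahnSeries.single_neg, sub_neg_eq_add]
  rw [coneSeries, hden, mul_div_cancel₀ _ (binomials_ne_zero m _), finiteSum]
  simp only [hnum]

/-- The contribution of a half-open simplicial cone to the elliptic genus. -/
def pieceSeries (P : Piece d) (v : Fin d → ℝ) (m : Fin d → ℤ) : LaurentSeries ℂ :=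
  finiteSum m (twisted (box P.gens v) P.form) / ∏ i ∈ P.gens, (1 + HahnSeries.single (m ⬝ᵥ i) 1)

theorem hasRationalSum_pieceSeries (P : Piece d) (v : Fin d → ℝ) (m : Fin d → ℤ) :
    HasRationalSum m (twisted (halfOpen P.gens v) P.form) (pieceSeries P v m) := by
  refine ⟨P.gens.toList, ?_, ?_⟩
  · rw [shiftProd_halfOpen P.indep v P.form_gens]
    exact finite_support_twisted_box P.indep v _
  · rw [shiftProd_halfOpen P.indep v P.form_gens, pieceSeries, ← binomials_toList,
      mul_div_cancel₀ _ (binomials_ne_zero m _)]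

/-- The contribution of `m` to the elliptic genus is a sum over the half-open cones of a
triangulation. -/
theorem Fan.sum_coneSeries_eq (F : Fan d) (hF : F.IsComplete) {deg : (Fin d → ℤ) → ℤ}
    (hdeg : F.IsDegree deg) {κ : Type} [Fintype κ] (P : κ → Piece d) {v : Fin d → ℝ}
    (hv : ∀ x, ∑ k, Set.indicator (halfOpen (P k).gens v) (1 : (Fin d → ℝ) → ℤ) x = 1)
    (hP : ∀ k n, latVec n ∈ latHull (P k).gens → deg n = (P k).form ⬝ᵥ n) (m : Fin d → ℤ) :
    ∑ C ∈ F.cones, (-1) ^ (d - coneDim C) * coneSeries deg (-1) m C =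
      ∑ k, pieceSeries (P k) v m := by
  classical
  let A : ∀ C : F.cones, F.RayData deg C := fun C => (F.exists_rayData hdeg C.2).some
  have h1 : HasRationalSum m (∑ C : F.cones, ((-1 : ℂ) ^ (d - coneDim (C : PointedCone ℝ (Fin d → ℝ)))) •
      twisted (C : PointedCone ℝ (Fin d → ℝ)) (A C).form)
      (∑ C : F.cones, HahnSeries.C ((-1 : ℂ) ^ (d - coneDim (C : PointedCone ℝ (Fin d → ℝ)))) *
        coneSeries deg (-1) m C) :=
    HasRationalSum.sum _ fun C _ => ((A C).hasRationalSum_coneSeries m).smul _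
  have h2 : HasRationalSum m (∑ k, twisted (halfOpen (P k).gens v) (P k).form)
      (∑ k, pieceSeries (P k) v m) :=
    HasRationalSum.sum _ fun k _ => hasRationalSum_pieceSeries (P k) v m
  -- Both formal sums are `(-1)^{deg n}` at every lattice point: one by the Euler relation, the
  -- other because the half-open cones partition the space.
  have h3 : (∑ C : F.cones, ((-1 : ℂ) ^ (d - coneDim (C : PointedCone ℝ (Fin d → ℝ)))) •
      twisted (C : PointedCone ℝ (Fin d → ℝ)) (A C).form) =
      ∑ k, twisted (halfOpen (P k).gens v) (P k).form := by
    have aux : ∀ (B : Set (Fin d → ℝ)) (u n : Fin d → ℤ), (latVec n ∈ B → deg n = u ⬝ᵥ n) →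
        twisted B u n = ((Set.indicator B (1 : (Fin d → ℝ) → ℤ) (latVec n) : ℤ) : ℂ) *
          (-1) ^ deg n := by
      intro B u n h
      rw [twisted]
      by_cases hn : latVec n ∈ B
      · rw [h hn]
      · rw [Set.indicator_of_notMem hn]; simp
    funext n
    rw [Finset.sum_apply, Finset.sum_apply]
    have e1 : ∑ k, twisted (halfOpen (P k).gens v) (P k).form n = (-1) ^ deg n := by
      rw [Finset.sum_congr rfl fun k _ => aux _ _ n fun h =>
        hP k n (halfOpen_subset (P k).indep h), ← Finset.sum_mul, ← Int.cast_sum, hv]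
      simp
    have e2 := F.sum_codim_eq_one hF hdeg (latVec n)
    rw [← Finset.sum_coe_sort] at e2
    rw [e1]
    calc _ = ∑ C : F.cones, (((-1 : ℤ) ^ (d - coneDim (C : PointedCone ℝ (Fin d → ℝ))) *
          Set.indicator ((C : PointedCone ℝ (Fin d → ℝ)) : Set (Fin d → ℝ))
            (1 : (Fin d → ℝ) → ℤ) (latVec n) : ℤ) : ℂ) * (-1) ^ deg n := by
          refine Finset.sum_congr rfl fun C _ => ?_
          rw [Pi.smul_apply, smul_eq_mul, aux _ _ n ((A C).deg_eq n)]
          push_cast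
          ring
      _ = (-1) ^ deg n := by
          rw [← Finset.sum_mul, ← Int.cast_sum, e2, Int.cast_one, one_mul]
  rw [h3] at h1
  rw [← h1.unique h2, ← Finset.sum_coe_sort]
  refine Finset.sum_congr rfl fun C _ => ?_
  rw [map_pow, map_neg, map_one]

/-- The lattice points of the fundamental parallelepiped. -/
def Piece.boxPoints (P : Piece d) (v : Fin d → ℝ) : Finset (Fin d → ℤ) :=
  (finite_box P.indep v).toFinset

theorem Piece.mem_boxPoints {P : Piece d} {v : Fin d → ℝ} {n : Fin d → ℤ} :
    n ∈ P.boxPoints v ↔ latVec n ∈ box P.gens v := by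
  simp [Piece.boxPoints]

/-- The lowest exponent of `q` in the contribution of a point of the fundamental
parallelepiped. -/
def Piece.expo (P : Piece d) (m b : Fin d → ℤ) : ℤ :=
  m ⬝ᵥ b + ∑ i ∈ P.gens, max 0 (-(m ⬝ᵥ i))

theorem Piece.mem_span (P : Piece d) (x : Fin d → ℝ) : x ∈ latSpan P.gens :=
  P.span_eq_top ▸ Submodule.mem_top

theorem Piece.pairing_eq (P : Piece d) (m : Fin d → ℤ) (x : Fin d → ℝ) :
    pairing m x = ∑ i ∈ P.gens, co P.gens i x * ((m ⬝ᵥ i : ℤ) : ℝ) := by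
  conv_lhs => rw [sum_co P.indep (P.mem_span x), map_sum]
  exact Finset.sum_congr rfl fun i _ => by rw [map_smul, pairing_latVec, smul_eq_mul]

theorem Piece.expo_eq (P : Piece d) (m b : Fin d → ℤ) :
    (P.expo m b : ℝ) = ∑ i ∈ P.gens, (co P.gens i (latVec b) * ((m ⬝ᵥ i : ℤ) : ℝ) +
      max 0 (-((m ⬝ᵥ i : ℤ) : ℝ))) := by
  rw [Finset.sum_add_distrib, ← P.pairing_eq, pairing_latVec, Piece.expo]
  push_cast
  rfl

/-- The expression is affine in `c`, with the values `max 0 (-k)` at 0 and `max k 0` at 1. -/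
theorem mul_add_max_nonneg {c k : ℝ} (h0 : 0 ≤ c) (h1 : c ≤ 1) : 0 ≤ c * k + max 0 (-k) := by
  rcases le_total 0 k with h | h
  · rw [max_eq_left (by linarith)]; nlinarith
  · rw [max_eq_right (by linarith)]; nlinarith

theorem Piece.expo_nonneg (P : Piece d) {v : Fin d → ℝ} (m : Fin d → ℤ) {b : Fin d → ℤ}
    (hb : b ∈ P.boxPoints v) : 0 ≤ P.expo m b := by
  have : (0 : ℝ) ≤ P.expo m b := by
    rw [P.expo_eq]
    refine Finset.sum_nonneg fun i hi => ?_
    obtain ⟨h0, h1⟩ := box_co_mem (Piece.mem_boxPoints.1 hb) hi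
    exact mul_add_max_nonneg h0 h1
  exact_mod_cast this

/-- The contribution of a half-open simplicial cone to the elliptic genus as a power series. -/
def piecePS (P : Piece d) (v : Fin d → ℝ) (m : Fin d → ℤ) : PowerSeries ℂ :=
  ∑ b ∈ P.boxPoints v, PowerSeries.C ((-1 : ℂ) ^ (P.form ⬝ᵥ b)) *
    PowerSeries.X ^ (P.expo m b).toNat * ∏ i ∈ P.gens, (1 + PowerSeries.X ^ (m ⬝ᵥ i).natAbs)⁻¹

theorem constantCoeff_one_add_X_pow_ne_zero (k : ℕ) :
    PowerSeries.constantCoeff (1 + PowerSeries.X ^ k : PowerSeries ℂ) ≠ 0 := by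
  rcases k.eq_zero_or_pos with rfl | h
  · simp
  · simp [h.ne']

/-- For `k < 0` one has `1 / (1 + q^k) = q^{-k} / (1 + q^{-k})`; for `k = 0` the power series is the
constant `1/2`. -/
theorem inv_binomial (k : ℤ) : (1 + HahnSeries.single k 1 : LaurentSeries ℂ)⁻¹ =
    HahnSeries.single (max 0 (-k)) 1 *
      (((1 + PowerSeries.X ^ k.natAbs)⁻¹ : PowerSeries ℂ) : LaurentSeries ℂ) := by
  refine inv_eq_of_mul_eq_one_right ?_
  have h1 : (1 + HahnSeries.single k 1 : LaurentSeries ℂ) * HahnSeries.single (max 0 (-k)) 1 =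
      ((1 + PowerSeries.X ^ k.natAbs : PowerSeries ℂ) : LaurentSeries ℂ) := by
    rw [PowerSeries.coe_add, PowerSeries.coe_pow, PowerSeries.coe_X, PowerSeries.coe_one,
      HahnSeries.single_pow, add_mul, one_mul, HahnSeries.single_mul_single]
    rcases le_total 0 k with h | h
    · rw [max_eq_left (by omega), add_zero]
      have : k.natAbs • (1 : ℤ) = k := by rw [nsmul_eq_mul, mul_one]; omega
      rw [this]; simp
    · rw [max_eq_right (by omega), add_neg_cancel, add_comm]
      have : k.natAbs • (1 : ℤ) = -k := by rw [nsmul_eq_mul, mul_one]; omega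
      rw [this]; simp
  rw [← mul_assoc, h1, ← PowerSeries.coe_mul, PowerSeries.mul_inv_cancel _
    (constantCoeff_one_add_X_pow_ne_zero _), PowerSeries.coe_one]

theorem pieceSeries_eq_coe (P : Piece d) (v : Fin d → ℝ) (m : Fin d → ℤ) :
    pieceSeries P v m = ((piecePS P v m : PowerSeries ℂ) : LaurentSeries ℂ) := by
  classical
  have h1 : finiteSum m (twisted (box P.gens v) P.form) =
      ∑ b ∈ P.boxPoints v, HahnSeries.single (m ⬝ᵥ b) ((-1 : ℂ) ^ (P.form ⬝ᵥ b)) := by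
    rw [finiteSum, finsum_eq_sum_of_support_subset (s := P.boxPoints v)]
    · refine Finset.sum_congr rfl fun b hb => ?_
      rw [twisted, Set.indicator_of_mem (Piece.mem_boxPoints.1 hb)]
      simp
    · intro b hb
      rw [Finset.mem_coe, Piece.mem_boxPoints]
      by_contra h
      exact hb (by simp only [twisted]; rw [Set.indicator_of_notMem h]; simp)
  rw [pieceSeries, h1, div_eq_mul_inv, ← Finset.prod_inv_distrib,
    Finset.prod_congr rfl fun i _ => inv_binomial _, Finset.prod_mul_distrib, Finset.sum_mul,
    piecePS]
  have hcoe : ∀ (s : Finset (Fin d → ℤ)) (f : (Fin d → ℤ) → PowerSeries ℂ),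
      ((∑ b ∈ s, f b : PowerSeries ℂ) : LaurentSeries ℂ) = ∑ b ∈ s, (f b : LaurentSeries ℂ) :=
    fun s f => map_sum (HahnSeries.ofPowerSeries ℤ ℂ) f s
  have hcoe' : ∀ (s : Finset (Fin d → ℤ)) (f : (Fin d → ℤ) → PowerSeries ℂ),
      ((∏ b ∈ s, f b : PowerSeries ℂ) : LaurentSeries ℂ) = ∏ b ∈ s, (f b : LaurentSeries ℂ) :=
    fun s f => map_prod (HahnSeries.ofPowerSeries ℤ ℂ) f s
  have hsing : ∏ i ∈ P.gens, (HahnSeries.single (max 0 (-(m ⬝ᵥ i))) (1 : ℂ) : LaurentSeries ℂ) =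
      HahnSeries.single (∑ i ∈ P.gens, max 0 (-(m ⬝ᵥ i))) 1 := by
    generalize P.gens = I
    induction I using Finset.induction_on with
    | empty => rfl
    | insert i I hi ih =>
      rw [Finset.prod_insert hi, Finset.sum_insert hi, ih, HahnSeries.single_mul_single, one_mul]
  rw [hcoe]
  refine Finset.sum_congr rfl fun b hb => ?_
  rw [PowerSeries.coe_mul, PowerSeries.coe_mul, hcoe', hsing, ← mul_assoc,
    HahnSeries.single_mul_single, mul_one, PowerSeries.coe_pow, PowerSeries.coe_X,
    PowerSeries.coe_C, HahnSeries.single_pow, one_pow, HahnSeries.C_apply,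
    HahnSeries.single_mul_single, zero_add, mul_one]
  congr 3
  rw [nsmul_eq_mul, mul_one, Int.toNat_of_nonneg (P.expo_nonneg m hb), Piece.expo]

end PieceSeries

end ToricGenus

end

noncomputable section

namespace ToricGenus

/-! ### Weighted norms, evaluation, and the product `G` at `y = -1` -/

section WeightedNorm

open scoped ENNReal

/-- The weighted `ℓ¹`-norm of a power series. -/
def wnorm (ρ : ℝ≥0∞) (f : PowerSeries ℂ) : ℝ≥0∞ := ∑' n, ‖PowerSeries.coeff n f‖ₑ * ρ ^ n

theorem wnorm_add_le (ρ : ℝ≥0∞) (f g : PowerSeries ℂ) :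
    wnorm ρ (f + g) ≤ wnorm ρ f + wnorm ρ g := by
  rw [wnorm, wnorm, wnorm, ← ENNReal.tsum_add]
  refine ENNReal.tsum_le_tsum fun n => ?_
  rw [map_add, ← add_mul]
  gcongr
  exact enorm_add_le _ _

theorem wnorm_zero (ρ : ℝ≥0∞) : wnorm ρ 0 = 0 := by simp [wnorm]

theorem wnorm_sum_le {ι : Type*} (ρ : ℝ≥0∞) (s : Finset ι) (f : ι → PowerSeries ℂ) :
    wnorm ρ (∑ i ∈ s, f i) ≤ ∑ i ∈ s, wnorm ρ (f i) := by
  classical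
  induction s using Finset.induction_on with
  | empty => simp [wnorm_zero]
  | insert i s hi ih =>
    rw [Finset.sum_insert hi, Finset.sum_insert hi]
    exact (wnorm_add_le _ _ _).trans (by gcongr)

theorem wnorm_mul_le (ρ : ℝ≥0∞) (f g : PowerSeries ℂ) :
    wnorm ρ (f * g) ≤ wnorm ρ f * wnorm ρ g := by
  have h : wnorm ρ f * wnorm ρ g = ∑' n, ∑ p ∈ Finset.HasAntidiagonal.antidiagonal n,
      (‖PowerSeries.coeff p.1 f‖ₑ * ρ ^ p.1) * (‖PowerSeries.coeff p.2 g‖ₑ * ρ ^ p.2) := by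
    rw [wnorm, wnorm, ← ENNReal.tsum_mul_right]
    simp_rw [← ENNReal.tsum_mul_left]
    rw [← ENNReal.tsum_prod' (f := fun p : ℕ × ℕ =>
      (‖PowerSeries.coeff p.1 f‖ₑ * ρ ^ p.1) * (‖PowerSeries.coeff p.2 g‖ₑ * ρ ^ p.2)),
      ← Finset.HasAntidiagonal.sigmaAntidiagonalEquivProd.tsum_eq, ENNReal.tsum_sigma']
    refine tsum_congr fun n => ?_
    rw [tsum_fintype]
    exact Finset.sum_coe_sort (Finset.HasAntidiagonal.antidiagonal n) fun p =>
      (‖PowerSeries.coeff p.1 f‖ₑ * ρ ^ p.1) * (‖PowerSeries.coeff p.2 g‖ₑ * ρ ^ p.2)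
  rw [h]
  refine ENNReal.tsum_le_tsum fun n => ?_
  rw [PowerSeries.coeff_mul]
  calc _ ≤ (∑ p ∈ Finset.HasAntidiagonal.antidiagonal n, ‖PowerSeries.coeff p.1 f * PowerSeries.coeff p.2 g‖ₑ) *
        ρ ^ n := by gcongr; exact enorm_sum_le _ _
    _ = _ := by
      rw [Finset.sum_mul]
      refine Finset.sum_congr rfl fun p hp => ?_
      rw [← Finset.HasAntidiagonal.mem_antidiagonal.1 hp, enorm_mul, pow_add]
      ring

theorem wnorm_C (ρ : ℝ≥0∞) (a : ℂ) : wnorm ρ (PowerSeries.C a) = ‖a‖ₑ := by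
  rw [wnorm, tsum_eq_single 0]
  · simp
  · intro n hn
    simp [PowerSeries.coeff_C, hn]

theorem wnorm_one (ρ : ℝ≥0∞) : wnorm ρ 1 = 1 := by
  rw [← map_one PowerSeries.C, wnorm_C, enorm_one]

theorem wnorm_X_pow (ρ : ℝ≥0∞) (k : ℕ) : wnorm ρ (PowerSeries.X ^ k) = ρ ^ k := by
  rw [wnorm, tsum_eq_single k]
  · simp [PowerSeries.coeff_X_pow]
  · intro n hn
    simp [PowerSeries.coeff_X_pow, hn]

theorem wnorm_prod_le {ι : Type*} (ρ : ℝ≥0∞) (s : Finset ι) (f : ι → PowerSeries ℂ) :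
    wnorm ρ (∏ i ∈ s, f i) ≤ ∏ i ∈ s, wnorm ρ (f i) := by
  classical
  induction s using Finset.induction_on with
  | empty => simp [wnorm_one]
  | insert i s hi ih =>
    rw [Finset.prod_insert hi, Finset.prod_insert hi]
    exact (wnorm_mul_le _ _ _).trans (by gcongr)

theorem wnorm_pow_le (ρ : ℝ≥0∞) (f : PowerSeries ℂ) (k : ℕ) :
    wnorm ρ (f ^ k) ≤ wnorm ρ f ^ k := by
  simpa using wnorm_prod_le ρ (Finset.range k) fun _ => f

/-- Geometric series: modulo `X^N` the inverse agrees with the sum of the first `N` powers of `a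
X^k`, whose norms are at most `ρ^(k j)`. -/
theorem wnorm_inv_le (ρ : ℝ≥0∞) (a : ℂ) (ha : ‖a‖ = 1) {k : ℕ} (hk : 0 < k) :
    wnorm ρ (1 - PowerSeries.C a * PowerSeries.X ^ k)⁻¹ ≤ (1 - ρ ^ k)⁻¹ := by
  set u : PowerSeries ℂ := PowerSeries.C a * PowerSeries.X ^ k with hu
  have hc : PowerSeries.constantCoeff (1 - u) ≠ 0 := by simp [hu, hk.ne']
  have hu1 : wnorm ρ u ≤ ρ ^ k := by
    refine (wnorm_mul_le _ _ _).trans ?_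
    rw [wnorm_C, wnorm_X_pow, enorm_eq_nnnorm, show ‖a‖₊ = 1 from NNReal.eq ha]
    simp
  have hcoef : ∀ n, PowerSeries.coeff n (1 - u)⁻¹ =
      PowerSeries.coeff n (∑ j ∈ Finset.range (n + 1), u ^ j) := by
    intro n
    have h1 : (1 - u)⁻¹ = ∑ j ∈ Finset.range (n + 1), u ^ j + u ^ (n + 1) * (1 - u)⁻¹ := by
      have h2 := mul_neg_geom_sum u (n + 1)
      have h3 : (1 - u) * (1 - u)⁻¹ = 1 := PowerSeries.mul_inv_cancel _ hc
      calc (1 - u)⁻¹ = ((1 - u) * ∑ j ∈ Finset.range (n + 1), u ^ j) * (1 - u)⁻¹ +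
            u ^ (n + 1) * (1 - u)⁻¹ := by rw [h2]; ring
        _ = (∑ j ∈ Finset.range (n + 1), u ^ j) * ((1 - u) * (1 - u)⁻¹) +
            u ^ (n + 1) * (1 - u)⁻¹ := by ring
        _ = _ := by rw [h3, mul_one]
    conv_lhs => rw [h1]
    rw [map_add, hu, mul_pow, ← map_pow, ← pow_mul]
    suffices h : PowerSeries.coeff n (PowerSeries.C (a ^ (n + 1)) *
        PowerSeries.X ^ (k * (n + 1)) * (1 - u)⁻¹) = 0 by rw [h, add_zero]
    have hdvd : (PowerSeries.X : PowerSeries ℂ) ^ (k * (n + 1)) ∣ PowerSeries.C (a ^ (n + 1)) *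
        PowerSeries.X ^ (k * (n + 1)) * (1 - u)⁻¹ :=
      Dvd.dvd.mul_right (Dvd.intro_left _ rfl) _
    exact PowerSeries.X_pow_dvd_iff.1 hdvd n (by nlinarith)
  rw [← ENNReal.tsum_geometric]
  have hle : ∀ N, ∑ n ∈ Finset.range N, ‖PowerSeries.coeff n (1 - u)⁻¹‖ₑ * ρ ^ n ≤
      ∑' j, (ρ ^ k) ^ j := by
    intro N
    have hcoef' : ∀ n ∈ Finset.range N, PowerSeries.coeff n (1 - u)⁻¹ =
        PowerSeries.coeff n (∑ j ∈ Finset.range N, u ^ j) := by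
      intro n hn
      rw [Finset.mem_range] at hn
      rw [hcoef, map_sum, map_sum]
      refine Finset.sum_subset (Finset.range_subset_range.2 hn) fun j _ hj => ?_
      rw [Finset.mem_range, not_lt] at hj
      have hdvd : (PowerSeries.X : PowerSeries ℂ) ^ (k * j) ∣ u ^ j := by
        rw [hu, mul_pow, ← pow_mul]; exact Dvd.intro_left _ rfl
      exact PowerSeries.X_pow_dvd_iff.1 hdvd n (by nlinarith)
    calc _ = ∑ n ∈ Finset.range N,
          ‖PowerSeries.coeff n (∑ j ∈ Finset.range N, u ^ j)‖ₑ * ρ ^ n :=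
          Finset.sum_congr rfl fun n hn => by rw [hcoef' n hn]
      _ ≤ wnorm ρ (∑ j ∈ Finset.range N, u ^ j) := ENNReal.sum_le_tsum _
      _ ≤ ∑ j ∈ Finset.range N, (ρ ^ k) ^ j := (wnorm_sum_le _ _ _).trans <|
          Finset.sum_le_sum fun j _ => (wnorm_pow_le _ _ _).trans (by gcongr)
      _ ≤ _ := ENNReal.sum_le_tsum _
  exact ENNReal.tsum_le_of_sum_range_le hle

/-- The bound is uniform in `k`, so one constant serves the denominators for all `m`. At `k = 0` the
inverse is `1/2`. -/
theorem wnorm_inv_one_add_le {ρ : ℝ≥0∞} (hρ : ρ < 1) (k : ℕ) :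
    wnorm ρ (1 + PowerSeries.X ^ k)⁻¹ ≤ (1 - ρ)⁻¹ := by
  rcases k.eq_zero_or_pos with rfl | hk
  · have : (1 + PowerSeries.X ^ 0 : PowerSeries ℂ)⁻¹ = PowerSeries.C (2⁻¹ : ℂ) := by
      rw [pow_zero, one_add_one_eq_two, show (2 : PowerSeries ℂ) = PowerSeries.C 2 from
        (map_ofNat _ 2).symm, ← PowerSeries.C_inv]
    rw [this, wnorm_C]
    refine le_trans ?_ (ENNReal.one_le_inv.2 tsub_le_self)
    rw [enorm_eq_nnnorm, nnnorm_inv]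
    norm_num
  · have := wnorm_inv_le ρ (-1) (by simp) hk
    simp only [map_neg, map_one, neg_mul, one_mul, sub_neg_eq_add] at this
    refine this.trans ?_
    gcongr
    exact pow_le_of_le_one zero_le hρ.le hk.ne'

theorem summable_of_wnorm {q : ℂ} {f : PowerSeries ℂ} (h : wnorm ‖q‖ₑ f < ∞) :
    Summable fun n => ‖PowerSeries.coeff n f * q ^ n‖ := by
  have : wnorm ‖q‖ₑ f = ∑' n, ‖PowerSeries.coeff n f * q ^ n‖ₑ := by
    simp [wnorm, enorm_mul, enorm_pow]
  rw [this] at h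
  exact tsum_enorm_ne_top_iff_summable_norm.1 h.ne

/-- Evaluation of a power series. -/
def evalPS (q : ℂ) (f : PowerSeries ℂ) : ℂ := ∑' n, PowerSeries.coeff n f * q ^ n

theorem norm_evalPS_le {q : ℂ} {f : PowerSeries ℂ} : ‖evalPS q f‖ₑ ≤ wnorm ‖q‖ₑ f := by
  refine (enorm_tsum_le_tsum_enorm).trans ?_
  simp [wnorm, enorm_mul, enorm_pow]

theorem evalPS_add {q : ℂ} {f g : PowerSeries ℂ} (hf : wnorm ‖q‖ₑ f < ∞)
    (hg : wnorm ‖q‖ₑ g < ∞) : evalPS q (f + g) = evalPS q f + evalPS q g := by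
  rw [evalPS, evalPS, evalPS, ← (summable_of_wnorm hf).of_norm.tsum_add
    (summable_of_wnorm hg).of_norm]
  simp [add_mul]

theorem evalPS_sum {ι : Type*} {q : ℂ} (s : Finset ι) {f : ι → PowerSeries ℂ}
    (hf : ∀ i ∈ s, wnorm ‖q‖ₑ (f i) < ∞) :
    evalPS q (∑ i ∈ s, f i) = ∑ i ∈ s, evalPS q (f i) := by
  rw [evalPS]
  simp_rw [map_sum, Finset.sum_mul]
  exact Summable.tsum_finsetSum fun i hi => (summable_of_wnorm (hf i hi)).of_norm

theorem evalPS_mul {q : ℂ} {f g : PowerSeries ℂ} (hf : wnorm ‖q‖ₑ f < ∞)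
    (hg : wnorm ‖q‖ₑ g < ∞) : evalPS q (f * g) = evalPS q f * evalPS q g := by
  rw [evalPS, evalPS, evalPS, tsum_mul_tsum_eq_tsum_sum_antidiagonal_of_summable_norm
    (summable_of_wnorm hf) (summable_of_wnorm hg)]
  refine tsum_congr fun n => ?_
  rw [PowerSeries.coeff_mul, Finset.sum_mul]
  refine Finset.sum_congr rfl fun p hp => ?_
  rw [← Finset.HasAntidiagonal.mem_antidiagonal.1 hp, pow_add]
  ring

theorem evalPS_C (q a : ℂ) : evalPS q (PowerSeries.C a) = a := by
  rw [evalPS, tsum_eq_single 0]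
  · simp
  · intro n hn
    simp [PowerSeries.coeff_C, hn]

theorem evalPS_one (q : ℂ) : evalPS q 1 = 1 := by
  rw [← map_one PowerSeries.C, evalPS_C]

theorem evalPS_X_pow (q : ℂ) (k : ℕ) : evalPS q (PowerSeries.X ^ k) = q ^ k := by
  rw [evalPS, tsum_eq_single k]
  · simp [PowerSeries.coeff_X_pow]
  · intro n hn
    simp [PowerSeries.coeff_X_pow, hn]

theorem evalPS_prod {ι : Type*} {q : ℂ} (s : Finset ι) {f : ι → PowerSeries ℂ}
    (hf : ∀ i ∈ s, wnorm ‖q‖ₑ (f i) < ∞) :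
    evalPS q (∏ i ∈ s, f i) = ∏ i ∈ s, evalPS q (f i) := by
  classical
  induction s using Finset.induction_on with
  | empty => simp [evalPS_one]
  | insert i s hi ih =>
    have h := fun j hj => hf j (Finset.mem_insert_of_mem hj)
    rw [Finset.prod_insert hi, Finset.prod_insert hi, evalPS_mul (hf i (Finset.mem_insert_self _ _)),
      ih h]
    exact (wnorm_prod_le _ _ _).trans_lt (ENNReal.prod_lt_top h)

theorem evalPS_inv_one_add {q : ℂ} (hq : ‖q‖ < 1) (k : ℕ) :
    evalPS q (1 + PowerSeries.X ^ k)⁻¹ = (1 + q ^ k)⁻¹ := by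
  have hq' : ‖q‖ₑ < 1 := by
    rw [enorm_eq_nnnorm]; exact_mod_cast hq
  have h0 : wnorm ‖q‖ₑ (1 + PowerSeries.X ^ k)⁻¹ < ∞ :=
    (wnorm_inv_one_add_le hq' k).trans_lt (ENNReal.inv_lt_top.2 (tsub_pos_of_lt hq'))
  have hX : wnorm ‖q‖ₑ (PowerSeries.X ^ k) < ∞ := by
    rw [wnorm_X_pow]; exact ENNReal.pow_lt_top (hq'.trans_le le_top)
  have h1 : wnorm ‖q‖ₑ (1 : PowerSeries ℂ) < ∞ := by rw [wnorm_one]; exact ENNReal.one_lt_top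
  have h := congrArg (evalPS q) (PowerSeries.mul_inv_cancel (1 + PowerSeries.X ^ k : PowerSeries ℂ)
    (constantCoeff_one_add_X_pow_ne_zero k))
  rw [evalPS_mul ((wnorm_add_le _ _ _).trans_lt (ENNReal.add_lt_top.2 ⟨h1, hX⟩)) h0,
    evalPS_add h1 hX, evalPS_one, evalPS_X_pow] at h
  exact eq_inv_of_mul_eq_one_right h

/-- Lower semicontinuity of the weighted norm. -/
theorem wnorm_le_of_tendsto {ρ : ℝ≥0∞} {f : ℕ → PowerSeries ℂ} {g : PowerSeries ℂ} {K : ℝ≥0∞}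
    (hK : ∀ N, wnorm ρ (f N) ≤ K)
    (hf : ∀ n, Filter.Tendsto (fun N => PowerSeries.coeff n (f N)) Filter.atTop
      (nhds (PowerSeries.coeff n g))) (hρ : ρ ≠ ∞) : wnorm ρ g ≤ K := by
  refine ENNReal.tsum_le_of_sum_range_le fun M => ?_
  have h : Filter.Tendsto (fun N => ∑ n ∈ Finset.range M, ‖PowerSeries.coeff n (f N)‖ₑ * ρ ^ n)
      Filter.atTop (nhds (∑ n ∈ Finset.range M, ‖PowerSeries.coeff n g‖ₑ * ρ ^ n)) :=
    tendsto_finsetSum _ fun n _ => ENNReal.Tendsto.mul_const ((hf n).enorm)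
      (Or.inr (ENNReal.pow_ne_top hρ))
  exact le_of_tendsto' h fun N => (ENNReal.sum_le_tsum _).trans (hK N)

/-- The factors of the product `G(-1, q)`. -/
theorem G_neg_one_factor (k : ℕ) :
    (1 - PowerSeries.C (-1 : ℂ) * PowerSeries.X ^ k) *
      (1 - PowerSeries.C (-1 : ℂ)⁻¹ * PowerSeries.X ^ (k + 1)) *
      ((1 - PowerSeries.X ^ (k + 1)) ^ 2)⁻¹ =
    (1 + PowerSeries.X ^ k) * (1 + PowerSeries.X ^ (k + 1)) *
      ((1 - PowerSeries.X ^ (k + 1) : PowerSeries ℂ)⁻¹) ^ 2 := by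
  rw [inv_neg, inv_one, map_neg, map_one, sq (1 - _ : PowerSeries ℂ), PowerSeries.mul_inv_rev, sq]
  ring

/-- The factors of the product `G(-1, q)`. -/
def factorG (k : ℕ) : PowerSeries ℂ :=
    (1 + PowerSeries.X ^ k) * (1 + PowerSeries.X ^ (k + 1)) *
      ((1 - PowerSeries.X ^ (k + 1) : PowerSeries ℂ)⁻¹) ^ 2

open scoped PowerSeries.WithPiTopology in
theorem G_neg_one : G (-1) = ∏' k, factorG k := by
  rw [G]
  exact tprod_congr G_neg_one_factor

theorem X_pow_dvd_factorG_sub_one (k : ℕ) : (PowerSeries.X : PowerSeries ℂ) ^ k ∣ factorG k - 1 := by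
  have hc : PowerSeries.constantCoeff (1 - PowerSeries.X ^ (k + 1) : PowerSeries ℂ) ≠ 0 := by simp
  set w : PowerSeries ℂ := (1 - PowerSeries.X ^ (k + 1))⁻¹ with hw
  have h1 : w = 1 + PowerSeries.X ^ (k + 1) * w := by
    have := PowerSeries.mul_inv_cancel _ hc
    rw [← hw] at this
    linear_combination this
  have h2 : ∃ w', w = 1 + PowerSeries.X ^ k * w' := ⟨PowerSeries.X * w, by
    rw [← mul_assoc, ← pow_succ]; exact h1⟩
  obtain ⟨w', h3⟩ := h2
  rw [factorG, ← hw, h3, pow_succ]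
  generalize (PowerSeries.X : PowerSeries ℂ) ^ k = x
  exact ⟨(1 + (1 + x) * PowerSeries.X) * (1 + x * w') ^ 2 + 2 * w' + x * w' ^ 2, by ring⟩

open scoped PowerSeries.WithPiTopology in
theorem multipliable_factorG : Multipliable factorG := by
  have : Multipliable fun k => 1 + (factorG k - 1) := by
    refine PowerSeries.WithPiTopology.multipliable_one_add_of_tendsto_order_atTop_nhds_top
      (ι := ℕ) (f := fun k => factorG k - 1) ℂ ?_
    refine ENat.tendsto_nhds_top_iff_natCast_lt.mpr fun n =>
      Filter.eventually_atTop.mpr ⟨n + 1, fun k hk => ?_⟩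
    have := PowerSeries.nat_le_order (factorG k - 1) k fun i hi =>
      PowerSeries.X_pow_dvd_iff.1 (X_pow_dvd_factorG_sub_one k) i hi
    refine lt_of_lt_of_le ?_ this
    exact_mod_cast hk
  simpa using this

theorem wnorm_factorG_le {ρ : ℝ≥0∞} (hρ : ρ < 1) (k : ℕ) :
    wnorm ρ (factorG k) ≤ (1 + ρ ^ k) * (1 + ρ ^ k) * ((1 - ρ ^ (k + 1))⁻¹) ^ 2 := by
  rw [factorG]
  refine (wnorm_mul_le _ _ _).trans (mul_le_mul' ((wnorm_mul_le _ _ _).trans (mul_le_mul' ?_ ?_))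
    ((wnorm_pow_le _ _ _).trans ?_))
  · refine (wnorm_add_le _ _ _).trans ?_
    rw [wnorm_one, wnorm_X_pow]
  · refine (wnorm_add_le _ _ _).trans ?_
    rw [wnorm_one, wnorm_X_pow, pow_succ]
    gcongr
    exact mul_le_of_le_one_right' hρ.le
  · gcongr
    simpa using wnorm_inv_le ρ 1 (by simp) (Nat.succ_pos k)

theorem one_sub_inv_le_exp {r x : ℝ} (hr : r < 1) (hx : 0 ≤ x) (hxr : x ≤ r) :
    (1 - x)⁻¹ ≤ Real.exp (x * (1 - r)⁻¹) := by
  have h1 : (1 - x)⁻¹ = x * (1 - x)⁻¹ + 1 := by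
    field_simp [(by linarith : (1 - x) ≠ 0)]
    ring
  rw [h1]
  refine le_trans ?_ (Real.add_one_le_exp _)
  have : (1 - x)⁻¹ ≤ (1 - r)⁻¹ := inv_anti₀ (by linarith) (by linarith)
  gcongr

theorem wnorm_factorG_le_exp {r : ℝ} (h0 : 0 ≤ r) (h1 : r < 1) (k : ℕ) :
    wnorm (ENNReal.ofReal r) (factorG k) ≤
      ENNReal.ofReal (Real.exp (r ^ k * (2 + 2 * (1 - r)⁻¹))) := by
  refine (wnorm_factorG_le (by simpa using h1) k).trans ?_
  have hk : 0 ≤ r ^ k := pow_nonneg h0 k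
  have hk' : r ^ (k + 1) ≤ r := by
    rw [pow_succ]; exact mul_le_of_le_one_left h0 (pow_le_one₀ h0 h1.le)
  have e1 : 1 + ENNReal.ofReal r ^ k = ENNReal.ofReal (1 + r ^ k) := by
    rw [ENNReal.ofReal_add zero_le_one hk, ENNReal.ofReal_pow h0, ENNReal.ofReal_one]
  have e2 : (1 - ENNReal.ofReal r ^ (k + 1))⁻¹ = ENNReal.ofReal (1 - r ^ (k + 1))⁻¹ := by
    rw [← ENNReal.ofReal_pow h0, ← ENNReal.ofReal_one, ← ENNReal.ofReal_sub _ (pow_nonneg h0 _),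
      ENNReal.ofReal_inv_of_pos (by linarith)]
  have hpos : 0 ≤ (1 - r ^ (k + 1))⁻¹ := inv_nonneg.2 (by linarith)
  rw [e1, e2, ← ENNReal.ofReal_mul (by positivity), ← ENNReal.ofReal_pow hpos,
    ← ENNReal.ofReal_mul (by positivity)]
  refine ENNReal.ofReal_le_ofReal ?_
  have a1 : 1 + r ^ k ≤ Real.exp (r ^ k) := by linarith [Real.add_one_le_exp (r ^ k)]
  have a2 : (1 - r ^ (k + 1))⁻¹ ≤ Real.exp (r ^ k * (1 - r)⁻¹) := by
    refine (one_sub_inv_le_exp h1 (pow_nonneg h0 _) hk').trans (Real.exp_le_exp.2 ?_)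
    refine mul_le_mul_of_nonneg_right ?_ (inv_nonneg.2 (by linarith))
    exact pow_le_pow_of_le_one h0 h1.le (Nat.le_succ k)
  calc _ ≤ Real.exp (r ^ k) * Real.exp (r ^ k) * Real.exp (r ^ k * (1 - r)⁻¹) ^ 2 := by gcongr
    _ = _ := by
      rw [sq, ← Real.exp_add, ← Real.exp_add, ← Real.exp_add]
      congr 1
      ring

-- The partial products are bounded by the exponential of a partial geometric sum, and the norm is
-- lower semicontinuous under coefficientwise limits.
open scoped PowerSeries.WithPiTopology in
theorem wnorm_G_lt_top {r : ℝ} (h0 : 0 ≤ r) (h1 : r < 1) :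
    wnorm (ENNReal.ofReal r) (G (-1)) < ∞ := by
  refine lt_of_le_of_lt (b := ENNReal.ofReal (Real.exp ((1 - r)⁻¹ * (2 + 2 * (1 - r)⁻¹)))) ?_
    ENNReal.ofReal_lt_top
  have ht := multipliable_factorG.hasProd.tendsto_prod_nat
  rw [← G_neg_one, PowerSeries.WithPiTopology.tendsto_iff_coeff_tendsto] at ht
  refine wnorm_le_of_tendsto (fun N => ?_) ht ENNReal.ofReal_ne_top
  refine (wnorm_prod_le _ _ _).trans ?_
  refine (Finset.prod_le_prod' fun k _ => wnorm_factorG_le_exp h0 h1 k).trans ?_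
  rw [← ENNReal.ofReal_prod_of_nonneg fun k _ => (Real.exp_pos _).le, ← Real.exp_sum,
    ← Finset.sum_mul]
  refine ENNReal.ofReal_le_ofReal (Real.exp_le_exp.2 (mul_le_mul_of_nonneg_right ?_ ?_))
  · rw [← tsum_geometric_of_lt_one h0 h1]
    exact (summable_geometric_of_lt_one h0 h1).sum_le_tsum _ fun k _ => pow_nonneg h0 k
  · have : 0 ≤ (1 - r)⁻¹ := inv_nonneg.2 (by linarith)
    positivity

-- The factor with `k = 0` has constant term 2 and all others have constant term 1. This makes the
-- formal inverse of `G` genuine.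
open scoped PowerSeries.WithPiTopology in
theorem constantCoeff_G_ne_zero : PowerSeries.constantCoeff (G (-1)) ≠ 0 := by
  have ht := multipliable_factorG.hasProd.tendsto_prod_nat
  rw [← G_neg_one, PowerSeries.WithPiTopology.tendsto_iff_coeff_tendsto] at ht
  have h0 := ht 0
  have h1 : ∀ N : ℕ, 1 ≤ N → PowerSeries.coeff 0 (∏ k ∈ Finset.range N, factorG k) = 2 := by
    intro N hN
    rw [PowerSeries.coeff_zero_eq_constantCoeff_apply, map_prod,
      Finset.prod_eq_single_of_mem 0 (Finset.mem_range.2 hN) fun k _ hk => ?_]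
    · simp [factorG]; norm_num
    · simp [factorG, hk]
  have h2 := tendsto_nhds_unique h0 (tendsto_const_nhds.congr' (Filter.eventually_atTop.2
    ⟨1, fun N hN => (h1 N hN).symm⟩))
  rw [← PowerSeries.coeff_zero_eq_constantCoeff_apply, h2]
  norm_num

end WeightedNorm

end ToricGenus

end

noncomputable section

namespace ToricGenus

/-! ### Growth of the exponents in the dual lattice -/

section Estimates

open Filter Topology

variable {d : ℕ}

theorem eventually_mul_lt {a b : ℝ} (hb : 0 < b) : ∀ᶠ δ : ℝ in 𝓝[>] 0, δ * a < b := by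
  have h : Tendsto (fun δ : ℝ => δ * a) (𝓝[>] 0) (𝓝 0) := by
    have : Continuous fun δ : ℝ => δ * a := by fun_prop
    simpa using (this.tendsto 0).mono_left nhdsWithin_le_nhds
  exact h.eventually_lt_const hb

theorem Piece.box_co_of_pos {P : Piece d} {v : Fin d → ℝ} {b : Fin d → ℤ}
    (hb : b ∈ P.boxPoints v) {i : Fin d → ℤ} (hi : i ∈ P.gens) (hv : 0 < co P.gens i v) :
    0 ≤ co P.gens i (latVec b) ∧ co P.gens i (latVec b) < 1 := by
  have h := (Piece.mem_boxPoints.1 hb).2 i hi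
  refine ⟨(box_co_mem (Piece.mem_boxPoints.1 hb) hi).1, lt_of_not_ge fun h1 => h.2 ?_⟩
  rcases h1.lt_or_eq with h1 | h1
  · exact Or.inl (by linarith)
  · exact Or.inr ⟨by linarith, hv⟩

theorem Piece.box_co_of_neg {P : Piece d} {v : Fin d → ℝ} {b : Fin d → ℤ}
    (hb : b ∈ P.boxPoints v) {i : Fin d → ℤ} (hi : i ∈ P.gens) (hv : co P.gens i v < 0) :
    0 < co P.gens i (latVec b) ∧ co P.gens i (latVec b) ≤ 1 := by
  have h := (Piece.mem_boxPoints.1 hb).2 i hi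
  refine ⟨?_, (box_co_mem (Piece.mem_boxPoints.1 hb) hi).2⟩
  rcases h.1 with h | h
  · exact h
  · linarith [h.2]

/-- Small translates of the points of the fundamental parallelepiped are interior points. -/
theorem Piece.eventually_mem_Ioo (P : Piece d) {v : Fin d → ℝ}
    (hv : ∀ i ∈ P.gens, co P.gens i v ≠ 0) :
    ∀ᶠ δ : ℝ in 𝓝[>] 0, ∀ b ∈ P.boxPoints v, ∀ i ∈ P.gens,
      δ * co P.gens i v + co P.gens i (latVec b) ∈ Set.Ioo (0 : ℝ) 1 := by
  rw [eventually_all_finset]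
  intro b hb
  rw [eventually_all_finset]
  intro i hi
  rcases lt_or_gt_of_ne (hv i hi) with h | h
  · filter_upwards [eventually_mul_lt (a := -co P.gens i v) (P.box_co_of_neg hb hi h).1,
      self_mem_nhdsWithin] with δ hδ hpos
    have h1 := mul_neg_of_pos_of_neg hpos h
    exact ⟨by linarith, by linarith [(P.box_co_of_neg hb hi h).2]⟩
  · filter_upwards [eventually_mul_lt (a := co P.gens i v)
      (sub_pos.2 (P.box_co_of_pos hb hi h).2), self_mem_nhdsWithin] with δ hδ hpos
    have h1 := mul_pos hpos h
    exact ⟨by linarith [(P.box_co_of_pos hb hi h).1], by linarith⟩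

/-- The exponents of `q` grow linearly in the directions `m` with `m · v < 0`. -/
theorem Piece.eventually_le_expo (P : Piece d) {v : Fin d → ℝ}
    (hv : ∀ i ∈ P.gens, co P.gens i v ≠ 0) :
    ∀ᶠ δ : ℝ in 𝓝[>] 0, ∀ b ∈ P.boxPoints v, ∀ m : Fin d → ℤ,
      δ * -pairing m v ≤ P.expo m b := by
  filter_upwards [P.eventually_mem_Ioo hv] with δ hδ b hb m
  rw [P.expo_eq, P.pairing_eq, ← Finset.sum_neg_distrib, Finset.mul_sum]
  -- Termwise: the shifted coordinate `δ a + c` lies in `(0,1)`, so `(δ a + c) k + max 0 (-k) ≥ 0`.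
  refine Finset.sum_le_sum fun i hi => ?_
  obtain ⟨ha, hb⟩ := hδ b hb i hi
  generalize co P.gens i (latVec b) = c at *
  generalize ((m ⬝ᵥ i : ℤ) : ℝ) = k at *
  generalize co P.gens i v = a at *
  rcases le_total 0 k with hk | hk
  · rw [max_eq_left (by linarith)]
    nlinarith
  · rw [max_eq_right (by linarith)]
    nlinarith

/-- The `ℓ¹`-norm of a lattice vector. -/
def absSum (m : Fin d → ℤ) : ℕ := ∑ l, (m l).natAbs

theorem cast_absSum (m : Fin d → ℤ) : (absSum m : ℝ) = ∑ l, |(m l : ℝ)| := by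
  rw [absSum, Nat.cast_sum]
  exact Finset.sum_congr rfl fun l _ => by rw [Nat.cast_natAbs, Int.cast_abs]

theorem finite_absSum_le (N : ℕ) : {m : Fin d → ℤ | absSum m ≤ N}.Finite := by
  refine (Set.finite_Icc (fun _ => -(N : ℤ)) (fun _ => (N : ℤ))).subset fun m hm => ?_
  have h : ∀ l, (m l).natAbs ≤ N := fun l =>
    (Finset.single_le_sum (f := fun l => (m l).natAbs) (fun _ _ => Nat.zero_le _)
      (Finset.mem_univ l)).trans hm
  exact ⟨fun l => by have := h l; simp only; omega, fun l => by have := h l; simp only; omega⟩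

theorem exists_notMem_near {bad : Finset (Submodule ℝ (Fin d → ℝ))} (hbad : ∀ B ∈ bad, B ≠ ⊤)
    (u : Fin d → ℝ) {ε : ℝ} (hε : 0 < ε) :
    ∃ v : Fin d → ℝ, (∀ B ∈ bad, v ∉ B) ∧ ∀ l, |v l - u l| ≤ ε := by
  obtain ⟨w, hw⟩ : ∃ w : Fin d → ℝ, ∀ B ∈ bad, w ∉ B := by
    obtain ⟨w, hw⟩ := Submodule.exists_forall_notMem_of_forall_ne_top
      (fun B : bad => (B : Submodule ℝ (Fin d → ℝ))) fun B => hbad B B.2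
    exact ⟨w, fun B hB => hw ⟨B, hB⟩⟩
  have h1 : ∀ᶠ t : ℝ in 𝓝[>] 0, ∀ B ∈ bad, u + t • w ∉ B := by
    rw [eventually_all_finset]
    exact fun B hB => eventually_notMem (hw B hB) u
  have h2 : ∀ᶠ t : ℝ in 𝓝[>] 0, ∀ l, |(u + t • w) l - u l| ≤ ε := by
    rw [eventually_all]
    intro l
    have h : Tendsto (fun t : ℝ => |(u + t • w) l - u l|) (𝓝[>] 0) (𝓝 0) := by
      have : Continuous fun t : ℝ => |(u + t • w) l - u l| := by
        simp only [Pi.add_apply, Pi.smul_apply]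
        fun_prop
      simpa using (this.tendsto 0).mono_left nhdsWithin_le_nhds
    exact (h.eventually_lt_const hε).mono fun δ h => h.le
  obtain ⟨t, ht1, ht2⟩ := (h1.and h2).exists
  exact ⟨_, ht1, ht2⟩

/-- Take generic vectors near `0` and near plus and minus the unit vectors. If `m j` is the
coordinate of largest absolute value, the unit vector of opposite sign gives `|m j|`, which is at
least `2ε |m|` for `ε = 1/(2(d+1))`, and the perturbation costs at most `ε |m|`. -/
theorem exists_directions {bad : Finset (Submodule ℝ (Fin d → ℝ))} (hbad : ∀ B ∈ bad, B ≠ ⊤) :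
    ∃ V : Finset (Fin d → ℝ), (∀ v ∈ V, ∀ B ∈ bad, v ∉ B) ∧
      ∀ m : Fin d → ℤ, ∃ v ∈ V, (absSum m : ℝ) * (2 * ((d : ℝ) + 1))⁻¹ ≤ -pairing m v := by
  classical
  choose g hg hg' using fun u => exists_notMem_near hbad u (ε := (2 * ((d : ℝ) + 1))⁻¹)
    (by positivity)
  refine ⟨{g 0} ∪ (Finset.univ.image fun j => g (Pi.single j 1)) ∪
    (Finset.univ.image fun j => g (Pi.single j (-1))), ?_, fun m => ?_⟩
  · intro v hv
    simp only [Finset.mem_union, Finset.mem_singleton, Finset.mem_image, Finset.mem_univ,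
      true_and] at hv
    rcases hv with (rfl | ⟨j, rfl⟩) | ⟨j, rfl⟩ <;> exact hg _
  have key : ∀ u : Fin d → ℝ, -pairing m u - absSum m * (2 * ((d : ℝ) + 1))⁻¹ ≤
      -pairing m (g u) := by
    intro u
    have : pairing m (g u) - pairing m u ≤ absSum m * (2 * ((d : ℝ) + 1))⁻¹ := by
      rw [← map_sub, pairing_apply, cast_absSum, Finset.sum_mul]
      refine Finset.sum_le_sum fun l _ => ?_
      refine (le_abs_self _).trans ?_
      rw [abs_mul, mul_comm]
      exact mul_le_mul_of_nonneg_left (hg' u l) (abs_nonneg _)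
    linarith
  by_cases hm : m = 0
  · refine ⟨g 0, by simp, ?_⟩
    have := key 0
    simp only [hm, absSum, map_zero] at this ⊢
    simpa using this
  · have : Nonempty (Fin d) := by
      by_contra h
      rw [not_nonempty_iff] at h
      exact hm (Subsingleton.elim _ _)
    obtain ⟨j, hj⟩ := Finite.exists_max fun l => |(m l : ℝ)|
    have hS : (absSum m : ℝ) * (2 * ((d : ℝ) + 1))⁻¹ ≤ |(m j : ℝ)| * 2⁻¹ := by
      have : (absSum m : ℝ) ≤ d * |(m j : ℝ)| := by
        rw [cast_absSum]
        refine (Finset.sum_le_sum fun l _ => hj l).trans ?_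
        simp
      rw [mul_inv, mul_comm 2⁻¹, ← mul_assoc]
      refine mul_le_mul_of_nonneg_right ?_ (by norm_num)
      rw [← div_eq_mul_inv, div_le_iff₀ (by positivity)]
      nlinarith [abs_nonneg (m j : ℝ)]
    have hp : ∀ a : ℝ, pairing m (Pi.single j a) = m j * a := by
      intro a
      rw [pairing_apply, Finset.sum_eq_single j]
      · simp only [Pi.single_eq_same, mul_comm]
      · intro l _ hl; simp [hl]
      · simp
    rcases le_total (m j : ℝ) 0 with h | h
    · refine ⟨g (Pi.single j 1), by simp, ?_⟩
      have := key (Pi.single j 1)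
      rw [hp] at this
      rw [abs_of_nonpos h] at hS
      linarith
    · refine ⟨g (Pi.single j (-1)), by simp, ?_⟩
      have := key (Pi.single j (-1))
      rw [hp] at this
      rw [abs_of_nonneg h] at hS
      linarith

theorem Piece.card_gens (P : Piece d) : P.gens.card = d := by
  have h : Module.finrank ℝ (latSpan P.gens) = P.gens.card := by
    have := finrank_span_eq_card (R := ℝ) (b := fun i : P.gens => latVec (i : Fin d → ℤ)) P.indep
    rw [Fintype.card_coe] at this
    rw [← this, latSpan, Set.image_eq_range]
    rfl
  rw [← h, P.span_eq_top, finrank_top, Module.finrank_fintype_fun_eq_card, Fintype.card_fin]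

theorem X_pow_dvd_piecePS (P : Piece d) (v : Fin d → ℝ) (m : Fin d → ℤ) {e : ℕ}
    (he : ∀ b ∈ P.boxPoints v, (e : ℤ) ≤ P.expo m b) :
    (PowerSeries.X : PowerSeries ℂ) ^ e ∣ piecePS P v m := by
  refine Finset.dvd_sum fun b hb => Dvd.dvd.mul_right (Dvd.dvd.mul_left ?_ _) _
  exact pow_dvd_pow _ (by have := he b hb; omega)

open scoped ENNReal in
theorem wnorm_piecePS_le (P : Piece d) (v : Fin d → ℝ) (m : Fin d → ℤ) {e : ℕ}
    (he : ∀ b ∈ P.boxPoints v, (e : ℤ) ≤ P.expo m b) {ρ : ℝ≥0∞} (hρ : ρ < 1) :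
    wnorm ρ (piecePS P v m) ≤ (P.boxPoints v).card * (ρ ^ e * ((1 - ρ)⁻¹) ^ d) := by
  rw [piecePS, ← nsmul_eq_mul, ← Finset.sum_const]
  refine (wnorm_sum_le _ _ _).trans (Finset.sum_le_sum fun b hb => ?_)
  refine (wnorm_mul_le _ _ _).trans (mul_le_mul' ((wnorm_mul_le _ _ _).trans ?_) ?_)
  · rw [wnorm_C, wnorm_X_pow, enorm_eq_nnnorm, nnnorm_zpow]
    simp only [nnnorm_neg, nnnorm_one, one_zpow, ENNReal.coe_one, one_mul]
    exact pow_le_pow_of_le_one zero_le hρ.le (by have := he b hb; omega)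
  · refine (wnorm_prod_le _ _ _).trans ?_
    refine (Finset.prod_le_prod' fun i _ => wnorm_inv_one_add_le hρ _).trans ?_
    rw [Finset.prod_const, P.card_gens]

/-! ### Bounds for the total contribution of each `m` -/

section Family

variable {κ : Type} [Fintype κ] {P : κ → Piece d} {bad : Finset (Submodule ℝ (Fin d → ℝ))}

open scoped ENNReal in
/-- The contributions to the elliptic genus become divisible by high powers of `q`. -/
theorem exists_contribution_bound (hbad : ∀ B ∈ bad, B ≠ ⊤)
    (hv : ∀ v, (∀ B ∈ bad, v ∉ B) → ∀ k, ∀ i ∈ (P k).gens, co (P k).gens i v ≠ 0)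
    {s : (Fin d → ℤ) → PowerSeries ℂ}
    (hs : ∀ v, (∀ B ∈ bad, v ∉ B) → ∀ m, s m = ∑ k, piecePS (P k) v m) :
    ∃ c : ℝ, 0 < c ∧ ∃ K : ℕ, ∀ m, (PowerSeries.X : PowerSeries ℂ) ^ ⌈c * absSum m⌉₊ ∣ s m ∧
      ∀ ρ : ℝ≥0∞, ρ < 1 → wnorm ρ (s m) ≤ K * (ρ ^ ⌈c * absSum m⌉₊ * ((1 - ρ)⁻¹) ^ d) := by
  obtain ⟨V, hV, hV'⟩ := exists_directions hbad
  have h1 : ∀ᶠ δ : ℝ in 𝓝[>] 0, ∀ v ∈ V, ∀ k, ∀ b ∈ (P k).boxPoints v, ∀ m : Fin d → ℤ,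
      δ * -pairing m v ≤ (P k).expo m b := by
    rw [eventually_all_finset]
    intro v hvV
    rw [eventually_all]
    exact fun k => (P k).eventually_le_expo (hv v (hV v hvV) k)
  obtain ⟨δ, hδ, hδ0⟩ := (h1.and self_mem_nhdsWithin).exists
  have hδ0 : 0 < δ := hδ0
  refine ⟨δ * (2 * ((d : ℝ) + 1))⁻¹, by positivity, ∑ v ∈ V, ∑ k, ((P k).boxPoints v).card, fun m => ?_⟩
  -- The total `s m` is the same for all generic vectors, so it is estimated with a vector adapted
  -- to `m`; the constants `δ` and `K` serve the whole finite set `V`.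
  obtain ⟨v, hvV, hvm⟩ := hV' m
  have he : ∀ k, ∀ b ∈ (P k).boxPoints v,
      (⌈δ * (2 * ((d : ℝ) + 1))⁻¹ * absSum m⌉₊ : ℤ) ≤ (P k).expo m b := by
    intro k b hb
    have h2 := hδ v hvV k b hb m
    have h3 := mul_le_mul_of_nonneg_left hvm hδ0.le
    have h4 : ⌈δ * (2 * ((d : ℝ) + 1))⁻¹ * absSum m⌉₊ ≤ ((P k).expo m b).toNat := by
      rw [Nat.ceil_le]
      have h5 := (P k).expo_nonneg m hb
      have h6 : (((P k).expo m b).toNat : ℝ) = (P k).expo m b := by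
        exact_mod_cast Int.toNat_of_nonneg h5
      rw [h6]
      linarith
    have := (P k).expo_nonneg m hb
    omega
  rw [hs v (hV v hvV) m]
  refine ⟨Finset.dvd_sum fun k _ => X_pow_dvd_piecePS _ _ _ (he k), fun ρ hρ => ?_⟩
  refine (wnorm_sum_le _ _ _).trans ((Finset.sum_le_sum fun k _ =>
    wnorm_piecePS_le _ _ _ (he k) hρ).trans ?_)
  rw [← Finset.sum_mul]
  refine mul_le_mul' ?_ le_rfl
  rw [← Nat.cast_sum]
  exact_mod_cast Finset.single_le_sum (f := fun v => ∑ k, ((P k).boxPoints v).card)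
    (fun _ _ => Nat.zero_le _) hvV

/-- The contributions computed with different generic vectors agree. -/
theorem piecePS_sum_unique {deg : (Fin d → ℤ) → ℤ} (F : Fan d) (hF : F.IsComplete)
    (hdeg : F.IsDegree deg)
    (hv : ∀ v, (∀ B ∈ bad, v ∉ B) →
      ∀ x, ∑ k, Set.indicator (halfOpen (P k).gens v) (1 : (Fin d → ℝ) → ℤ) x = 1)
    (hP : ∀ k n, latVec n ∈ latHull (P k).gens → deg n = (P k).form ⬝ᵥ n)
    {v : Fin d → ℝ} (hvb : ∀ B ∈ bad, v ∉ B) (m : Fin d → ℤ) :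
    ∑ C ∈ F.cones, (-1) ^ (d - coneDim C) * coneSeries deg (-1) m C =
      ((∑ k, piecePS (P k) v m : PowerSeries ℂ) : LaurentSeries ℂ) := by
  rw [F.sum_coneSeries_eq hF hdeg P (hv v hvb) hP m,
    Finset.sum_congr rfl fun k _ => pieceSeries_eq_coe (P k) v m]
  exact (map_sum (HahnSeries.ofPowerSeries ℤ ℂ) _ _).symm

end Family

/-! ### Coefficientwise sums over the dual lattice -/

section FormalSums

open scoped ENNReal

variable {s : (Fin d → ℤ) → PowerSeries ℂ} {c : ℝ}

theorem absSum_le_of_coeff_ne_zero (hc : 0 < c) {f : PowerSeries ℂ} {m : Fin d → ℤ}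
    (h : (PowerSeries.X : PowerSeries ℂ) ^ ⌈c * absSum m⌉₊ ∣ f) {n : ℕ}
    (hn : PowerSeries.coeff n f ≠ 0) : absSum m ≤ ⌈(n : ℝ) / c⌉₊ := by
  have h1 : ⌈c * absSum m⌉₊ ≤ n := by
    by_contra hlt
    exact hn (PowerSeries.X_pow_dvd_iff.1 h n (not_le.1 hlt))
  rw [Nat.ceil_le] at h1
  have : (absSum m : ℝ) ≤ n / c := by rw [le_div_iff₀ hc]; linarith
  exact_mod_cast this.trans (Nat.le_ceil _)

theorem finite_support_coeff (hc : 0 < c)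
    (hs : ∀ m, (PowerSeries.X : PowerSeries ℂ) ^ ⌈c * absSum m⌉₊ ∣ s m) (n : ℕ) :
    (Function.support fun m => PowerSeries.coeff n (s m)).Finite :=
  (finite_absSum_le _).subset fun m hm => absSum_le_of_coeff_ne_zero hc (hs m) hm

/-- The coefficientwise sum of a family of power series. -/
def formalSum (s : (Fin d → ℤ) → PowerSeries ℂ) : PowerSeries ℂ :=
  PowerSeries.mk fun k => ∑ᶠ m, PowerSeries.coeff k (s m)

/-- Only finitely many `m` enter each coefficient, so the sum over `m` commutes with the finite
convolution. This lets the power of `G` be taken out of the sum. -/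
theorem formalSum_mul (hc : 0 < c)
    (hs : ∀ m, (PowerSeries.X : PowerSeries ℂ) ^ ⌈c * absSum m⌉₊ ∣ s m) (g : PowerSeries ℂ) :
    formalSum (fun m => s m * g) = formalSum s * g := by
  ext n
  rw [PowerSeries.coeff_mul, formalSum, PowerSeries.coeff_mk]
  simp_rw [PowerSeries.coeff_mul]
  rw [finsum_sum_comm]
  · refine Finset.sum_congr rfl fun p _ => ?_
    rw [formalSum, PowerSeries.coeff_mk, finsum_mul' _ _ (finite_support_coeff hc hs p.1)]
  · intro p _
    exact (finite_support_coeff hc hs p.1).subset fun m hm h => hm (by simp [h])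

theorem wnorm_formalSum_le (hc : 0 < c)
    (hs : ∀ m, (PowerSeries.X : PowerSeries ℂ) ^ ⌈c * absSum m⌉₊ ∣ s m) (ρ : ℝ≥0∞) :
    wnorm ρ (formalSum s) ≤ ∑' m, wnorm ρ (s m) := by
  simp only [wnorm]
  rw [ENNReal.tsum_comm]
  refine ENNReal.tsum_le_tsum fun n => ?_
  rw [ENNReal.tsum_mul_right, formalSum, PowerSeries.coeff_mk,
    ← tsum_eq_finsum (L := .unconditional _) (finite_support_coeff hc hs n)]
  gcongr
  exact enorm_tsum_le_tsum_enorm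

theorem evalPS_formalSum (hc : 0 < c)
    (hs : ∀ m, (PowerSeries.X : PowerSeries ℂ) ^ ⌈c * absSum m⌉₊ ∣ s m) {q : ℂ}
    (h : ∑' m, wnorm ‖q‖ₑ (s m) < ∞) :
    evalPS q (formalSum s) = ∑' m, evalPS q (s m) := by
  have hsum : Summable (Function.uncurry fun (m : Fin d → ℤ) (n : ℕ) =>
      PowerSeries.coeff n (s m) * q ^ n) := by
    refine Summable.of_norm (tsum_enorm_ne_top_iff_summable_norm.1 (ne_of_lt (lt_of_eq_of_lt ?_ h)))
    rw [ENNReal.tsum_prod']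
    simp [wnorm, enorm_mul, enorm_pow]
  simp only [evalPS]
  rw [← hsum.tsum_comm]
  refine tsum_congr fun n => ?_
  rw [formalSum, PowerSeries.coeff_mk, ← tsum_eq_finsum (L := .unconditional _) (finite_support_coeff hc hs n),
    tsum_mul_right]

end FormalSums

end Estimates

end ToricGenus

end

noncomputable section

namespace ToricGenus

/-! ### The kernel with multipliers 1 and -1 and its modular behaviour -/

section Kernel

open Filter Topology Complex

/-- The exponential `exp(2πiz)`. -/
def ex (z : ℂ) : ℂ := exp (2 * Real.pi * I * z)

theorem ex_add (z w : ℂ) : ex (z + w) = ex z * ex w := by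
  rw [ex, mul_add, exp_add, ex, ex]

theorem ex_zero : ex 0 = 1 := by simp [ex]

theorem ex_ne_zero (z : ℂ) : ex z ≠ 0 := exp_ne_zero _

theorem ex_neg (z : ℂ) : ex (-z) = (ex z)⁻¹ := by rw [ex, mul_neg, exp_neg, ex]

theorem ex_sub (z w : ℂ) : ex (z - w) = ex z / ex w := by
  rw [sub_eq_add_neg, ex_add, ex_neg, div_eq_mul_inv]

theorem ex_sum {ι : Type*} (s : Finset ι) (f : ι → ℂ) : ex (∑ i ∈ s, f i) = ∏ i ∈ s, ex (f i) := by
  simp only [ex]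
  rw [Finset.mul_sum, exp_sum]

theorem ex_int (n : ℤ) : ex n = 1 := by
  rw [ex, exp_eq_one_iff]
  exact ⟨n, by ring⟩

theorem ex_int_mul (n : ℤ) (z : ℂ) : ex (n * z) = ex z ^ n := by
  rw [ex, ex, ← exp_int_mul]
  congr 1
  ring

theorem norm_ex (z : ℂ) : ‖ex z‖ = Real.exp (-(2 * Real.pi * z.im)) := by
  rw [ex, norm_exp]
  congr 1
  simp

theorem norm_ex_lt_one {z : ℂ} (h : 0 < z.im) : ‖ex z‖ < 1 := by
  rw [norm_ex, Real.exp_lt_one_iff, neg_lt_zero]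
  positivity

theorem ex_eq_one_iff (z : ℂ) : ex z = 1 ↔ ∃ n : ℤ, z = n := by
  rw [ex, exp_eq_one_iff]
  refine exists_congr fun n => ⟨fun h => ?_, fun h => by rw [h]; ring⟩
  have : (2 * Real.pi * I : ℂ) ≠ 0 := two_pi_I_ne_zero
  exact mul_left_cancel₀ this (by rw [h]; ring)

theorem differentiable_ex : Differentiable ℂ ex := by
  unfold ex
  fun_prop

/-- The odd rational function `(1 + w) / (2 (1 - w))`. -/
def cayley (w : ℂ) : ℂ := (1 + w) / (1 - w) / 2

/-- At the pole `w = 1` both sides are 0 by the convention for division by zero, so the functional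
equations of `ker` hold at every `z`. -/
theorem cayley_inv {w : ℂ} (hw : w ≠ 0) : cayley w⁻¹ = -cayley w := by
  by_cases h : w = 1
  · simp [h, cayley]
  · have h1 : 1 - w ≠ 0 := sub_ne_zero.2 (Ne.symm h)
    have h2 : 1 - w⁻¹ ≠ 0 := sub_ne_zero.2 fun h' => h (by rw [← inv_inv w, ← h', inv_one])
    rw [cayley, cayley]
    have h3 : w - 1 ≠ 0 := sub_ne_zero.2 h
    field_simp
    ring

theorem cayley_sub_half {w : ℂ} (h : w ≠ 1) : cayley w - 1 / 2 = w / (1 - w) := by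
  have h1 : 1 - w ≠ 0 := sub_ne_zero.2 (Ne.symm h)
  rw [cayley]
  field_simp
  ring

theorem norm_cayley_sub_half_le {w : ℂ} {r : ℝ} (hr : r < 1) (hw : ‖w‖ ≤ r) :
    ‖cayley w - 1 / 2‖ ≤ ‖w‖ * (1 - r)⁻¹ := by
  have h : w ≠ 1 := by
    rintro rfl
    rw [norm_one] at hw
    linarith
  rw [cayley_sub_half h, norm_div, div_eq_mul_inv]
  have h1 : 1 - r ≤ ‖1 - w‖ := by
    have := norm_sub_norm_le 1 w
    rw [norm_one] at this
    linarith
  gcongr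

/-- The alternating sum `∑ (-1)^l t q^l / (1 - t q^l)`. -/
def altSum (q t : ℂ) : ℂ := ∑' l : ℕ, (-1) ^ l * (cayley (t * q ^ l) - 1 / 2)

theorem summable_altSum {q : ℂ} (hq : ‖q‖ < 1) (t : ℂ) :
    Summable fun l : ℕ => (-1) ^ l * (cayley (t * q ^ l) - 1 / 2) := by
  have h1 : Tendsto (fun l : ℕ => ‖t * q ^ l‖) atTop (𝓝 0) := by
    have := (tendsto_pow_atTop_nhds_zero_of_norm_lt_one hq).const_mul t
    simpa using this.norm
  refine Summable.of_norm_bounded_eventually_nat (g := fun l => ‖t‖ * ‖q‖ ^ l * (1 - 1 / 2)⁻¹)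
    (((summable_geometric_of_lt_one (norm_nonneg _) hq).mul_left _).mul_right _) ?_
  filter_upwards [h1.eventually_lt_const (show (0 : ℝ) < 1 / 2 by norm_num)] with l hl
  rw [norm_mul, norm_pow, norm_neg, norm_one, one_pow, one_mul, ← norm_pow, ← norm_mul]
  exact norm_cayley_sub_half_le (by norm_num) hl.le

theorem altSum_eq {q : ℂ} (hq : ‖q‖ < 1) (t : ℂ) :
    altSum q t = cayley t - 1 / 2 - altSum q (t * q) := by
  rw [altSum, (summable_altSum hq t).tsum_eq_zero_add, altSum, sub_eq_add_neg (cayley t - 1 / 2),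
    ← tsum_neg]
  congr 1
  · simp
  · refine tsum_congr fun l => ?_
    rw [pow_succ (-1 : ℂ), pow_succ' q, mul_assoc t]
    ring

theorem differentiableOn_altSum {q : ℂ} (hq : ‖q‖ < 1) :
    DifferentiableOn ℂ (altSum q) (Metric.ball 0 1) := by
  intro t ht
  rw [mem_ball_zero_iff] at ht
  obtain ⟨r, hr, hr1⟩ := exists_between ht
  have h0 : 0 < r := (norm_nonneg t).trans_lt hr
  have hb : ∀ (l : ℕ), ∀ w ∈ Metric.ball (0 : ℂ) r, ‖w * q ^ l‖ ≤ r * ‖q‖ ^ l := by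
    intro l w hw
    rw [mem_ball_zero_iff] at hw
    rw [norm_mul, norm_pow]
    gcongr
  have hb' : ∀ l : ℕ, r * ‖q‖ ^ l ≤ r := fun l =>
    mul_le_of_le_one_right h0.le (pow_le_one₀ (norm_nonneg _) hq.le)
  have h : DifferentiableOn ℂ (altSum q) (Metric.ball 0 r) := by
    refine differentiableOn_tsum_of_summable_norm (u := fun l => r * ‖q‖ ^ l * (1 - r)⁻¹)
      (((summable_geometric_of_lt_one (norm_nonneg _) hq).mul_left _).mul_right _) (fun l => ?_)
      Metric.isOpen_ball fun l w hw => ?_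
    · unfold cayley
      intro w hw
      have : 1 - w * q ^ l ≠ 0 := by
        intro h
        have h2 := (hb l w hw).trans (hb' l)
        rw [← sub_eq_zero.1 h, norm_one] at h2
        linarith
      refine DifferentiableAt.differentiableWithinAt ?_
      fun_prop (disch := assumption)
    · rw [norm_mul, norm_pow, norm_neg, norm_one, one_pow, one_mul]
      refine (norm_cayley_sub_half_le hr1 ((hb l w hw).trans (hb' l))).trans ?_
      have := hb l w hw
      have h3 : 0 ≤ (1 - r)⁻¹ := inv_nonneg.2 (by linarith)
      gcongr
  exact (h.differentiableAt (Metric.isOpen_ball.mem_nhds (by simpa using hr))).differentiableWithinAt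

/-- The meromorphic function with simple poles at the lattice points and multipliers `1`, `-1`. -/
def ker (τ z : ℂ) : ℂ := 1 / 2 + altSum (ex τ) (ex z) + altSum (ex τ) (ex τ / ex z)

variable {τ : ℂ}

theorem ker_add_one (τ z : ℂ) : ker τ (z + 1) = ker τ z := by
  have : ex 1 = 1 := by exact_mod_cast ex_int 1
  simp only [ker, ex_add, this, mul_one]

/-- The shift moves the two alternating sums by one term in opposite directions. Each changes sign,
and the split-off terms cancel because `cayley` is odd. -/
theorem ker_add_tau (hτ : 0 < τ.im) (z : ℂ) : ker τ (z + τ) = -ker τ z := by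
  have hq := norm_ex_lt_one hτ
  have h1 := altSum_eq hq (ex z)
  have h2 := altSum_eq hq (ex z)⁻¹
  rw [cayley_inv (ex_ne_zero z)] at h2
  have h3 : ex τ / (ex z * ex τ) = (ex z)⁻¹ := by
    field_simp [ex_ne_zero z, ex_ne_zero τ]
  rw [ker, ker, ex_add, h3, h2, h1, div_eq_inv_mul (ex τ)]
  ring

theorem ker_neg (hτ : 0 < τ.im) (z : ℂ) : ker τ (-z) = -ker τ z := by
  have hq := norm_ex_lt_one hτ
  have h1 := altSum_eq hq (ex z)
  have h2 := altSum_eq hq (ex z)⁻¹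
  rw [cayley_inv (ex_ne_zero z)] at h2
  rw [ker, ker, ex_neg, div_inv_eq_mul, h2, h1, div_eq_inv_mul (ex τ), mul_comm (ex τ) (ex z)]
  ring

/-- In the strip `|Im z| < Im τ` both alternating sums on the right are evaluated inside the unit
disc, so all poles there come from the first term. -/
theorem ker_eq (hτ : 0 < τ.im) (z : ℂ) :
    ker τ z = cayley (ex z) - altSum (ex τ) (ex (z + τ)) + altSum (ex τ) (ex (τ - z)) := by
  rw [ker, altSum_eq (norm_ex_lt_one hτ) (ex z), ex_add, ex_sub]
  ring

theorem ker_add_int (τ z : ℂ) (n : ℤ) : ker τ (z + n) = ker τ z := by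
  simp only [ker, ex_add, ex_int, mul_one]

theorem apply_add_lattice {ψ : ℂ → ℂ} (h1 : ∀ z, ψ (z + 1) = ψ z) (h2 : ∀ z, ψ (z + τ) = -ψ z)
    (z : ℂ) (m n : ℤ) : ψ (z + (n * τ + m)) = (-1) ^ n * ψ z := by
  have hm : ∀ z, ψ (z + m) = ψ z := by
    intro z
    have hp : Function.Periodic ψ (m * (1 : ℂ)) := Function.Periodic.int_mul (f := ψ) h1 m
    rw [mul_one] at hp
    exact hp z
  have hn : ∀ n : ℤ, ψ (z + n * τ) = (-1) ^ n * ψ z := by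
    intro n
    induction n using Int.induction_on with
    | zero => simp
    | succ n ih =>
      rw [Int.cast_add, Int.cast_one, add_mul, one_mul, ← add_assoc, h2, ih,
        zpow_add_one₀ (by norm_num)]
      ring
    | pred n ih =>
      have := h2 (z + ((-n - 1 : ℤ) : ℂ) * τ)
      have h2 : z + ((-n - 1 : ℤ) : ℂ) * τ + τ = z + ((-n : ℤ) : ℂ) * τ := by push_cast; ring
      rw [h2, ih] at this
      rw [← neg_eq_iff_eq_neg] at this
      rw [← this, zpow_sub_one₀ (by norm_num)]
      norm_num
  rw [← add_assoc, hm, hn]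

theorem ker_add_lattice (hτ : 0 < τ.im) (z : ℂ) (m n : ℤ) :
    ker τ (z + (n * τ + m)) = (-1) ^ n * ker τ z :=
  apply_add_lattice (ker_add_one τ) (ker_add_tau hτ) z m n

theorem ker_add_int_mul_tau (hτ : 0 < τ.im) (z : ℂ) (n : ℤ) :
    ker τ (z + n * τ) = (-1) ^ n * ker τ z := by
  simpa using ker_add_lattice hτ z 0 n

theorem differentiableAt_altSum_ex (hτ : 0 < τ.im) {z : ℂ} (hz : 0 < z.im) :
    DifferentiableAt ℂ (altSum (ex τ)) (ex z) :=
  (differentiableOn_altSum (norm_ex_lt_one hτ)).differentiableAt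
    (Metric.isOpen_ball.mem_nhds (by simpa using norm_ex_lt_one hz))

theorem differentiableAt_ker_sub_cayley (hτ : 0 < τ.im) {z : ℂ} (h1 : -τ.im < z.im)
    (h2 : z.im < τ.im) : DifferentiableAt ℂ (fun z => ker τ z - cayley (ex z)) z := by
  have h3 : (fun z => ker τ z - cayley (ex z)) =
      fun z => altSum (ex τ) (ex (τ - z)) - altSum (ex τ) (ex (z + τ)) := by
    funext z
    rw [ker_eq hτ]
    ring
  have e := differentiable_ex
  rw [h3]
  refine DifferentiableAt.sub ?_ ?_
  · exact DifferentiableAt.comp z (g := altSum (ex τ)) (f := fun z => ex (τ - z))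
      (differentiableAt_altSum_ex hτ (z := τ - z) (by simpa using h2))
      (by fun_prop)
  · exact DifferentiableAt.comp z (g := altSum (ex τ)) (f := fun z => ex (z + τ))
      (differentiableAt_altSum_ex hτ (by simp; linarith)) (by fun_prop)

/-- A multiple of `τ` moves `z` into the strip around the real axis, where the only possible poles
are the integers. -/
theorem differentiableAt_ker (hτ : 0 < τ.im) {z : ℂ} (hz : ∀ m n : ℤ, z ≠ n * τ + m) :
    DifferentiableAt ℂ (ker τ) z := by
  obtain ⟨n, hn⟩ : ∃ n : ℤ, -τ.im < (z - n * τ).im ∧ (z - n * τ).im < τ.im := by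
    refine ⟨⌊z.im / τ.im⌋, ?_⟩
    have h1 := Int.floor_le (z.im / τ.im)
    have h2 := Int.lt_floor_add_one (z.im / τ.im)
    rw [le_div_iff₀ hτ] at h1
    rw [div_lt_iff₀ hτ] at h2
    have : (z - ⌊z.im / τ.im⌋ * τ).im = z.im - ⌊z.im / τ.im⌋ * τ.im := by simp
    rw [this]
    constructor <;> linarith
  set w := z - n * τ with hw
  have h1 : DifferentiableAt ℂ (ker τ) w := by
    have hc : DifferentiableAt ℂ (fun z => cayley (ex z)) w := by
      have hne : 1 - ex w ≠ 0 := by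
        intro h
        obtain ⟨m, hm⟩ := (ex_eq_one_iff w).1 (sub_eq_zero.1 h).symm
        exact hz m n (by rw [← hm, hw]; ring)
      have e := differentiable_ex
      unfold cayley
      fun_prop (disch := assumption)
    have := (differentiableAt_ker_sub_cayley hτ hn.1 hn.2).add hc
    refine this.congr_of_eventuallyEq (Eventually.of_forall fun z => ?_)
    simp
  have h2 : ker τ = fun z => (-1) ^ n * ker τ (z - n * τ) := by
    funext z
    rw [← ker_add_int_mul_tau hτ, sub_add_cancel]
  rw [h2]
  refine DifferentiableAt.const_mul ?_ _
  exact DifferentiableAt.comp z (g := ker τ) (f := fun z => z - n * τ) h1 (by fun_prop)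

theorem tendsto_mul_cayley_ex : Tendsto (fun z => z * cayley (ex z)) (𝓝[≠] 0)
    (𝓝 (I / (2 * Real.pi))) := by
  have h1 : Tendsto (fun z => z⁻¹ * (ex z - 1)) (𝓝[≠] 0) (𝓝 (2 * Real.pi * I)) := by
    have hd : HasDerivAt ex (2 * Real.pi * I) 0 := by
      have := ((hasDerivAt_id (0 : ℂ)).const_mul (2 * Real.pi * I)).cexp
      simp only [id, mul_zero, exp_zero, one_mul, mul_one] at this
      exact this
    have := hd.tendsto_slope
    refine this.congr fun z => ?_
    rw [slope_def_field, ex_zero, sub_zero, div_eq_inv_mul]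
  have h2 : Tendsto (fun z => (1 + ex z) / 2) (𝓝[≠] 0) (𝓝 1) := by
    have : Continuous fun z => (1 + ex z) / 2 := by
      have := differentiable_ex.continuous
      fun_prop
    have h := (this.tendsto 0).mono_left (nhdsWithin_le_nhds (s := {0}ᶜ))
    rw [ex_zero] at h
    norm_num at h
    exact h
  have h3 := (h1.neg.inv₀ (neg_ne_zero.2 two_pi_I_ne_zero)).mul h2
  have h4 : (-(2 * Real.pi * I))⁻¹ * 1 = (I / (2 * Real.pi) : ℂ) := by
    have : (Real.pi : ℂ) ≠ 0 := by exact_mod_cast Real.pi_ne_zero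
    have hI := I_ne_zero
    rw [mul_one]
    field_simp
    rw [I_sq]
  rw [h4] at h3
  refine h3.congr fun z => ?_
  rw [cayley]
  simp only [mul_inv, inv_inv, ← mul_neg, neg_sub, div_eq_mul_inv]
  ring

theorem tendsto_mul_ker (hτ : 0 < τ.im) : Tendsto (fun z => z * ker τ z) (𝓝[≠] 0)
    (𝓝 (I / (2 * Real.pi))) := by
  have h1 : Tendsto (fun z => z * (ker τ z - cayley (ex z))) (𝓝[≠] 0) (𝓝 0) := by
    have hc : ContinuousAt (fun z => z * (ker τ z - cayley (ex z))) 0 :=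
      continuousAt_id.mul (differentiableAt_ker_sub_cayley hτ (z := 0) (by simpa) (by simpa)).continuousAt
    have := hc.tendsto.mono_left (nhdsWithin_le_nhds (s := {0}ᶜ))
    simpa using this
  have := h1.add tendsto_mul_cayley_ex
  rw [zero_add] at this
  exact this.congr fun z => by ring

theorem exists_lattice_sub (hτ : 0 < τ.im) (z : ℂ) : ∃ m n : ℤ, ∃ x ∈ Set.Icc (0 : ℝ) 1,
    ∃ y ∈ Set.Icc (0 : ℝ) 1, z = x + y * τ + (n * τ + m) := by
  refine ⟨⌊z.re - z.im / τ.im * τ.re⌋, ⌊z.im / τ.im⌋, Int.fract (z.re - z.im / τ.im * τ.re),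
    ⟨Int.fract_nonneg _, (Int.fract_lt_one _).le⟩, Int.fract (z.im / τ.im),
    ⟨Int.fract_nonneg _, (Int.fract_lt_one _).le⟩, ?_⟩
  have hx := Int.fract_add_floor (z.re - z.im / τ.im * τ.re)
  have hy := Int.fract_add_floor (z.im / τ.im)
  generalize Int.fract (z.re - z.im / τ.im * τ.re) = x at *
  generalize ⌊z.re - z.im / τ.im * τ.re⌋ = m at *
  generalize Int.fract (z.im / τ.im) = y at *
  generalize ⌊z.im / τ.im⌋ = n at *
  have hy' : (y + n) * τ.im = z.im := by rw [hy]; field_simp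
  refine Complex.ext ?_ ?_
  · simp
    rw [← hy] at hx
    linarith
  · simp
    linarith

/-- A function with multipliers `1` and `-1` without poles vanishes. -/
theorem eq_zero_of_periodic (hτ : 0 < τ.im) {ψ : ℂ → ℂ} (h1 : ∀ z, ψ (z + 1) = ψ z)
    (h2 : ∀ z, ψ (z + τ) = -ψ z) (hodd : ∀ z, ψ (-z) = -ψ z)
    (hd : ∀ z, (∀ m n : ℤ, z ≠ n * τ + m) → DifferentiableAt ℂ ψ z)
    (h0 : Tendsto (fun z => z * ψ z) (𝓝[≠] 0) (𝓝 0)) (z : ℂ) : ψ z = 0 := by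
  have hψ0 : ψ 0 = 0 := by
    have := hodd 0
    rw [neg_zero] at this
    exact self_eq_neg.1 this
  -- Near 0 there is no other lattice point and `ψ z = o(1/z)`, so the singularity is removable.
  -- Oddness forces the limit to be 0, which is the value `ψ 0`.
  have hd0 : DifferentiableAt ℂ ψ 0 := by
    have hs : Metric.ball (0 : ℂ) (min 1 τ.im) ∈ 𝓝 0 := Metric.ball_mem_nhds _ (by positivity)
    have hds : DifferentiableOn ℂ ψ (Metric.ball (0 : ℂ) (min 1 τ.im) \ {0}) := by
      rintro z ⟨hz, hz0⟩
      refine (hd z fun m n h => hz0 ?_).differentiableWithinAt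
      rw [mem_ball_zero_iff, lt_min_iff] at hz
      have him : z.im = n * τ.im := by rw [h]; simp
      have hn : n = 0 := by
        have h3 := (abs_im_le_norm z).trans_lt hz.2
        rw [him, abs_mul, abs_of_pos hτ] at h3
        have h4 : |(n : ℝ)| < 1 := by
          by_contra h5
          nlinarith
        exact Int.abs_lt_one_iff.1 (by exact_mod_cast h4)
      have hm : m = 0 := by
        have h3 := hz.1
        rw [h, hn] at h3
        simp only [Int.cast_zero, zero_mul, zero_add, norm_intCast] at h3
        exact Int.abs_lt_one_iff.1 (by exact_mod_cast h3)
      simp [h, hn, hm]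
    have ho : (fun z => ψ z - ψ 0) =o[𝓝[≠] 0] fun z => (z - 0)⁻¹ := by
      simp only [hψ0, sub_zero]
      rw [Asymptotics.isLittleO_iff_tendsto']
      · refine h0.congr fun z => ?_
        rw [div_inv_eq_mul, mul_comm]
      · filter_upwards [self_mem_nhdsWithin] with z hz h
        exact absurd (inv_eq_zero.1 h) hz
    have hu := (differentiableOn_update_limUnder_of_isLittleO hs hds ho).differentiableAt hs
    set L := limUnder (𝓝[≠] 0) ψ
    have hL : Tendsto ψ (𝓝[≠] 0) (𝓝 L) := by
      have := continuousAt_update_same.1 hu.continuousAt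
      exact this
    have hneg : Tendsto (fun z : ℂ => -z) (𝓝[≠] 0) (𝓝[≠] 0) := by
      refine tendsto_nhdsWithin_of_tendsto_nhds_of_eventually_within _ ?_ ?_
      · have := (continuous_neg (G := ℂ)).tendsto 0
        rw [neg_zero] at this
        exact this.mono_left nhdsWithin_le_nhds
      · filter_upwards [self_mem_nhdsWithin] with z hz
        exact neg_ne_zero.2 hz
    have hL0 : L = 0 := by
      have h3 := hL.comp hneg
      have h4 : Tendsto (ψ ∘ fun z => -z) (𝓝[≠] 0) (𝓝 (-L)) :=
        hL.neg.congr fun z => (hodd z).symm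
      exact self_eq_neg.1 (tendsto_nhds_unique h3 h4)
    have hself := Function.update_eq_self (0 : ℂ) ψ
    rw [hψ0] at hself
    rwa [hL0, hself] at hu
  have hlat := apply_add_lattice (τ := τ) h1 h2
  have hdiff : Differentiable ℂ ψ := by
    intro z
    by_cases hz : ∀ m n : ℤ, z ≠ n * τ + m
    · exact hd z hz
    · push Not at hz
      obtain ⟨m, n, rfl⟩ := hz
      have h3 : ψ = fun z => (-1) ^ n * ψ (z - (n * τ + m)) := by
        funext z
        rw [← hlat, sub_add_cancel]
      rw [h3]
      refine DifferentiableAt.const_mul ?_ _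
      refine DifferentiableAt.comp _ (g := ψ) (f := fun z => z - (n * τ + m)) ?_ (by fun_prop)
      rwa [sub_self]
  -- The multipliers have absolute value 1, so a bound on one period parallelogram is global and
  -- Liouville's theorem applies.
  have hbdd : Bornology.IsBounded (Set.range ψ) := by
    have hK : IsCompact ((fun p : ℝ × ℝ => ψ (p.1 + p.2 * τ)) ''
        (Set.Icc (0 : ℝ) 1 ×ˢ Set.Icc (0 : ℝ) 1)) := by
      refine (isCompact_Icc.prod isCompact_Icc).image ?_
      have := hdiff.continuous
      fun_prop
    obtain ⟨C, hC⟩ := hK.isBounded.exists_norm_le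
    refine (isBounded_iff_forall_norm_le).2 ⟨C, ?_⟩
    rintro _ ⟨z, rfl⟩
    obtain ⟨m, n, x, hx, y, hy, rfl⟩ := exists_lattice_sub hτ z
    rw [hlat, norm_mul, norm_zpow, norm_neg, norm_one, one_zpow, one_mul]
    exact hC _ ⟨(x, y), ⟨hx, hy⟩, rfl⟩
  rw [hdiff.apply_eq_apply_of_bounded hbdd z 0, hψ0]

/-- The modular transformation behaviour of `ker`. -/
theorem ker_modular (hτ : 0 < τ.im) {a b c e : ℤ} (hdet : a * e - b * c = 1) (hc : Even c)
    {τ' : ℂ} (hτ' : 0 < τ'.im) (hw0 : (c * τ + e : ℂ) ≠ 0)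
    (hw : (c * τ + e : ℂ) * τ' = a * τ + b) (z : ℂ) :
    ker τ' (z / (c * τ + e)) = (c * τ + e) * ker τ z := by
  have hdet' : (a * e - b * c : ℂ) = 1 := by exact_mod_cast hdet
  -- The parity of `c` and `e` makes the multipliers agree: `1/w = -c τ' + a` has multiplier
  -- `(-1)^(-c) = 1`, and `τ/w = e τ' - b` has multiplier `(-1)^e = -1`.
  have he : Odd e := by
    have h : Odd (a * e) := by
      rw [show a * e = b * c + 1 by linarith]
      exact (hc.mul_left b).add_one
    exact (Int.odd_mul.1 h).2
  set w : ℂ := c * τ + e with hwdef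
  rw [← sub_eq_zero]
  refine eq_zero_of_periodic hτ (ψ := fun z => ker τ' (z / w) - w * ker τ z) ?_ ?_ ?_ ?_ ?_ z
  · intro z
    have h : (z + 1) / w = z / w + ((-c : ℤ) * τ' + a) := by
      field_simp
      push_cast
      rw [hwdef] at hw ⊢
      linear_combination c * hw - hdet'
    rw [h, ker_add_lattice hτ', ker_add_one, hc.neg.neg_one_zpow, one_mul]
  · intro z
    have h : (z + τ) / w = z / w + ((e : ℤ) * τ' + (-b : ℤ)) := by
      field_simp
      push_cast
      rw [hwdef] at hw ⊢
      linear_combination (-(e : ℂ)) * hw - τ * hdet'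
    rw [h, ker_add_lattice hτ', ker_add_tau hτ, he.neg_one_zpow]
    ring
  · intro z
    rw [neg_div, ker_neg hτ', ker_neg hτ]
    ring
  · intro z hz
    refine DifferentiableAt.sub ?_ ((differentiableAt_ker hτ hz).const_mul _)
    refine DifferentiableAt.comp z (g := ker τ') (f := fun z => z / w) ?_ (by fun_prop)
    refine differentiableAt_ker hτ' fun m n h => hz (n * b + m * e) (n * a + m * c) ?_
    rw [div_eq_iff hw0] at h
    rw [h]
    push_cast
    rw [hwdef] at hw ⊢
    linear_combination n * hw
  -- Both `(z/w) ker τ' (z/w)` and `z ker τ z` tend to `i/(2π)`, so the poles at 0 cancel.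
  · have h3 : Tendsto (fun z => z / w) (𝓝[≠] 0) (𝓝[≠] 0) := by
      refine tendsto_nhdsWithin_of_tendsto_nhds_of_eventually_within _ ?_ ?_
      · have : Continuous fun z => z / w := by fun_prop
        have := this.tendsto 0
        rw [zero_div] at this
        exact this.mono_left nhdsWithin_le_nhds
      · filter_upwards [self_mem_nhdsWithin] with z hz
        exact div_ne_zero hz hw0
    have h4 := (((tendsto_mul_ker hτ').comp h3).sub (tendsto_mul_ker hτ)).const_mul w
    rw [sub_self, mul_zero] at h4
    refine h4.congr fun z => ?_
    simp only [Function.comp]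
    field_simp

/-- Expand each term as a geometric series in `t q^l` and sum over `l` first; the double series
converges absolutely. -/
theorem hasSum_altSum {q t : ℂ} (hq : ‖q‖ < 1) (ht : ‖t‖ < 1) :
    HasSum (fun k : ℕ => t ^ (k + 1) / (1 + q ^ (k + 1))) (altSum q t) := by
  have hsum : Summable (Function.uncurry fun (l k : ℕ) => (-1 : ℂ) ^ l * (t * q ^ l) ^ (k + 1)) := by
    have h := (summable_geometric_of_lt_one (norm_nonneg _) hq).mul_of_nonneg
      (summable_geometric_of_lt_one (norm_nonneg _) ht) (fun _ => by positivity)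
      (fun _ => by positivity)
    refine Summable.of_norm_bounded h fun p => ?_
    obtain ⟨l, k⟩ := p
    simp only [Function.uncurry, norm_mul, norm_pow, norm_neg, norm_one, one_pow, one_mul]
    rw [mul_pow, ← pow_mul, mul_comm]
    refine mul_le_mul (pow_le_pow_of_le_one (norm_nonneg _) hq.le ?_)
      (pow_le_pow_of_le_one (norm_nonneg _) ht.le (Nat.le_succ k)) (by positivity) (by positivity)
    nlinarith
  have hk : ∀ k : ℕ, ∑' l : ℕ, (-1 : ℂ) ^ l * (t * q ^ l) ^ (k + 1) =
      t ^ (k + 1) / (1 + q ^ (k + 1)) := by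
    intro k
    have h1 : ‖-q ^ (k + 1)‖ < 1 := by
      rw [norm_neg, norm_pow]
      exact pow_lt_one₀ (norm_nonneg _) hq (Nat.succ_ne_zero k)
    have h2 : ∀ l : ℕ, (-1 : ℂ) ^ l * (t * q ^ l) ^ (k + 1) =
        t ^ (k + 1) * (-q ^ (k + 1)) ^ l := by
      intro l
      rw [mul_pow, neg_pow (q ^ (k + 1)), ← pow_mul, ← pow_mul, mul_comm l]
      ring
    rw [tsum_congr h2, tsum_mul_left, tsum_geometric_of_norm_lt_one h1, sub_neg_eq_add,
      div_eq_mul_inv]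
  have hl : ∀ l : ℕ, ∑' k : ℕ, (-1 : ℂ) ^ l * (t * q ^ l) ^ (k + 1) =
      (-1) ^ l * (cayley (t * q ^ l) - 1 / 2) := by
    intro l
    have h1 : ‖t * q ^ l‖ < 1 := by
      rw [norm_mul, norm_pow]
      exact (mul_le_of_le_one_right (norm_nonneg _)
        (pow_le_one₀ (norm_nonneg _) hq.le)).trans_lt ht
    have h2 : t * q ^ l ≠ 1 := by
      intro h
      rw [h, norm_one] at h1
      exact lt_irrefl _ h1
    simp only [pow_succ']
    rw [tsum_mul_left, tsum_mul_left, tsum_geometric_of_norm_lt_one h1, cayley_sub_half h2,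
      div_eq_mul_inv]
  have hsw : Summable (Function.uncurry fun (k l : ℕ) => (-1 : ℂ) ^ l * (t * q ^ l) ^ (k + 1)) :=
    hsum.prod_symm
  have h3 := hsw.prod.hasSum
  simp only [Function.uncurry] at h3
  rw [altSum, ← tsum_congr hl, ← hsum.tsum_comm]
  simpa only [hk] using h3

/-- The Fourier expansion of `ker` in the fundamental strip. -/
theorem hasSum_ker (hτ : 0 < τ.im) {z : ℂ} (h1 : 0 < z.im) (h2 : z.im < τ.im) :
    HasSum (fun k : ℤ => ex z ^ k / (1 + ex τ ^ k)) (ker τ z) := by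
  have hq := norm_ex_lt_one hτ
  have ha := hasSum_altSum hq (norm_ex_lt_one h1)
  have hb := hasSum_altSum hq (norm_ex_lt_one (z := τ - z) (by simpa using h2))
  have h3 : HasSum (fun k : ℕ => ex z ^ (k : ℤ) / (1 + ex τ ^ (k : ℤ)))
      (1 / 2 + altSum (ex τ) (ex z)) := by
    have := (hasSum_nat_add_iff (f := fun k : ℕ => ex z ^ (k : ℤ) / (1 + ex τ ^ (k : ℤ))) 1).1
      (by simpa only [zpow_natCast] using ha)
    have h0 : ∑ k ∈ Finset.range 1, ex z ^ (k : ℤ) / (1 + ex τ ^ (k : ℤ)) = 1 / 2 := by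
      rw [Finset.sum_range_one]
      norm_num
    rwa [h0, add_comm] at this
  -- For negative exponents, `t^{-k} / (1 + q^{-k}) = (q/t)^k / (1 + q^k)`. The exponent 0, treated
  -- above, gives the `1/2`.
  have h4 : HasSum (fun k : ℕ => ex z ^ (-((k : ℤ) + 1)) / (1 + ex τ ^ (-((k : ℤ) + 1))))
      (altSum (ex τ) (ex τ / ex z)) := by
    rw [← ex_sub]
    refine hb.congr_fun fun k => ?_
    have hz := ex_ne_zero z
    have ht := ex_ne_zero τ
    rw [ex_sub, div_pow, zpow_neg, zpow_neg]
    norm_cast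
    field_simp
    rw [add_comm]
  exact HasSum.of_nat_of_neg_add_one h3 h4

end Kernel

end ToricGenus

end

noncomputable section

namespace ToricGenus

/-! ### Lattice points modulo the generators, and characters -/

section LatticeSums

variable {d : ℕ}

theorem hasSum_mul_prod {α β : Type*} {f : α → ℂ} {g : β → ℂ} {a b : ℂ} (hf : HasSum f a)
    (hg : HasSum g b) : HasSum (fun p : α × β => f p.1 * g p.2) (a * b) :=
  hf.mul hg (summable_mul_of_summable_norm (summable_norm_iff.2 hf.summable)
    (summable_norm_iff.2 hg.summable))

theorem hasSum_fin_prod {n : ℕ} {f : Fin n → ℤ → ℂ} {a : Fin n → ℂ}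
    (hf : ∀ i, HasSum (f i) (a i)) :
    HasSum (fun m : Fin n → ℤ => ∏ i, f i (m i)) (∏ i, a i) := by
  induction n with
  | zero =>
    simp only [Finset.univ_eq_empty, Finset.prod_empty]
    exact hasSum_unique _
  | succ n ih =>
    have h1 := hf 0
    have h2 := ih fun i => hf i.succ
    have h3 := hasSum_mul_prod h1 h2
    rw [← (Fin.consEquiv fun _ => ℤ).hasSum_iff, Fin.prod_univ_succ]
    refine h3.congr_fun fun p => ?_
    simp [Fin.consEquiv, Fin.prod_univ_succ]

/-- A product of absolutely convergent sums is a sum over functions. -/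
theorem hasSum_pi_prod {ι : Type*} [Fintype ι] {f : ι → ℤ → ℂ} {a : ι → ℂ}
    (hf : ∀ i, HasSum (f i) (a i)) :
    HasSum (fun m : ι → ℤ => ∏ i, f i (m i)) (∏ i, a i) := by
  let e := (Fintype.equivFin ι).symm
  have h := hasSum_fin_prod fun i => hf (e i)
  rw [e.prod_comp a] at h
  rw [← (e.arrowCongr (Equiv.refl ℤ)).hasSum_iff]
  refine h.congr_fun fun m => ?_
  simp only [Function.comp]
  rw [← e.prod_comp]
  simp [Equiv.arrowCongr]

theorem summable_pow_absSum {σ : ℝ} (h0 : 0 ≤ σ) (h1 : σ < 1) :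
    Summable fun m : Fin d → ℤ => σ ^ absSum m := by
  have h : Summable fun k : ℤ => ((σ ^ k.natAbs : ℝ) : ℂ) := by
    rw [Complex.summable_ofReal]
    refine Summable.of_nat_of_neg ?_ ?_ <;> simpa using summable_geometric_of_lt_one h0 h1
  have := (hasSum_fin_prod (n := d) fun _ => h.hasSum).summable
  rw [← Complex.summable_ofReal]
  refine this.congr fun m => ?_
  rw [absSum, ← Finset.prod_pow_eq_pow_sum, Complex.ofReal_prod]

namespace Piece

variable (P : Piece d)

/-- The sublattice generated by the generators of a simplicial cone. -/
def lattice : AddSubgroup (Fin d → ℤ) := AddSubgroup.closure (P.gens : Set (Fin d → ℤ))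

theorem mem_lattice_iff (n : Fin d → ℤ) :
    n ∈ P.lattice ↔ ∀ i ∈ P.gens, ∃ k : ℤ, co P.gens i (latVec n) = k := by
  constructor
  · intro h i hi
    induction h using AddSubgroup.closure_induction with
    | mem x hx =>
      refine ⟨if i = x then 1 else 0, ?_⟩
      rw [co_gen P.indep hi hx]
      push_cast
      rfl
    | zero => exact ⟨0, by simp [latVec_zero]⟩
    | add x y _ _ hx hy =>
      obtain ⟨k, hk⟩ := hx
      obtain ⟨l, hl⟩ := hy
      exact ⟨k + l, by rw [latVec_add, map_add, hk, hl]; push_cast; rfl⟩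
    | neg x _ hx =>
      obtain ⟨k, hk⟩ := hx
      refine ⟨-k, ?_⟩
      have : latVec (-x) = -latVec x := by
        have := latVec_sub 0 x
        rwa [zero_sub, latVec_zero, zero_sub] at this
      rw [this, map_neg, hk]
      push_cast
      rfl
  · intro h
    choose! k hk using h
    have : n = ∑ i ∈ P.gens, k i • i := by
      apply latVec_injective
      rw [sum_co P.indep (P.mem_span (latVec n)), latVec_sum]
      refine Finset.sum_congr rfl fun i hi => ?_
      rw [hk i hi, latVec_zsmul]
    rw [this]
    exact AddSubgroup.sum_mem _ fun i hi =>
      AddSubgroup.zsmul_mem _ (AddSubgroup.subset_closure hi) _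

theorem apply_add_of_mem_lattice {F : (Fin d → ℤ) → ℂ} (hF : ∀ n, ∀ i ∈ P.gens, F (n + i) = F n)
    {l : Fin d → ℤ} (hl : l ∈ P.lattice) (n : Fin d → ℤ) : F (n + l) = F n := by
  induction hl using AddSubgroup.closure_induction generalizing n with
  | mem x hx => exact hF n x hx
  | zero => rw [add_zero]
  | add x y _ _ hx hy => rw [← add_assoc, hy, hx]
  | neg x _ hx => rw [← hx (n + -x), neg_add_cancel_right]

variable {P} {v : Fin d → ℝ}

theorem exists_boxPoint (hv : ∀ i ∈ P.gens, co P.gens i v ≠ 0) (n : Fin d → ℤ) :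
    ∃ b ∈ P.boxPoints v, n - b ∈ P.lattice := by
  -- Rounding is chosen so that the remainder lies in `[0,1)` when `v` has positive coordinate and
  -- in `(0,1]` when it is negative, as `box` requires.
  let k : (Fin d → ℤ) → ℤ := fun i => if 0 < co P.gens i v then ⌊co P.gens i (latVec n)⌋
    else ⌈co P.gens i (latVec n)⌉ - 1
  let l : Fin d → ℤ := ∑ i ∈ P.gens, k i • i
  have hl : l ∈ P.lattice := AddSubgroup.sum_mem _ fun i hi =>
    AddSubgroup.zsmul_mem _ (AddSubgroup.subset_closure hi) _
  have hco : ∀ i ∈ P.gens, co P.gens i (latVec l) = k i := by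
    intro i hi
    rw [latVec_sum, map_sum]
    have : ∀ j ∈ P.gens, co P.gens i (latVec (k j • j)) = if i = j then (k j : ℝ) else 0 := by
      intro j hj
      rw [latVec_zsmul, map_smul, co_gen P.indep hi hj]
      simp
    rw [Finset.sum_congr rfl this, Finset.sum_ite_eq, if_pos hi]
  refine ⟨n - l, mem_boxPoints.2 ⟨P.mem_span _, fun i hi => ?_⟩, by rwa [sub_sub_cancel]⟩
  rw [latVec_sub, map_sub, hco i hi]
  have hk : k i = if 0 < co P.gens i v then ⌊co P.gens i (latVec n)⌋
    else ⌈co P.gens i (latVec n)⌉ - 1 := rfl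
  rw [hk]
  generalize co P.gens i (latVec n) = c
  rcases lt_or_gt_of_ne (hv i hi) with h | h
  · rw [if_neg h.le.not_gt]
    have h1 := Int.ceil_lt_add_one c
    have h2 := Int.le_ceil c
    push_cast
    refine ⟨Or.inl (by linarith), ?_⟩
    push Not
    exact ⟨by linarith, fun _ => h.le⟩
  · rw [if_pos h]
    have h1 := Int.floor_le c
    have h2 := Int.lt_floor_add_one c
    refine ⟨?_, ?_⟩
    · rcases h1.lt_or_eq with h1 | h1
      · exact Or.inl (by linarith)
      · exact Or.inr ⟨by linarith, h⟩
    · push Not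
      exact ⟨by linarith, fun h' => by linarith⟩

/-- Each coordinate of the difference is an integer, and both coordinates lie in the same half-open
interval of length 1. -/
theorem eq_of_sub_mem_lattice (hv : ∀ i ∈ P.gens, co P.gens i v ≠ 0) {b b' : Fin d → ℤ}
    (hb : b ∈ P.boxPoints v) (hb' : b' ∈ P.boxPoints v) (h : b - b' ∈ P.lattice) : b = b' := by
  apply latVec_injective
  rw [sum_co P.indep (P.mem_span (latVec b)), sum_co P.indep (P.mem_span (latVec b'))]
  refine Finset.sum_congr rfl fun i hi => ?_
  obtain ⟨k, hk⟩ := (P.mem_lattice_iff _).1 h i hi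
  rw [latVec_sub, map_sub] at hk
  have hlt : |(k : ℝ)| < 1 := by
    rw [← hk, abs_lt]
    rcases lt_or_gt_of_ne (hv i hi) with h | h
    · have h1 := P.box_co_of_neg hb hi h
      have h2 := P.box_co_of_neg hb' hi h
      constructor <;> linarith
    · have h1 := P.box_co_of_pos hb hi h
      have h2 := P.box_co_of_pos hb' hi h
      constructor <;> linarith
  have hk0 : k = 0 := Int.abs_lt_one_iff.1 (by exact_mod_cast hlt)
  rw [hk0, Int.cast_zero, sub_eq_zero] at hk
  rw [hk]

/-- The points of the fundamental parallelepiped represent the classes modulo the lattice. -/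
def boxEquiv (hv : ∀ i ∈ P.gens, co P.gens i v ≠ 0) :
    P.boxPoints v ≃ (Fin d → ℤ) ⧸ P.lattice :=
  Equiv.ofBijective (fun b => QuotientAddGroup.mk (b : Fin d → ℤ)) <| by
    constructor
    · intro b b' h
      refine Subtype.ext (eq_of_sub_mem_lattice hv b.2 b'.2 ?_)
      have := QuotientAddGroup.eq.1 h.symm
      rwa [neg_add_eq_sub] at this
    · intro x
      induction x using QuotientAddGroup.induction_on with
      | H n =>
        obtain ⟨b, hb, h⟩ := exists_boxPoint hv n
        exact ⟨⟨b, hb⟩, QuotientAddGroup.eq.2 (by rwa [neg_add_eq_sub])⟩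

theorem sub_out_mem_lattice (n : Fin d → ℤ) :
    n - (QuotientAddGroup.mk n : (Fin d → ℤ) ⧸ P.lattice).out ∈ P.lattice := by
  have := QuotientAddGroup.eq.1
    (QuotientAddGroup.out_eq' (QuotientAddGroup.mk n : (Fin d → ℤ) ⧸ P.lattice))
  rwa [neg_add_eq_sub] at this

theorem apply_out {F : (Fin d → ℤ) → ℂ} (hF : ∀ n, ∀ i ∈ P.gens, F (n + i) = F n)
    (n : Fin d → ℤ) : F (QuotientAddGroup.mk n : (Fin d → ℤ) ⧸ P.lattice).out = F n := by
  have := P.apply_add_of_mem_lattice hF (sub_out_mem_lattice (P := P) n)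
    (QuotientAddGroup.mk n : (Fin d → ℤ) ⧸ P.lattice).out
  rw [← this, add_sub_cancel]

theorem sum_boxPoints [Fintype ((Fin d → ℤ) ⧸ P.lattice)]
    (hv : ∀ i ∈ P.gens, co P.gens i v ≠ 0) {F : (Fin d → ℤ) → ℂ}
    (hF : ∀ n, ∀ i ∈ P.gens, F (n + i) = F n) :
    ∑ b ∈ P.boxPoints v, F b = ∑ x : (Fin d → ℤ) ⧸ P.lattice, F x.out := by
  rw [← Finset.sum_coe_sort, ← (boxEquiv hv).sum_comp]
  exact Finset.sum_congr rfl fun b _ => (apply_out hF b).symm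

theorem sum_boxPoints_add (hv : ∀ i ∈ P.gens, co P.gens i v ≠ 0) {F : (Fin d → ℤ) → ℂ}
    (hF : ∀ n, ∀ i ∈ P.gens, F (n + i) = F n) (n : Fin d → ℤ) :
    ∑ b ∈ P.boxPoints v, F (b + n) = ∑ b ∈ P.boxPoints v, F b := by
  let _ : Fintype ((Fin d → ℤ) ⧸ P.lattice) := Fintype.ofEquiv _ (boxEquiv hv)
  rw [sum_boxPoints hv hF, sum_boxPoints hv (F := fun b => F (b + n))
    fun m i hi => by rw [add_right_comm, hF _ i hi]]
  conv_rhs => rw [← Equiv.sum_comp (Equiv.addRight (QuotientAddGroup.mk n : (Fin d → ℤ) ⧸ P.lattice))]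
  refine Finset.sum_congr rfl fun x _ => ?_
  rw [Equiv.coe_addRight]
  have h : x + (QuotientAddGroup.mk n : (Fin d → ℤ) ⧸ P.lattice) =
      QuotientAddGroup.mk (x.out + n) := by
    rw [QuotientAddGroup.mk_add, QuotientAddGroup.out_eq']
  change _ = F (x + _).out
  rw [h, apply_out hF]

/-- Sums of doubly periodic functions over pairs of points of the fundamental parallelepiped are
invariant under unimodular substitutions. -/
theorem sum_boxPoints_unimodular (hv : ∀ i ∈ P.gens, co P.gens i v ≠ 0)
    {F : (Fin d → ℤ) → (Fin d → ℤ) → ℂ} (hF : ∀ n n', ∀ i ∈ P.gens, F (n + i) n' = F n n')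
    (hF' : ∀ n n', ∀ i ∈ P.gens, F n (n' + i) = F n n') {a b c e : ℤ} (hdet : a * e - b * c = 1) :
    ∑ x ∈ P.boxPoints v, ∑ y ∈ P.boxPoints v, F (a • x + c • y) (b • x + e • y) =
      ∑ x ∈ P.boxPoints v, ∑ y ∈ P.boxPoints v, F x y := by
  let _ : Fintype ((Fin d → ℤ) ⧸ P.lattice) := Fintype.ofEquiv _ (boxEquiv hv)
  have hL : ∀ {l}, l ∈ P.lattice → ∀ n n', F (n + l) n' = F n n' := fun hl n n' =>
    P.apply_add_of_mem_lattice (F := fun n => F n n') (fun n i hi => hF n n' i hi) hl n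
  have hL' : ∀ {l}, l ∈ P.lattice → ∀ n n', F n (n' + l) = F n n' := fun hl n n' =>
    P.apply_add_of_mem_lattice (F := fun n' => F n n') (fun n' i hi => hF' n n' i hi) hl n'
  have hmem : ∀ (k : ℤ) {i}, i ∈ P.gens → k • i ∈ P.lattice := fun k i hi =>
    AddSubgroup.zsmul_mem _ (AddSubgroup.subset_closure hi) _
  have key : ∀ {H : (Fin d → ℤ) → (Fin d → ℤ) → ℂ},
      (∀ n n', ∀ i ∈ P.gens, H (n + i) n' = H n n') →
      (∀ n n', ∀ i ∈ P.gens, H n (n' + i) = H n n') →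
      ∑ x ∈ P.boxPoints v, ∑ y ∈ P.boxPoints v, H x y =
        ∑ p : ((Fin d → ℤ) ⧸ P.lattice) × ((Fin d → ℤ) ⧸ P.lattice), H p.1.out p.2.out := by
    intro H h h'
    rw [Fintype.sum_prod_type, sum_boxPoints hv (F := fun x => ∑ y ∈ P.boxPoints v, H x y)
      fun n i hi => Finset.sum_congr rfl fun y _ => h n y i hi]
    exact Finset.sum_congr rfl fun x _ => sum_boxPoints hv fun n i hi => h' _ n i hi
  -- On classes the substitution is a bijection; the adjugate matrix gives its inverse because the
  -- determinant is 1.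
  let σ : ((Fin d → ℤ) ⧸ P.lattice) × ((Fin d → ℤ) ⧸ P.lattice) ≃
      ((Fin d → ℤ) ⧸ P.lattice) × ((Fin d → ℤ) ⧸ P.lattice) :=
    { toFun := fun p => (a • p.1 + c • p.2, b • p.1 + e • p.2)
      invFun := fun p => (e • p.1 - c • p.2, a • p.2 - b • p.1)
      left_inv := by
        rintro ⟨x, y⟩
        refine Prod.ext ?_ ?_
        · calc e • (a • x + c • y) - c • (b • x + e • y) = (a * e - b * c) • x := by module
            _ = x := by rw [hdet, one_zsmul]
        · calc a • (b • x + e • y) - b • (a • x + c • y) = (a * e - b * c) • y := by module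
            _ = y := by rw [hdet, one_zsmul]
      right_inv := by
        rintro ⟨x, y⟩
        refine Prod.ext ?_ ?_
        · calc a • (e • x - c • y) + c • (a • y - b • x) = (a * e - b * c) • x := by module
            _ = x := by rw [hdet, one_zsmul]
        · calc b • (e • x - c • y) + e • (a • y - b • x) = (a * e - b * c) • y := by module
            _ = y := by rw [hdet, one_zsmul] }
  rw [key hF hF', key (H := fun x y => F (a • x + c • y) (b • x + e • y))]
  · conv_rhs => rw [← σ.sum_comp]
    refine Finset.sum_congr rfl fun p _ => ?_
    obtain ⟨x, y⟩ := p
    have h1 : ∀ k l : ℤ, k • x + l • y =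
        (QuotientAddGroup.mk (k • x.out + l • y.out) : (Fin d → ℤ) ⧸ P.lattice) := by
      intro k l
      rw [QuotientAddGroup.mk_add, QuotientAddGroup.mk_zsmul, QuotientAddGroup.mk_zsmul,
        QuotientAddGroup.out_eq', QuotientAddGroup.out_eq']
    change _ = F (a • x + c • y).out (b • x + e • y).out
    rw [h1, h1, apply_out (F := fun n => F n _) fun n i hi => hF n _ i hi,
      apply_out (F := fun n => F _ n) fun n i hi => hF' _ n i hi]
  · intro n n' i hi
    rw [smul_add, smul_add, add_right_comm, add_right_comm (b • n), hL (hmem a hi),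
      hL' (hmem b hi)]
  · intro n n' i hi
    rw [smul_add, smul_add, ← add_assoc, ← add_assoc, hL (hmem c hi), hL' (hmem e hi)]

theorem coe_latVec_eq_sum (n : Fin d → ℤ) : latVec n = ∑ j, (n j : ℝ) • latVec (Pi.single j 1) := by
  funext l
  rw [Finset.sum_apply, Finset.sum_eq_single l]
  · simp [latVec]
  · intro j _ hj
    simp [latVec, hj.symm]
  · simp

open Classical in
/-- Orthogonality of characters. -/
theorem sum_character (hv : ∀ i ∈ P.gens, co P.gens i v ≠ 0) (k : P.gens → ℤ) :
    ∑ b ∈ P.boxPoints v, ex ((∑ i : P.gens, (k i : ℝ) * co P.gens i (latVec b) : ℝ) : ℂ) =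
      if k ∈ Set.range (fun (m : Fin d → ℤ) (i : P.gens) => m ⬝ᵥ (i : Fin d → ℤ))
      then ((P.boxPoints v).card : ℂ) else 0 := by
  let ℓ : (Fin d → ℝ) →ₗ[ℝ] ℝ := ∑ i : P.gens, (k i : ℝ) • co P.gens i
  have hℓ : ∀ x, ∑ i : P.gens, (k i : ℝ) * co P.gens i x = ℓ x := by
    intro x
    simp [ℓ]
  simp only [hℓ]
  have hgen : ∀ i : P.gens, ℓ (latVec i) = k i := by
    intro i
    rw [← hℓ, Finset.sum_congr rfl fun j _ => by rw [co_gen P.indep j.2 i.2]]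
    simp
  split_ifs with h
  · obtain ⟨m, rfl⟩ := h
    rw [← nsmul_one, ← Finset.sum_const]
    refine Finset.sum_congr rfl fun b _ => ?_
    have : ℓ (latVec b) = ((m ⬝ᵥ b : ℤ) : ℝ) := by
      rw [← pairing_latVec, P.pairing_eq, ← hℓ, ← Finset.sum_coe_sort P.gens]
      exact Finset.sum_congr rfl fun i _ => mul_comm _ _
    rw [this]
    exact_mod_cast ex_int (m ⬝ᵥ b)
  -- If the character were trivial, `ℓ` would be integral on the lattice, and its values on the unit
  -- vectors would form an `m` that induces `k`.
  · obtain ⟨n, hn⟩ : ∃ n, ex (ℓ (latVec n) : ℝ) ≠ 1 := by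
      by_contra! hall
      refine h ?_
      have hint : ∀ n, ∃ z : ℤ, ℓ (latVec n) = z := by
        intro n
        obtain ⟨z, hz⟩ := (ex_eq_one_iff _).1 (hall n)
        exact ⟨z, by exact_mod_cast hz⟩
      choose z hz using hint
      refine ⟨fun j => z (Pi.single j 1), funext fun i => ?_⟩
      have h1 : (((fun j => z (Pi.single j 1)) ⬝ᵥ (i : Fin d → ℤ) : ℤ) : ℝ) = k i := by
        rw [← hgen, coe_latVec_eq_sum, map_sum, dotProduct, Int.cast_sum]
        refine Finset.sum_congr rfl fun j _ => ?_
        rw [map_smul, hz, smul_eq_mul, Int.cast_mul, mul_comm]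
      exact_mod_cast h1
    have hadd : ∀ b, ex (ℓ (latVec (b + n)) : ℝ) = ex (ℓ (latVec b) : ℝ) * ex (ℓ (latVec n) : ℝ) := by
      intro b
      rw [latVec_add, map_add, Complex.ofReal_add, ex_add]
    -- Translation by `n` permutes the classes but multiplies the sum by a number other than 1, so
    -- the sum vanishes.
    have h1 := sum_boxPoints_add hv (F := fun b => ex (ℓ (latVec b) : ℝ)) (fun b i hi => by
      rw [latVec_add, map_add, Complex.ofReal_add, ex_add, hgen ⟨i, hi⟩]
      have : ex (((k ⟨i, hi⟩ : ℝ)) : ℂ) = 1 := by exact_mod_cast ex_int (k ⟨i, hi⟩)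
      rw [this, mul_one]) n
    simp only [hadd] at h1
    rw [← Finset.sum_mul] at h1
    by_contra h0
    exact hn (mul_left_cancel₀ h0 (by rw [h1, mul_one]))

end Piece

end LatticeSums

end ToricGenus

end

noncomputable section

namespace ToricGenus

/-! ### Deformed contributions of simplicial cones -/

section Transformation

open Filter Topology

variable {d : ℕ}

/-- The argument of the kernel attached to a generator and a pair of lattice points. -/
def Piece.arg (P : Piece d) (v : Fin d → ℝ) (τ s : ℂ) (x y i : Fin d → ℤ) : ℂ :=
  s * (co P.gens i v : ℝ) + (co P.gens i (latVec x) : ℝ) * τ + (co P.gens i (latVec y) : ℝ)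

/-- The product of kernels attached to a pair of lattice points. -/
def Piece.kerProd (P : Piece d) (v : Fin d → ℝ) (τ s : ℂ) (x y : Fin d → ℤ) : ℂ :=
  (-1) ^ (P.form ⬝ᵥ x) * ∏ i : P.gens, ker τ (P.arg v τ s x y i)

/-- The deformed contribution of a simplicial cone. -/
def Piece.deformed (P : Piece d) (v : Fin d → ℝ) (τ s : ℂ) : ℂ :=
  ((P.boxPoints v).card : ℂ)⁻¹ * ∑ x ∈ P.boxPoints v, ∑ y ∈ P.boxPoints v, P.kerProd v τ s x y

variable {P : Piece d} {v : Fin d → ℝ} {τ : ℂ}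

/-- Adding the generator `j` shifts one argument by `τ`, which gives a sign. The character
`(-1)^(P.form ⬝ᵥ x)` gives another because the form is 1 on `j`. -/
theorem Piece.kerProd_add_left (hτ : 0 < τ.im) (s : ℂ) (x y : Fin d → ℤ) {j : Fin d → ℤ}
    (hj : j ∈ P.gens) : P.kerProd v τ s (x + j) y = P.kerProd v τ s x y := by
  classical
  have h : ∀ i : P.gens, ker τ (P.arg v τ s (x + j) y i) =
      (if i = ⟨j, hj⟩ then -1 else 1) * ker τ (P.arg v τ s x y i) := by
    intro i
    have h1 : co P.gens i (latVec (x + j)) =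
        co P.gens i (latVec x) + if i = ⟨j, hj⟩ then 1 else 0 := by
      rw [latVec_add, map_add, co_gen P.indep i.2 hj]
      simp [Subtype.ext_iff]
    rw [Piece.arg, h1]
    split_ifs with h2
    · rw [neg_one_mul, ← ker_add_tau hτ, Piece.arg]
      congr 1
      push_cast
      ring
    · rw [one_mul, add_zero, Piece.arg]
  rw [Piece.kerProd, Finset.prod_congr rfl fun i _ => h i, Finset.prod_mul_distrib,
    Finset.prod_ite_eq' , if_pos (Finset.mem_univ _), dotProduct_add, P.form_gens j hj,
    zpow_add_one₀ (by norm_num), Piece.kerProd]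
  ring

theorem Piece.kerProd_add_right (s : ℂ) (x y : Fin d → ℤ) {j : Fin d → ℤ}
    (hj : j ∈ P.gens) : P.kerProd v τ s x (y + j) = P.kerProd v τ s x y := by
  classical
  rw [Piece.kerProd, Piece.kerProd]
  congr 1
  refine Finset.prod_congr rfl fun i _ => ?_
  have h1 : co P.gens i (latVec (y + j)) =
      co P.gens i (latVec y) + ((if (i : Fin d → ℤ) = j then 1 else 0 : ℤ) : ℝ) := by
    rw [latVec_add, map_add, co_gen P.indep i.2 hj]
    push_cast
    rfl
  rw [Piece.arg, h1, Complex.ofReal_add, Complex.ofReal_intCast, ← add_assoc, ker_add_int,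
    Piece.arg]

/-- The deformed contributions transform like modular forms. -/
theorem Piece.deformed_modular (hv : ∀ i ∈ P.gens, co P.gens i v ≠ 0) (hτ : 0 < τ.im)
    {a b c e : ℤ} (hdet : a * e - b * c = 1) (hc : Even c) {τ' : ℂ} (hτ' : 0 < τ'.im)
    (hw0 : (c * τ + e : ℂ) ≠ 0) (hw : (c * τ + e : ℂ) * τ' = a * τ + b) (s : ℂ) :
    P.deformed v τ' (s / (c * τ + e)) = (c * τ + e) ^ d * P.deformed v τ s := by
  -- With `a` odd and `c` even, the character `(-1)^(P.form ⬝ᵥ x)` is unchanged when `x` becomes `a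
  -- • x + c • y`.
  have ha : Odd a := by
    have h : Odd (a * e) := by
      rw [show a * e = b * c + 1 by linarith]
      exact (hc.mul_left b).add_one
    exact (Int.odd_mul.1 h).1
  -- `(cτ+e)(x_i τ' + y_i) = (a x_i + c y_i) τ + (b x_i + e y_i)`, so the matrix acts on pairs; each
  -- of the `d` kernels contributes one factor `cτ+e`.
  have key : ∀ x y, P.kerProd v τ' (s / (c * τ + e)) x y =
      (c * τ + e) ^ d * P.kerProd v τ s (a • x + c • y) (b • x + e • y) := by
    intro x y
    have h1 : ∀ i : P.gens, ker τ' (P.arg v τ' (s / (c * τ + e)) x y i) =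
        (c * τ + e) * ker τ (P.arg v τ s (a • x + c • y) (b • x + e • y) i) := by
      intro i
      rw [← ker_modular hτ hdet hc hτ' hw0 hw]
      congr 1
      simp only [Piece.arg, latVec_add, latVec_zsmul, map_add, map_smul, smul_eq_mul]
      rw [eq_div_iff hw0]
      push_cast
      field_simp
      linear_combination (co P.gens i (latVec x) : ℂ) * hw
    have h2 : (-1 : ℂ) ^ (P.form ⬝ᵥ (a • x + c • y)) = (-1) ^ (P.form ⬝ᵥ x) := by
      rw [dotProduct_add, dotProduct_smul, dotProduct_smul, smul_eq_mul, smul_eq_mul,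
        zpow_add₀ (by norm_num), (hc.mul_right _).neg_one_zpow, mul_one, zpow_mul,
        ha.neg_one_zpow]
    rw [Piece.kerProd, Finset.prod_congr rfl fun i _ => h1 i, Finset.prod_mul_distrib,
      Finset.prod_const, Finset.card_univ, Fintype.card_coe, P.card_gens, Piece.kerProd, h2]
    ring
  rw [Piece.deformed, Piece.deformed]
  simp only [key, ← Finset.mul_sum]
  rw [Piece.sum_boxPoints_unimodular hv (F := P.kerProd v τ s)
    (fun n n' i hi => Piece.kerProd_add_left hτ s n n' hi)
    (fun n n' i hi => Piece.kerProd_add_right s n n' hi) hdet]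
  ring

theorem Piece.boxPoints_nonempty (hv : ∀ i ∈ P.gens, co P.gens i v ≠ 0) :
    (P.boxPoints v).Nonempty :=
  let ⟨b, hb, _⟩ := Piece.exists_boxPoint hv 0
  ⟨b, hb⟩

theorem Piece.injective_dotProduct_gens :
    Function.Injective fun (m : Fin d → ℤ) (i : P.gens) => m ⬝ᵥ (i : Fin d → ℤ) := by
  intro m m' h
  funext j
  have h1 : pairing m (latVec (Pi.single j 1)) = pairing m' (latVec (Pi.single j 1)) := by
    rw [P.pairing_eq, P.pairing_eq]
    refine Finset.sum_congr rfl fun i hi => ?_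
    have hi' : m ⬝ᵥ i = m' ⬝ᵥ i := congrFun h ⟨i, hi⟩
    rw [hi']
  rw [pairing_latVec, pairing_latVec] at h1
  simpa using h1

/-- The rational function of `q` attached to a point of the fundamental parallelepiped. -/
def Piece.boxTerm (P : Piece d) (q : ℂ) (m b : Fin d → ℤ) : ℂ :=
  (-1) ^ (P.form ⬝ᵥ b) * (q ^ (m ⬝ᵥ b) * ∏ i ∈ P.gens, (1 + q ^ (m ⬝ᵥ i))⁻¹)

theorem wnorm_piecePS_lt_top (P : Piece d) (v : Fin d → ℝ) (m : Fin d → ℤ) {q : ℂ}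
    (hq : ‖q‖ < 1) : wnorm ‖q‖ₑ (piecePS P v m) < ⊤ := by
  have hq' : ‖q‖ₑ < 1 := by
    rw [enorm_eq_nnnorm]; exact_mod_cast hq
  refine (wnorm_piecePS_le P v m (e := 0) (fun b hb => P.expo_nonneg m hb) hq').trans_lt ?_
  refine ENNReal.mul_lt_top (by simp) (ENNReal.mul_lt_top (by simp) ?_)
  exact ENNReal.pow_lt_top (ENNReal.inv_lt_top.2 (tsub_pos_of_lt hq'))

theorem evalPS_piecePS (P : Piece d) (v : Fin d → ℝ) (m : Fin d → ℤ) {q : ℂ} (hq : ‖q‖ < 1)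
    (hq0 : q ≠ 0) : evalPS q (piecePS P v m) = ∑ b ∈ P.boxPoints v, P.boxTerm q m b := by
  have hq' : ‖q‖ₑ < 1 := by
    rw [enorm_eq_nnnorm]; exact_mod_cast hq
  have hinv : ∀ k, wnorm ‖q‖ₑ (1 + PowerSeries.X ^ k)⁻¹ < ⊤ := fun k =>
    (wnorm_inv_one_add_le hq' k).trans_lt (ENNReal.inv_lt_top.2 (tsub_pos_of_lt hq'))
  have hC : ∀ a : ℂ, wnorm ‖q‖ₑ (PowerSeries.C a) < ⊤ := fun a => by
    rw [wnorm_C]; exact enorm_lt_top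
  have hX : ∀ k : ℕ, wnorm ‖q‖ₑ (PowerSeries.X ^ k) < ⊤ := fun k => by
    rw [wnorm_X_pow]; exact ENNReal.pow_lt_top enorm_lt_top
  have hCX : ∀ (a : ℂ) (k : ℕ), wnorm ‖q‖ₑ (PowerSeries.C a * PowerSeries.X ^ k) < ⊤ :=
    fun a k => (wnorm_mul_le _ _ _).trans_lt (ENNReal.mul_lt_top (hC a) (hX k))
  have hprod : wnorm ‖q‖ₑ (∏ i ∈ P.gens, (1 + PowerSeries.X ^ (m ⬝ᵥ i).natAbs)⁻¹) < ⊤ :=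
    (wnorm_prod_le _ _ _).trans_lt (ENNReal.prod_lt_top fun i _ => hinv _)
  rw [piecePS, evalPS_sum _ fun b _ => (wnorm_mul_le _ _ _).trans_lt
    (ENNReal.mul_lt_top (hCX _ _) hprod)]
  refine Finset.sum_congr rfl fun b hb => ?_
  rw [evalPS_mul (hCX _ _) hprod, evalPS_mul (hC _) (hX _), evalPS_C, evalPS_X_pow,
    evalPS_prod _ fun i _ => hinv _, Piece.boxTerm, mul_assoc]
  congr 1
  have h1 : q ^ (P.expo m b).toNat = q ^ (m ⬝ᵥ b) * ∏ i ∈ P.gens, q ^ max 0 (-(m ⬝ᵥ i)) := by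
    rw [← zpow_natCast, Int.toNat_of_nonneg (P.expo_nonneg m hb), Piece.expo, zpow_add₀ hq0]
    congr 1
    generalize P.gens = I
    classical
    induction I using Finset.induction_on with
    | empty => simp
    | insert i I hi ih => rw [Finset.sum_insert hi, Finset.prod_insert hi, zpow_add₀ hq0, ih]
  rw [h1, mul_assoc, ← Finset.prod_mul_distrib]
  congr 1
  refine Finset.prod_congr rfl fun i _ => ?_
  rw [evalPS_inv_one_add hq]
  generalize m ⬝ᵥ i = k
  have hne : ∀ n : ℕ, 0 < n → 1 + q ^ n ≠ 0 := by
    intro n hn h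
    have h2 : ‖q ^ n‖ < 1 := by
      rw [norm_pow]; exact pow_lt_one₀ (norm_nonneg _) hq hn.ne'
    rw [eq_neg_of_add_eq_zero_right h, norm_neg, norm_one] at h2
    exact lt_irrefl _ h2
  rcases le_or_gt 0 k with hk | hk
  · obtain ⟨n, rfl⟩ := Int.eq_ofNat_of_zero_le hk
    rw [max_eq_left (by omega), zpow_zero, one_mul, Int.natAbs_natCast, zpow_natCast]
  · obtain ⟨n, hn⟩ := Int.eq_ofNat_of_zero_le (show 0 ≤ -k by omega)
    obtain rfl : k = -n := by omega
    have h3 := hne n (by omega)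
    rw [max_eq_right (by omega), neg_neg, Int.natAbs_neg, Int.natAbs_natCast, zpow_neg,
      zpow_natCast]
    have h4 : q ^ n ≠ 0 := pow_ne_zero _ hq0
    have h5 : 1 + (q ^ n)⁻¹ = (1 + q ^ n) * (q ^ n)⁻¹ := by field_simp; ring
    rw [h5, mul_inv, inv_inv, mul_comm]

/-- The sum over the dual lattice of the deformed contributions of a simplicial cone. -/
theorem Piece.hasSum_deformed (hv : ∀ i ∈ P.gens, co P.gens i v ≠ 0) (hτ : 0 < τ.im) {s : ℂ}
    (hs : ∀ b ∈ P.boxPoints v, ∀ i ∈ P.gens,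
      s.im / τ.im * co P.gens i v + co P.gens i (latVec b) ∈ Set.Ioo (0 : ℝ) 1) :
    HasSum (fun m => ex (s * (pairing m v : ℝ)) * evalPS (ex τ) (piecePS P v m))
      (P.deformed v τ s) := by
  classical
  -- The hypothesis on `s` puts every argument into the open strip where the Fourier series of `ker`
  -- converges; without the deformation, coordinates 0 or 1 would lie on its boundary.
  have hstrip : ∀ x ∈ P.boxPoints v, ∀ y, ∀ i : P.gens,
      0 < (P.arg v τ s x y i).im ∧ (P.arg v τ s x y i).im < τ.im := by
    intro x hx y i
    have h := hs x hx i i.2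
    have him : (P.arg v τ s x y i).im =
        (s.im / τ.im * co P.gens i v + co P.gens i (latVec x)) * τ.im := by
      simp [Piece.arg]
      field_simp
    rw [him]
    exact ⟨mul_pos h.1 hτ, mul_lt_of_lt_one_left hτ h.2⟩
  have hbox : ∀ x ∈ P.boxPoints v, HasSum (fun m => ex (s * (pairing m v : ℝ)) *
      P.boxTerm (ex τ) m x) (((P.boxPoints v).card : ℂ)⁻¹ *
        ∑ y ∈ P.boxPoints v, P.kerProd v τ s x y) := by
    intro x hx
    have h1 : ∀ y, HasSum (fun k : P.gens → ℤ => (-1) ^ (P.form ⬝ᵥ x) *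
        ∏ i : P.gens, ex (P.arg v τ s x y i) ^ k i / (1 + ex τ ^ k i)) (P.kerProd v τ s x y) :=
      fun y => (hasSum_pi_prod fun i : P.gens =>
        hasSum_ker hτ (hstrip x hx y i).1 (hstrip x hx y i).2).mul_left _
    have h2 := (hasSum_sum fun y (_ : y ∈ P.boxPoints v) => h1 y).mul_left
      ((P.boxPoints v).card : ℂ)⁻¹
    have hcard : ((P.boxPoints v).card : ℂ) ≠ 0 :=
      Nat.cast_ne_zero.2 (Piece.boxPoints_nonempty hv).card_ne_zero
    -- The Fourier series runs over all integer tuples `k` indexed by the generators. Averaging over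
    -- `y` keeps just the tuples `m ⬝ᵥ i` with `m` in the dual lattice, and these determine `m`.
    have h3 : ∀ k : P.gens → ℤ, ((P.boxPoints v).card : ℂ)⁻¹ * ∑ y ∈ P.boxPoints v,
        (-1) ^ (P.form ⬝ᵥ x) * ∏ i : P.gens, ex (P.arg v τ s x y i) ^ k i / (1 + ex τ ^ k i) =
        (-1) ^ (P.form ⬝ᵥ x) * (∏ i : P.gens, ex (P.arg v τ s x 0 i) ^ k i / (1 + ex τ ^ k i)) *
          if k ∈ Set.range (fun (m : Fin d → ℤ) (i : P.gens) => m ⬝ᵥ (i : Fin d → ℤ))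
          then 1 else 0 := by
      intro k
      have h4 : ∀ y, ∏ i : P.gens, ex (P.arg v τ s x y i) ^ k i / (1 + ex τ ^ k i) =
          (∏ i : P.gens, ex (P.arg v τ s x 0 i) ^ k i / (1 + ex τ ^ k i)) *
          ex ((∑ i : P.gens, (k i : ℝ) * co P.gens i (latVec y) : ℝ) : ℂ) := by
        intro y
        rw [Complex.ofReal_sum, ex_sum, ← Finset.prod_mul_distrib]
        refine Finset.prod_congr rfl fun i _ => ?_
        have h5 : P.arg v τ s x y i =
            P.arg v τ s x 0 i + (co P.gens i (latVec y) : ℝ) := by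
          simp [Piece.arg, latVec_zero]
        rw [h5, ex_add, mul_zpow, Complex.ofReal_mul, Complex.ofReal_intCast,
          ex_int_mul (k i) ((co P.gens i (latVec y) : ℝ) : ℂ)]
        ring
      rw [Finset.sum_congr rfl fun y _ => congrArg _ (h4 y), ← Finset.mul_sum, ← Finset.mul_sum,
        Piece.sum_character hv]
      split_ifs
      · field_simp
      · simp
    replace h2 := h2.congr_fun fun k => (h3 k).symm
    rw [← (Piece.injective_dotProduct_gens (P := P)).hasSum_iff] at h2
    · refine h2.congr_fun fun m => ?_
      simp only [Function.comp]
      rw [if_pos ⟨m, rfl⟩, mul_one, Piece.boxTerm, mul_left_comm]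
      congr 1
      have h6 : ∏ i : P.gens, ex (P.arg v τ s x 0 i) ^ (m ⬝ᵥ (i : Fin d → ℤ)) =
          ex (s * (pairing m v : ℝ)) * ex τ ^ (m ⬝ᵥ x) := by
        rw [Finset.prod_congr rfl fun i _ => (ex_int_mul _ _).symm, ← ex_sum, ← ex_int_mul, ← ex_add]
        congr 1
        have h7 : ((m ⬝ᵥ x : ℤ) : ℂ) = ((pairing m (latVec x) : ℝ) : ℂ) := by
          rw [pairing_latVec]
          norm_cast
        rw [h7, P.pairing_eq, P.pairing_eq, ← Finset.sum_coe_sort P.gens,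
          ← Finset.sum_coe_sort P.gens]
        push_cast
        rw [Finset.mul_sum, Finset.sum_mul, ← Finset.sum_add_distrib]
        refine Finset.sum_congr rfl fun i _ => ?_
        rw [Piece.arg, latVec_zero, map_zero, Complex.ofReal_zero]
        ring
      rw [Finset.prod_div_distrib, h6, Finset.prod_inv_distrib,
        ← Finset.prod_coe_sort P.gens fun i => 1 + ex τ ^ (m ⬝ᵥ i), div_eq_mul_inv, mul_assoc]
    · intro k hk
      rw [if_neg hk, mul_zero]
  have h := hasSum_sum fun x (hx : x ∈ P.boxPoints v) => hbox x hx
  rw [← Finset.mul_sum] at h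
  refine h.congr_fun fun m => ?_
  rw [evalPS_piecePS P v m (norm_ex_lt_one hτ) (ex_ne_zero τ), Finset.mul_sum]

end Transformation

end ToricGenus

end

noncomputable section

namespace ToricGenus

/-! ### Convergence and modularity of the genus -/

section Genus

open Filter Topology
open scoped ENNReal

variable {d : ℕ}

/-- A description of the contributions to the elliptic genus by half-open simplicial cones. -/
structure Fan.Contributions (F : Fan d) (hG : F.IsGorenstein) where
  κ : Type
  fintype : Fintype κ
  P : κ → Piece d
  v : Fin d → ℝ
  generic : ∀ k, ∀ i ∈ (P k).gens, co (P k).gens i v ≠ 0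
  s : (Fin d → ℤ) → PowerSeries ℂ
  s_eq : ∀ m, s m = ∑ k, piecePS (P k) v m
  ellTerm_eq : ∀ m, F.ellTerm hG (-1) m =
    ((s m * G (-1) ^ d : PowerSeries ℂ) : LaurentSeries ℂ)
  c : ℝ
  c_pos : 0 < c
  dvd : ∀ m, (PowerSeries.X : PowerSeries ℂ) ^ ⌈c * absSum m⌉₊ ∣ s m
  K : ℕ
  wnorm_le : ∀ m, ∀ ρ : ℝ≥0∞, ρ < 1 →
    wnorm ρ (s m) ≤ K * (ρ ^ ⌈c * absSum m⌉₊ * ((1 - ρ)⁻¹) ^ d)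

theorem Fan.exists_contributions (F : Fan d) (hF : F.IsComplete) (hG : F.IsGorenstein) :
    Nonempty (F.Contributions hG) := by
  have hdeg : F.IsDegree (F.deg hG) := hG.choose_spec
  obtain ⟨κ, hκ, P, bad, hbad, hgood, hP⟩ := F.exists_pieces hF hdeg
  obtain ⟨v, hv, -⟩ := exists_notMem_near hbad 0 one_pos
  have huniq := fun {v} (hv : ∀ B ∈ bad, v ∉ B) m =>
    piecePS_sum_unique F hF hdeg (fun v hv => (hgood v hv).2) hP hv m
  -- Independence of the generic vector: for both vectors the power series maps to the same
  -- alternating sum over the fan, and power series embed into Laurent series.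
  obtain ⟨c, hc, K, hK⟩ := exists_contribution_bound hbad (fun v hv => (hgood v hv).1)
    (s := fun m => ∑ k, piecePS (P k) v m) fun v' hv' m =>
      HahnSeries.ofPowerSeries_injective ((huniq hv m).symm.trans (huniq hv' m))
  exact ⟨⟨κ, hκ, P, v, (hgood v hv).1, _, fun m => rfl, fun m => by
    rw [Fan.ellTerm, huniq hv m, PowerSeries.coe_mul, PowerSeries.coe_pow], c, hc,
    fun m => (hK m).1, K, fun m => (hK m).2⟩⟩

namespace Fan.Contributions

variable {F : Fan d} {hG : F.IsGorenstein} (D : F.Contributions hG)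

theorem dvd_mul (m : Fin d → ℤ) :
    (PowerSeries.X : PowerSeries ℂ) ^ ⌈D.c * absSum m⌉₊ ∣ D.s m * G (-1) ^ d :=
  (D.dvd m).mul_right _

theorem ellWellDefined (D : F.Contributions hG) : F.EllWellDefined hG (-1) := by
  refine ⟨fun m k hk => ?_, fun k => ?_⟩
  · rw [D.ellTerm_eq]
    exact PowerSeries.coeff_coe .. |>.trans (if_pos hk)
  · rcases lt_or_ge k 0 with hk | hk
    · convert Set.finite_empty
      rw [Set.eq_empty_iff_forall_notMem]
      intro m hm
      refine hm ?_
      rw [D.ellTerm_eq]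
      exact PowerSeries.coeff_coe .. |>.trans (if_pos hk)
    · obtain ⟨n, rfl⟩ := Int.eq_ofNat_of_zero_le hk
      refine (finite_support_coeff D.c_pos D.dvd_mul n).subset fun m hm => ?_
      rw [Set.mem_ofPred_eq, D.ellTerm_eq, LaurentSeries.coeff_coe_powerSeries] at hm
      exact hm

theorem ell_eq : F.ell hG (-1) =
    PowerSeries.C ((-1 : ℂ) ^ (-(d : ℂ) / 2)) * (formalSum D.s * G (-1) ^ d) := by
  rw [Fan.ell, ← formalSum_mul D.c_pos D.dvd, formalSum]
  congr 2
  funext k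
  refine finsum_congr fun m => ?_
  rw [D.ellTerm_eq, LaurentSeries.coeff_coe_powerSeries]

theorem normEll_eq : F.normEll hG = formalSum D.s := by
  have h1 : G (-1) ^ d * ((G (-1))⁻¹) ^ d = 1 := by
    rw [← mul_pow, PowerSeries.mul_inv_cancel _ constantCoeff_G_ne_zero, one_pow]
  have h2 : (-1 : ℂ) ^ ((d : ℂ) / 2) * (-1) ^ (-(d : ℂ) / 2) = 1 := by
    rw [neg_div, ← Complex.cpow_add _ _ (by norm_num), add_neg_cancel, Complex.cpow_zero]
  rw [Fan.normEll, D.ell_eq]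
  calc _ = PowerSeries.C ((-1 : ℂ) ^ ((d : ℂ) / 2) * (-1) ^ (-(d : ℂ) / 2)) *
        formalSum D.s * (G (-1) ^ d * ((G (-1))⁻¹) ^ d) := by
        rw [map_mul]; ring
    _ = _ := by rw [h1, h2, map_one, one_mul, mul_one]

/-- Divisibility by `q^{c|m|}` gives geometric decay in `absSum m` with ratio `σ = ‖q‖^c`. -/
theorem exists_wnorm_le {q : ℂ} (hq : ‖q‖ < 1) (hq0 : q ≠ 0) : ∃ σ K : ℝ, 0 < σ ∧ σ < 1 ∧ 0 ≤ K ∧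
    ∀ m, wnorm ‖q‖ₑ (D.s m) ≤ ENNReal.ofReal (K * σ ^ absSum m) := by
  have hq' : ‖q‖ₑ < 1 := by
    rw [enorm_eq_nnnorm]; exact_mod_cast hq
  have hpos : 0 < ‖q‖ := norm_pos_iff.2 hq0
  have hσ : 0 < ‖q‖ ^ D.c := Real.rpow_pos_of_pos hpos _
  refine ⟨‖q‖ ^ D.c, ((D.K : ℝ≥0∞) * ((1 - ‖q‖ₑ)⁻¹) ^ d).toReal, hσ,
    Real.rpow_lt_one hpos.le hq D.c_pos, ENNReal.toReal_nonneg, fun m => ?_⟩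
  have htop : (D.K : ℝ≥0∞) * ((1 - ‖q‖ₑ)⁻¹) ^ d ≠ ∞ :=
    ENNReal.mul_ne_top (by simp) (ENNReal.pow_ne_top (ENNReal.inv_ne_top.2 (tsub_pos_of_lt hq').ne'))
  rw [ENNReal.ofReal_mul ENNReal.toReal_nonneg, ENNReal.ofReal_toReal htop]
  refine (D.wnorm_le m _ hq').trans ?_
  rw [mul_comm (‖q‖ₑ ^ _), ← mul_assoc]
  refine mul_le_mul' le_rfl ?_
  rw [← ofReal_norm, ← ENNReal.ofReal_pow hpos.le]
  refine ENNReal.ofReal_le_ofReal ?_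
  rw [← Real.rpow_natCast, ← Real.rpow_natCast, ← Real.rpow_mul hpos.le]
  exact Real.rpow_le_rpow_of_exponent_ge hpos hq.le (Nat.le_ceil _)

theorem tsum_wnorm_lt_top {q : ℂ} (hq : ‖q‖ < 1) (hq0 : q ≠ 0) :
    ∑' m, wnorm ‖q‖ₑ (D.s m) < ∞ := by
  obtain ⟨σ, K, h0, h1, hK, h⟩ := D.exists_wnorm_le hq hq0
  refine (ENNReal.tsum_le_tsum h).trans_lt ?_
  exact ((summable_pow_absSum h0.le h1).mul_left K).tsum_ofReal_lt_top

theorem summable_qTerm_formalSum (τ : ℍ) : Summable (qTerm (formalSum D.s) τ) := by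
  have hq := norm_ex_lt_one τ.im_pos
  have h : wnorm ‖ex τ‖ₑ (formalSum D.s) < ∞ :=
    (wnorm_formalSum_le D.c_pos D.dvd _).trans_lt (D.tsum_wnorm_lt_top hq (ex_ne_zero _))
  exact (summable_of_wnorm h).of_norm

theorem summable_qTerm_ell (D : F.Contributions hG) (τ : ℍ) : Summable (qTerm (F.ell hG (-1)) τ) := by
  have hq := norm_ex_lt_one τ.im_pos
  have h : wnorm ‖ex τ‖ₑ (formalSum D.s) < ∞ :=
    (wnorm_formalSum_le D.c_pos D.dvd _).trans_lt (D.tsum_wnorm_lt_top hq (ex_ne_zero _))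
  have hGt : wnorm ‖ex τ‖ₑ (G (-1)) < ∞ := by
    rw [← ofReal_norm]
    exact wnorm_G_lt_top (norm_nonneg _) hq
  have h2 : wnorm ‖ex τ‖ₑ (F.ell hG (-1)) < ∞ := by
    rw [D.ell_eq]
    refine (wnorm_mul_le _ _ _).trans_lt (ENNReal.mul_lt_top ?_
      ((wnorm_mul_le _ _ _).trans_lt (ENNReal.mul_lt_top h
        ((wnorm_pow_le _ _ _).trans_lt (ENNReal.pow_lt_top hGt)))))
    rw [wnorm_C]
    exact enorm_lt_top
  exact (summable_of_wnorm h2).of_norm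

theorem qValue_formalSum (τ : ℍ) :
    qValue (formalSum D.s) τ = ∑' m, evalPS (ex τ) (D.s m) :=
  evalPS_formalSum D.c_pos D.dvd
    (D.tsum_wnorm_lt_top (norm_ex_lt_one τ.im_pos) (ex_ne_zero _))

theorem abs_pairing_le (m : Fin d → ℤ) (v : Fin d → ℝ) :
    |pairing m v| ≤ (∑ l, |v l|) * absSum m := by
  rw [pairing_apply, cast_absSum, Finset.sum_mul]
  refine (Finset.abs_sum_le_sum_abs _ _).trans (Finset.sum_le_sum fun l hl => ?_)
  rw [abs_mul]
  exact mul_le_mul_of_nonneg_left (Finset.single_le_sum (f := fun l => |(m l : ℝ)|)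
    (fun _ _ => abs_nonneg _) hl) (abs_nonneg _)

/-- The undeformed sum is the limit of the deformed sums. -/
theorem tendsto_tsum_ex_mul (τ : ℍ) (s₀ : ℂ) :
    Tendsto (fun t : ℝ => ∑' m, ex (t * s₀ * (pairing m D.v : ℝ)) * evalPS (ex τ) (D.s m))
      (𝓝[>] 0) (𝓝 (qValue (formalSum D.s) τ)) := by
  obtain ⟨σ, K, h0, h1, hK, h⟩ := D.exists_wnorm_le (norm_ex_lt_one τ.im_pos) (ex_ne_zero _)
  obtain ⟨σ', hσ, hσ'⟩ := exists_between h1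
  set V := ∑ l, |D.v l| with hV
  have hV0 : 0 ≤ V := Finset.sum_nonneg fun _ _ => abs_nonneg _
  have heval : ∀ m, ‖evalPS (ex τ) (D.s m)‖ ≤ K * σ ^ absSum m := by
    intro m
    have h2 := norm_evalPS_le.trans (h m)
    rw [← ofReal_norm] at h2
    exact (ENNReal.ofReal_le_ofReal_iff (by positivity)).1 h2
  -- The deforming factor grows at most geometrically in `absSum m`, with a ratio tending to 1 as `t
  -- → 0`, so the decay `σ` absorbs it at the price of a slightly larger `σ' < 1`.
  have hsmall : ∀ᶠ t : ℝ in 𝓝[>] 0, Real.exp (2 * Real.pi * (t * (|s₀.im| * V))) * σ < σ' := by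
    have hc : Continuous fun t : ℝ => Real.exp (2 * Real.pi * (t * (|s₀.im| * V))) * σ := by fun_prop
    have := (hc.tendsto 0).mono_left (nhdsWithin_le_nhds (s := Set.Ioi 0))
    simp only [zero_mul, mul_zero, Real.exp_zero, one_mul] at this
    exact this.eventually_lt_const hσ
  rw [D.qValue_formalSum]
  refine tendsto_tsum_of_dominated_convergence (bound := fun m => K * σ' ^ absSum m)
    ((summable_pow_absSum (h0.le.trans hσ.le) hσ').mul_left K) (fun m => ?_) ?_
  · have hc : Continuous fun t : ℝ =>
        ex (t * s₀ * (pairing m D.v : ℝ)) * evalPS (ex τ) (D.s m) := by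
      have := differentiable_ex.continuous
      fun_prop
    have := (hc.tendsto 0).mono_left (nhdsWithin_le_nhds (s := Set.Ioi 0))
    simpa [ex_zero] using this
  · filter_upwards [hsmall, self_mem_nhdsWithin] with t ht htpos m
    have htpos : 0 < t := htpos
    rw [norm_mul]
    have h3 : ‖ex (t * s₀ * (pairing m D.v : ℝ))‖ ≤
        Real.exp (2 * Real.pi * (t * (|s₀.im| * V))) ^ absSum m := by
      rw [norm_ex, ← Real.exp_nat_mul, Real.exp_le_exp]
      have h4 : (t * s₀ * (pairing m D.v : ℝ)).im = t * s₀.im * pairing m D.v := by simp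
      rw [h4, mul_comm (absSum m : ℝ), mul_assoc (2 * Real.pi), ← mul_neg]
      refine mul_le_mul_of_nonneg_left ?_ (by positivity)
      refine (neg_le_abs _).trans ?_
      rw [abs_mul, abs_mul, abs_of_pos htpos, mul_assoc, mul_assoc, mul_assoc]
      exact mul_le_mul_of_nonneg_left (mul_le_mul_of_nonneg_left (abs_pairing_le m D.v)
        (abs_nonneg _)) htpos.le
    calc _ ≤ Real.exp (2 * Real.pi * (t * (|s₀.im| * V))) ^ absSum m * (K * σ ^ absSum m) :=
          mul_le_mul h3 (heval m) (norm_nonneg _) (by positivity)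
      _ = K * (Real.exp (2 * Real.pi * (t * (|s₀.im| * V))) * σ) ^ absSum m := by
          rw [mul_pow]; ring
      _ ≤ _ := by gcongr

/-- The genus is the limit of the deformed contributions of the simplicial cones. -/
theorem tendsto_sum_deformed (τ : ℍ) {s₀ : ℂ} (hs₀ : 0 < s₀.im) :
    let _ := D.fintype
    Tendsto (fun t : ℝ => ∑ k, (D.P k).deformed D.v τ (t * s₀)) (𝓝[>] 0)
      (𝓝 (qValue (formalSum D.s) τ)) := by
  intro _
  refine (D.tendsto_tsum_ex_mul τ s₀).congr' ?_
  have hτ : 0 < (τ : ℂ).im := τ.im_pos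
  have h1 : Tendsto (fun t : ℝ => t * (s₀.im / (τ : ℂ).im)) (𝓝[>] 0) (𝓝[>] 0) := by
    refine tendsto_nhdsWithin_of_tendsto_nhds_of_eventually_within _ ?_ ?_
    · have hc : Continuous fun t : ℝ => t * (s₀.im / (τ : ℂ).im) := by fun_prop
      have := (hc.tendsto 0).mono_left (nhdsWithin_le_nhds (s := Set.Ioi 0))
      simpa using this
    · filter_upwards [self_mem_nhdsWithin] with t ht
      exact mul_pos ht (div_pos hs₀ hτ)
  -- For small `t` every parallelepiped satisfies the strip condition, so the sum over `m` may be
  -- split into the sums of the individual cones.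
  have h2 := h1.eventually (eventually_all.2 fun k => (D.P k).eventually_mem_Ioo (D.generic k))
  filter_upwards [h2] with t ht
  refine HasSum.tsum_eq ?_
  have h3 := hasSum_sum fun k (_ : k ∈ Finset.univ) =>
    (D.P k).hasSum_deformed (D.generic k) hτ (s := t * s₀) (by
      have : (t * s₀ : ℂ).im / (τ : ℂ).im = t * (s₀.im / (τ : ℂ).im) := by
        simp [mul_div_assoc]
      rw [this]
      exact ht k)
  refine h3.congr_fun fun m => ?_
  rw [D.s_eq, evalPS_sum _ fun k _ => wnorm_piecePS_lt_top _ _ _ (norm_ex_lt_one hτ),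
    Finset.mul_sum]

/-- The deformed sums at `τ'` with parameter `t s₀/(cτ+e)` and at `τ` with parameter `t s₀` differ
by the factor `(cτ+e)^d` for every `t`; letting `t → 0` gives the claim. -/
theorem qValue_modular (hd : Even d) (γ : SL(2, ℤ)) (hγ : γ ∈ CongruenceSubgroup.Gamma0 2) (τ : ℍ) :
    qValue (formalSum D.s) (γ • τ) =
      ((γ 1 0 : ℂ) * (τ : ℂ) + (γ 1 1 : ℂ)) ^ d * qValue (formalSum D.s) τ := by
  have hτ : 0 < (τ : ℂ).im := τ.im_pos
  have hτ' : 0 < ((γ • τ : ℍ) : ℂ).im := (γ • τ).im_pos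
  have hc : Even (γ 1 0) := by
    rw [CongruenceSubgroup.Gamma0_mem] at hγ
    exact (ZMod.intCast_zmod_eq_zero_iff_dvd _ 2).1 hγ |> even_iff_two_dvd.2
  have hdet : γ 0 0 * γ 1 1 - γ 0 1 * γ 1 0 = 1 := by
    rw [← Matrix.det_fin_two]
    exact γ.2
  have hcoe : ((γ • τ : ℍ) : ℂ) =
      ((γ 0 0 : ℂ) * τ + (γ 0 1 : ℂ)) / ((γ 1 0 : ℂ) * τ + (γ 1 1 : ℂ)) := by
    rw [UpperHalfPlane.coe_specialLinearGroup_apply]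
    simp
  generalize γ 0 0 = a at *
  generalize γ 0 1 = b at *
  generalize γ 1 0 = c at *
  generalize γ 1 1 = e at *
  generalize γ • τ = τ' at *
  have hw0 : (c * τ + e : ℂ) ≠ 0 := by
    intro h
    rw [h, div_zero] at hcoe
    rw [hcoe] at hτ'
    simp at hτ'
  have hw : (c * τ + e : ℂ) * τ' = a * τ + b := by
    rw [hcoe]
    field_simp
  -- For `c = 0` the parameters `s₀` and `s₀/e` cannot both lie in the upper half plane if `e = -1`.
  -- This case is a translation of `τ` by an integer, and `(-1)^d = 1` as `d` is even.
  by_cases hc0 : c = 0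
  · subst hc0
    have he : e = 1 ∨ e = -1 := Int.isUnit_iff.1 (IsUnit.of_mul_eq_one a (by linarith))
    have h1 : (((0 : ℤ) : ℂ) * τ + e) ^ d = 1 := by
      rcases he with rfl | rfl <;> simp [hd.neg_one_pow]
    have hex : ex τ' = ex τ := by
      rcases he with rfl | rfl
      · have ha : a = 1 := by linarith
        rw [ha] at hw
        have : (τ' : ℂ) = τ + b := by simpa using hw
        rw [this, ex_add, ex_int, mul_one]
      · have ha : a = -1 := by linarith
        rw [ha] at hw
        have : (τ' : ℂ) = τ + (-b : ℤ) := by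
          push_cast at hw ⊢
          linear_combination -hw
        rw [this, ex_add, ex_int, mul_one]
    rw [h1, one_mul, D.qValue_formalSum, D.qValue_formalSum, hex]
  · obtain ⟨s₀, h1, h2⟩ : ∃ s₀ : ℂ, 0 < s₀.im ∧ 0 < (s₀ / (c * τ + e)).im := by
      have him : (c * τ + e : ℂ).im ≠ 0 := by
        simp [hc0, τ.im_ne_zero]
      generalize (c * τ + e : ℂ) = w at *
      -- The quotient `s₀/w` has imaginary part 1 for any real shift of `I`; this shift makes the
      -- imaginary part of `s₀` equal to 1 as well.
      refine ⟨(Complex.I + ((1 - w.re) / w.im : ℝ)) * w, ?_, ?_⟩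
      · simp
        field_simp
        norm_num
      · rw [mul_div_assoc, div_self hw0]
        simp
    let _ := D.fintype
    have h3 := D.tendsto_sum_deformed τ' h2
    have h4 := (D.tendsto_sum_deformed τ h1).const_mul ((c * τ + e : ℂ) ^ d)
    refine tendsto_nhds_unique h3 (h4.congr fun t => ?_)
    rw [Finset.mul_sum]
    refine Finset.sum_congr rfl fun k _ => ?_
    rw [← Piece.deformed_modular (D.generic k) hτ hdet hc hτ' hw0 hw, mul_div_assoc]

end Fan.Contributions

end Genus

end ToricGenus

end

theorem theorem7p7 (d : ℕ) (hd : Even d) (F : ToricGenus.Fan d) (hF : F.IsComplete)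
    (hG : F.IsGorenstein) :
    F.EllWellDefined hG (-1) ∧
    (∀ τ : ℍ, Summable (ToricGenus.qTerm (F.ell hG (-1)) τ)) ∧
    (∀ τ : ℍ, Summable (ToricGenus.qTerm (F.normEll hG) τ)) ∧
    ∀ γ ∈ CongruenceSubgroup.Gamma0 2, ∀ τ : ℍ,
      ToricGenus.qValue (F.normEll hG) (γ • τ) =
        ((γ 1 0 : ℂ) * (τ : ℂ) + (γ 1 1 : ℂ)) ^ d * ToricGenus.qValue (F.normEll hG) τ := by
  obtain ⟨D⟩ := F.exists_contributions hF hG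
  rw [D.normEll_eq]
  exact ⟨D.ellWellDefined, D.summable_qTerm_ell, D.summable_qTerm_formalSum, D.qValue_modular hd⟩
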